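/- **Setting.** Let $A=\sqrt{-\Delta}$ on $\mathbb R^3$, $\langle x\rangle=\sqrt{1+x^2}$, and let $\|\cdot\|$ be the norm of $L^2=(L^2(\mathbb R^3))^3$. For $r<3/2$, $\dot H^r$ is the space of vector-valued tempered distributions $f$ whose Fourier transform is a measurable function with $\|f\|_{\dot H^r}=\|A^rf\|<\infty$; $H^r$ has the norm $\|f\|_{H^r}=\|\langle A\rangle^rf\|$. Let $M$ be a fixed real $3\times3$ matrix and let $P$ be a fixed measurable Fourier multiplier, $\widehat{Pf}(\xi)=P(\xi)\hat f(\xi)$, where $P(\xi)$ is an orthogonal projection for almost every $\xi$. Given $u_0$, write $Y(t)=e^{-tA^2}u_0$ and consider the integral equation $$X(t)=Y(t)+B(X,X)(t),\qquad B(u,v)(t)=-\int_0^te^{-(t-s)A^2}P(Mu(s)\cdot\nabla)v(s)\,ds. \tag{1}$$ Fields may be complex-valued; if $u_0$ is real-valued and $P$ maps real fields to real fields, then the solution $X$ below is real-valued as well. For $T>0$ put $I=]0,T]$ and $\bar I=[0,T]$. Given functions $\zeta,\theta$ on $I$, a number $s_1$ and a symbol $a$, let $\mathcal B$ be the space of $v$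 on $I$ for which $e^{-\zeta(t)}t^{s_1}e^{\theta(t)A}a(A)v(t)$ defines a bounded continuous function $I\to L^2$, with norm $$|v|=\sup_{t\in I}e^{-\zeta(t)}t^{s_1}\|e^{\theta(t)A}a(A)v(t)\|,$$ and let $\mathcal B^0\subseteq\mathcal B$ be the subspace where $t^{s_1}\|e^{\theta(t)A}a(A)v(t)\|\to0$ as $t\to0$. Finally, $BC(\bar I,\cdot)$ denotes bounded continuous functions on $\bar I$. **Theorem.** **(i)** Let $r\in\,]1/2,3/2[$ and $\epsilon\in\,]0,2r-1]$; put $\tilde r=\max(r,5/4)$, $s_1=\tilde r/2-r/4-1/8$, $s_2=\tilde r$, $a(A)=A^{s_2}$. Let $u_0\in\dot H^r$. There is $T_0>0$, depending on $u_0$ only through $\|A^ru_0\|$, such that for every $T\in\,]0,T_0]$ the following holds with $$\lambda_0=\sqrt{2r-1-\epsilon}\,\sqrt{|\ln T|},\quad \lambda(t)=\lambda_0\sqrt{t/T},\quad \theta(t)=\lambda(t)\sqrt t=\lambda_0t/\sqrt T,\quad \zeta(t)=\tfrac{\lambda(t)^2}4+(\tilde r-r)\ln\langle\lambda(t)\rangle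 .$$ One has $Y\in\mathcal B$, and equation (1) has a unique solution $X$ on $I$ in the ball $\{v\in\mathcal B:|v|\le2|Y|\}$. This $X$ belongs to $\mathcal B^0$, and (extended to $\bar I$) it obeys $e^{\theta A}X\in BC(\bar I,\dot H^r)$ with $X(0)=u_0$. Moreover $$\|e^{\theta(t)A}X(t)\|_{\dot H^r}\le C\,T^{-(r/2-1/4-\epsilon/4)}\quad\text{for all }t\in I .$$ If in addition $u_0\in L^2$ and $r\le5/4$, then $e^{\theta A}X\in BC(\bar I,H^r)$ and $$\|e^{\theta(t)A}X(t)\|\le\widetilde C\,T^{-(r/2-1/4-\epsilon/4)}\quad\text{for all }t\in I .$$ The constant $C$ depends on $u_0$ only through $\|A^ru_0\|$, and $\widetilde C$ only through $\|A^ru_0\|$ and $\|u_0\|$; neither depends on $t$ or on $T$. **(ii)** Let $r\in[5/4,\infty[$, $\tilde r\in[5/4,3/2[$ with $\tilde r\le r$, and $\epsilon\in\,]0,2\tilde r-1]$; put $s_1=\tilde r/4-1/8$, $s_2=r$, $a(A)=\langle A\rangle^{s_2}$. Let $u_0\in H^r$. There is $T_0>0$, depending on $u_0$ only through $\|\langle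 A\rangle^ru_0\|$, such that for every $T\in\,]0,T_0]$ the following holds with $$\lambda_0=\sqrt{2\tilde r-1-\epsilon}\,\sqrt{|\ln T|},\quad \lambda(t)=\lambda_0\sqrt{t/T},\quad\theta(t)=\lambda(t)\sqrt t,\quad\zeta(t)=\tfrac{\lambda(t)^2}4 .$$ One has $Y\in\mathcal B$, and equation (1) has a unique solution $X$ on $I$ in the ball $\{v\in\mathcal B:|v|\le2|Y|\}$. This $X$ belongs to $\mathcal B^0$, and (extended to $\bar I$) it obeys $e^{\theta A}X\in BC(\bar I,H^r)$ with $X(0)=u_0$. Moreover $$\|e^{\theta(t)A}X(t)\|_{H^r}\le C\,T^{-(\tilde r/2-1/4-\epsilon/4)}\quad\text{for all }t\in I,$$ where $C$ depends on $u_0$ only through $\|\langle A\rangle^ru_0\|$ and does not depend on $t$ or $T$. -/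

import Mathlib

open MeasureTheory Set Filter Topology
open scoped SchwartzMap FourierTransform LineDeriv ENNReal

noncomputable section

namespace NSE

/-- Physical space (and frequency space) `ℝ³`. -/
abbrev Space := EuclideanSpace ℝ (Fin 3)

/-- The (complexified) space of velocity vectors, `ℂ³` with its Euclidean norm. -/
abbrev Vec := EuclideanSpace ℂ (Fin 3)

/-- `(𝓢'(ℝ³))³`, realised as the `ℂ³`-valued tempered distributions. -/
abbrev VDist := 𝓢'(Space, Vec)

/-- `(L²(ℝ³))³` with norm `(‖f₁‖² + ‖f₂‖² + ‖f₃‖²)^{1/2}`. -/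
abbrev L2 := Lp Vec 2 (volume : Measure Space)

/-- The tempered distribution `u` is given by the (measurable, locally integrable) function `f`. -/
def IsGivenBy (u : VDist) (f : Space → Vec) : Prop :=
  ∀ φ : 𝓢(Space, ℂ), Integrable (fun x => φ x • f x) ∧ u φ = ∫ x, φ x • f x

/-- `w = m(-i∇) u`: the Fourier transforms of `u` and `w` are functions, and that of `w` is the one
of `u` multiplied by the (matrix-valued) symbol `m`. Mathlib's Fourier transform uses the kernel
`exp (-2πi⟨x, ξ⟩)`, so that `-i∇` acts as multiplication by `2πξ`. -/
def IsMultiplier (m : Space → Vec →L[ℂ] Vec) (u w : VDist) : Prop :=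
  ∃ g : Space → Vec, IsGivenBy (𝓕 u) g ∧
    IsGivenBy (𝓕 w) (fun ξ => m ((2 * Real.pi) • ξ) (g ξ))

/-- The scalar real symbol `a` as a matrix-valued symbol. -/
def scalarSymbol (a : Space → ℝ) : Space → Vec →L[ℂ] Vec :=
  fun p => (a p : ℂ) • ContinuousLinearMap.id ℂ Vec

/-- `‖a(-i∇) u‖` in `(L²)³`, with the value `∞` if `a(-i∇) u` is not in `(L²)³`. -/
def multNorm (a : Space → ℝ) (u : VDist) : ℝ≥0∞ :=
  ⨅ (f : L2) (_ : IsMultiplier (scalarSymbol a) u f), ‖f‖ₑ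

/-- `⟨x⟩ = (1 + x²)^{1/2}`. -/
def bracket (x : ℝ) : ℝ := Real.sqrt (1 + x ^ 2)

/-- The symbol `|p|^s` of `A^s`, where `A = (-Δ)^{1/2}`. -/
def homSymbol (s : ℝ) : Space → ℝ := fun p => ‖p‖ ^ s

/-- The symbol `⟨p⟩^s` of `⟨A⟩^s`. -/
def inhomSymbol (s : ℝ) : Space → ℝ := fun p => bracket ‖p‖ ^ s

/-- The symbol `e^{c|p|}` of `e^{cA}`. -/
def expSymbol (c : ℝ) : Space → ℝ := fun p => Real.exp (c * ‖p‖)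

/-- The symbol `e^{-t|p|²}` of the heat semigroup `e^{-tA²}`. -/
def heatSymbol (t : ℝ) : Space → ℝ := fun p => Real.exp (-t * ‖p‖ ^ 2)

/-- The homogeneous Sobolev space `(Ḣ^r)³`, `r < 3/2`: the Fourier transform is a function, and
`A^r u ∈ (L²)³`. -/
def MemHdot (r : ℝ) (u : VDist) : Prop :=
  ∃ f : L2, IsMultiplier (scalarSymbol (homSymbol r)) u f

/-- The Sobolev space `(H^r)³`: `⟨A⟩^r u ∈ (L²)³`. -/
def MemH (r : ℝ) (u : VDist) : Prop :=
  ∃ f : L2, IsMultiplier (scalarSymbol (inhomSymbol r)) u f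

/-- `u ∈ (L²)³`. -/
def MemL2 (u : VDist) : Prop := ∃ f : L2, u = f

/-- The norm of `u` in `(L²)³`, with the value `∞` if `u` is not in `(L²)³`. -/
def normL2 (u : VDist) : ℝ≥0∞ := ⨅ (f : L2) (_ : u = f), ‖f‖ₑ

/-- The expression `t ↦ a_t(-i∇) v(t)` defines an element of `BC(J, (L²)³)`. -/
def DefinesBC (J : Set ℝ) (a : ℝ → Space → ℝ) (v : ℝ → VDist) : Prop :=
  ∃ F : ℝ → L2, (∀ t ∈ J, IsMultiplier (scalarSymbol (a t)) (v t) (F t)) ∧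
    ContinuousOn F J ∧ ∃ C : ℝ, ∀ t ∈ J, ‖F t‖ ≤ C

/-- `v` belongs to the space `𝓑_{ζ,θ,]0,T],s₁}` with spatial symbol `a` (either `|p|^{s₂}` or
`⟨p⟩^{s₂}`): the expression `e^{-ζ(t)} t^{s₁} e^{θ(t)A} a(-i∇) v(t)` is in `BC(]0,T], (L²)³)`. -/
def MemB (ζ θ : ℝ → ℝ) (T s₁ : ℝ) (a : Space → ℝ) (v : ℝ → VDist) : Prop :=
  DefinesBC (Ioc 0 T)
    (fun t p => Real.exp (-ζ t) * t ^ s₁ * (expSymbol (θ t) p * a p)) v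

/-- The norm `sup_{0 < t ≤ T} e^{-ζ(t)} t^{s₁} ‖e^{θ(t)A} a(-i∇) v(t)‖` of the space `𝓑`. -/
def normB (ζ θ : ℝ → ℝ) (T s₁ : ℝ) (a : Space → ℝ) (v : ℝ → VDist) : ℝ≥0∞ :=
  ⨆ t ∈ Ioc 0 T, ENNReal.ofReal (Real.exp (-ζ t) * t ^ s₁) *
    multNorm (fun p => expSymbol (θ t) p * a p) (v t)

/-- `v` belongs to the subspace `𝓑⁰` of `𝓑`: in addition `t^{s₁} ‖e^{θ(t)A} a(-i∇) v(t)‖ → 0` as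
`t → 0`. -/
def MemB0 (ζ θ : ℝ → ℝ) (T s₁ : ℝ) (a : Space → ℝ) (v : ℝ → VDist) : Prop :=
  MemB ζ θ T s₁ a v ∧
    Tendsto (fun t => ENNReal.ofReal (t ^ s₁) *
      multNorm (fun p => expSymbol (θ t) p * a p) (v t)) (𝓝[>] 0) (𝓝 0)

/-- `w = (M u · ∇) v`: the distributions `u` and `∂₁v, ∂₂v, ∂₃v` are functions, and `w` is the
function `∑ⱼ (M u)ⱼ ∂ⱼ v`, formed pointwise. -/
def IsAdvection (M : Matrix (Fin 3) (Fin 3) ℝ) (u v w : VDist) : Prop :=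
  ∃ (f : Space → Vec) (g : Fin 3 → Space → Vec), IsGivenBy u f ∧
    (∀ j, IsGivenBy (∂_{(EuclideanSpace.single j 1 : Space)} v) (g j)) ∧
    IsGivenBy w (fun x => ∑ j, (∑ k, (M j k : ℂ) * f x k) • g j x)

/-- `b = B(u,v)(t) = -∫₀ᵗ e^{-(t-s)A²} P (M u(s) · ∇) v(s) ds`, the integral being that of an
`𝓢'`-valued function (i.e. taken after pairing with any Schwartz function). -/
def IsBilinear (M : Matrix (Fin 3) (Fin 3) ℝ) (P : Space → Vec →L[ℂ] Vec)
    (u v : ℝ → VDist) (t : ℝ) (b : VDist) : Prop :=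
  ∃ G : ℝ → VDist,
    (∀ s ∈ Ioo 0 t, ∃ N : VDist, IsAdvection M (u s) (v s) N ∧
      IsMultiplier (fun p => (heatSymbol (t - s) p : ℂ) • P p) N (G s)) ∧
    ∀ φ : 𝓢(Space, ℂ), IntegrableOn (fun s => G s φ) (Ioo 0 t) ∧
      b φ = -∫ s in Ioo 0 t, G s φ

/-- `Y(t) = e^{-tA²} u₀` for `0 < t ≤ T`. -/
def IsHeatFlow (u₀ : VDist) (T : ℝ) (Y : ℝ → VDist) : Prop :=
  ∀ t ∈ Ioc 0 T, IsMultiplier (scalarSymbol (heatSymbol t)) u₀ (Y t)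

/-- The integral equation `X = Y + B(X,X)` on `]0,T]`. -/
def SolvesIntegralEq (M : Matrix (Fin 3) (Fin 3) ℝ) (P : Space → Vec →L[ℂ] Vec)
    (T : ℝ) (Y X : ℝ → VDist) : Prop :=
  ∀ t ∈ Ioc 0 T, ∃ b : VDist, IsBilinear M P X X t b ∧ X t = Y t + b

/-- `X` solves `X = Y + B(X,X)` on `]0,T]`, lies in the ball `B_{2|Y|}` of `𝓑`, and is (on `]0,T]`)
the only such function. -/
def IsUniqueSolInBall (M : Matrix (Fin 3) (Fin 3) ℝ) (P : Space → Vec →L[ℂ] Vec)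
    (ζ θ : ℝ → ℝ) (T s₁ : ℝ) (a : Space → ℝ) (Y X : ℝ → VDist) : Prop :=
  (MemB ζ θ T s₁ a X ∧ normB ζ θ T s₁ a X ≤ 2 * normB ζ θ T s₁ a Y ∧
    SolvesIntegralEq M P T Y X) ∧
  ∀ X' : ℝ → VDist, MemB ζ θ T s₁ a X' → normB ζ θ T s₁ a X' ≤ 2 * normB ζ θ T s₁ a Y →
    SolvesIntegralEq M P T Y X' → ∀ t ∈ Ioc 0 T, X' t = X t

/-- `u` is real, i.e. `ℝ³`-valued: it takes values in `ℝ³` on real test functions. -/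
def IsReal (u : VDist) : Prop :=
  ∀ φ : 𝓢(Space, ℂ), (∀ x, (φ x).im = 0) → ∀ i, (u φ i).im = 0

/-- The symbol `P` defines an operator that maps real fields to real fields:
`P(-p)` is the complex conjugate of the matrix `P(p)` for almost every `p`. -/
def IsRealSymbol (P : Space → Vec →L[ℂ] Vec) : Prop :=
  ∀ᵐ p, ∀ i j, P (-p) (EuclideanSpace.single i 1) j =
    (starRingEnd ℂ) (P p (EuclideanSpace.single i 1) j)

/-- `λ(t) = λ₀ √(t/T)`. -/
def lam (lam₀ T t : ℝ) : ℝ := lam₀ * Real.sqrt (t / T)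

/-- `θ(t) = λ(t) √t`, that is, `θ(t) = λ₀ t / √T`. -/
def thetaFun (lam₀ T t : ℝ) : ℝ := lam lam₀ T t * Real.sqrt t

/-- `ζ(t) = λ(t)²/4 + c ln ⟨λ(t)⟩`. -/
def zetaFun (c lam₀ T t : ℝ) : ℝ :=
  lam lam₀ T t ^ 2 / 4 + c * Real.log (bracket (lam lam₀ T t))

/-- `λ₀ = √(2ρ - 1 - ε) √|ln T|`. -/
def lamZero (ρ ε T : ℝ) : ℝ := Real.sqrt (2 * ρ - 1 - ε) * Real.sqrt |Real.log T|

end NSE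

end

/-!
The equation is solved on the Fourier side. A field is described by its *profile* `h ∈ L²`, which
is `a(-i∇)u` seen in frequency space, where `a` is the weight of the space (`HasProfile`). With
`a` of order `σ ∈ [5/4, 3/2[`, the profile of the advection term `(Mu·∇)v`, taken with a weight `b`
of order `2σ - 5/2`, is a weighted convolution of the profiles of `u` and `v`. It is bounded on
`L² × L²` by a product estimate for power weights (`lintegral_conv_negPow_le`,
`exists_isWeightPair_hom`, `exists_isWeightPair_inhom`). This bound survives the factors `e^{θA}`
with a constant independent of `θ`, since `e^{c|ξ|} ≤ e^{c|ξ-η|} e^{c|η|}`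
(`enorm_interOp_exp_le`).

In `B(u,v)(t)` both arguments at time `s` carry `e^{μsA}` with `μ = λ₀/√T`, so the exponential that
remains to be absorbed is `e^{μ(t-s)|ξ| - (t-s)|ξ|²} ≤ e^{μ²(t-s)/4}`. Here
`μ²t/4 = λ(t)²/4` is the leading term of `ζ`, and derivatives cost powers of `(t-s)^{-1/2}` and of
`⟨λ⟩` (`bracket_rpow_mul_exp_le`, `norm_kerOp_le`). The Duhamel integral then converges like a beta
integral, and `B` is bounded on `𝓑` with a constant which is at most `e^{λ₀²/4}` times a power of
`⟨λ₀⟩` and a positive power of `T`. The choice of `λ₀` makes `e^{λ₀²/4} = T^{-(ρ/2-1/4-ε/4)}`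
(`exp_lamZero_sq`), so a factor `T^{ε/4}`, which beats every power of `⟨λ₀⟩`, is left over
(`exists_bilinConst_le`), and for small `T` the contraction principle applies
(`IsBddBilin.exists_fixedPoint`).

To pass between profiles and distributions, the pointwise product of two inverse Fourier transforms
of functions that need not be integrable is identified with the inverse Fourier transform of the
convolution (`integral_mul_fourierInv`). This gives `IsWeightPair.isAdvection`, and
`isBilinear_iff` then turns the integral equation into the fixed point equation for profiles, in
both directions; the converse direction is what uniqueness in `𝓑` needs.

The heat flow of data in the space of order `ρ` decays in the norm of `𝓑` like a positive power of
`t`, and the solution inherits this (`IsSolProfile.norm_le`). Hence it lies in `𝓑⁰`, and reinserting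
the decay in the Duhamel integral, now measured with the weight of the data, shows that the
nonlinear part tends to `0` with `t` and is bounded as claimed (`IsSolProfile.regularity`). The
real-valued case follows from the uniqueness of the fixed point: conjugation of fields acts on
profiles as `h ↦ conj h(-·)` and commutes with every operator involved
(`IsSolProfile.reflConj_eq`).

Both parts are instances of one statement (`IsWeightSystem.exists_solution`) with data of order `ρ`
and solutions of order `σ`: in (i) `ρ = r` and `σ = max r (5/4)`, with homogeneous weights; in (ii)
`ρ = σ` is the parameter `r̃`, and all weights are inhomogeneous with `r - r̃` additional
derivatives.
-/

namespace NSE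

noncomputable section

/-! ### Fourier multipliers as operators on the frequency side -/

/-- The symbol `m`, read in Mathlib's frequency variable `ξ = p / (2π)`, is measurable and bounded
by `C` almost everywhere. -/
def IsBddSymbol (m : Space → Vec →L[ℂ] Vec) (C : ℝ) : Prop :=
  AEStronglyMeasurable (fun ξ : Space => m ((2 * Real.pi) • ξ)) volume ∧
    ∀ᵐ ξ : Space, ‖m ((2 * Real.pi) • ξ)‖ ≤ C

lemma quasiMeasurePreserving_dilation :
    Measure.QuasiMeasurePreserving (fun ξ : Space => (2 * Real.pi) • ξ) volume volume := by
  have h : (2 * Real.pi) ≠ 0 := by positivity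
  refine ⟨measurable_const_smul _, ?_⟩
  rw [Measure.map_addHaar_smul _ h]
  exact Measure.smul_absolutelyContinuous

lemma IsBddSymbol.memLp {m : Space → Vec →L[ℂ] Vec} {C : ℝ} (hm : IsBddSymbol m C) (f : L2) :
    MemLp (fun ξ => m ((2 * Real.pi) • ξ) (f ξ)) 2 (volume : Measure Space) := by
  refine MemLp.of_le_mul (c := C) (Lp.memLp f) ?_ ?_
  · exact (ContinuousLinearMap.apply ℂ Vec).flip.aestronglyMeasurable_comp₂ hm.1
      (Lp.aestronglyMeasurable f)
  · filter_upwards [hm.2] with ξ hξ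
    exact (ContinuousLinearMap.le_opNorm _ _).trans (by gcongr)

lemma ae_ne_zero : ∀ᵐ ξ : Space, ξ ≠ 0 := by
  simp [ae_iff]

lemma two_pi_smul_ne_zero {ξ : Space} (h : ξ ≠ 0) : (2 * Real.pi) • ξ ≠ 0 :=
  smul_ne_zero (by positivity) h

lemma isBddSymbol_scalar {m : Space → ℝ} {C : ℝ} (hm : Measurable m)
    (hC : ∀ p, p ≠ 0 → |m p| ≤ C) : IsBddSymbol (scalarSymbol m) C := by
  constructor
  · have : Measurable fun ξ : Space => m ((2 * Real.pi) • ξ) :=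
      hm.comp (measurable_const_smul _)
    exact ((Complex.measurable_ofReal.comp this).aestronglyMeasurable).smul
      aestronglyMeasurable_const
  · filter_upwards [ae_ne_zero] with ξ hξ
    simp only [scalarSymbol]
    rw [norm_smul]
    calc _ ≤ ‖((m ((2 * Real.pi) • ξ) : ℝ) : ℂ)‖ * 1 := by
          gcongr; exact ContinuousLinearMap.norm_id_le
      _ ≤ C := by
          rw [mul_one, Complex.norm_real]; exact hC _ (two_pi_smul_ne_zero hξ)

open Classical in
/-- The operator of multiplication by the symbol `ξ ↦ m (2πξ)` on `L²` (and `0` if the symbol is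
not measurable and bounded). -/
def mulOp (m : Space → Vec →L[ℂ] Vec) : L2 →L[ℂ] L2 :=
  if h : ∃ C, IsBddSymbol m C then
    LinearMap.mkContinuous
      { toFun := fun f => (h.choose_spec.memLp f).toLp
        map_add' := by
          intro f g
          ext1
          filter_upwards [(h.choose_spec.memLp (f + g)).coeFn_toLp,
            (h.choose_spec.memLp f).coeFn_toLp, (h.choose_spec.memLp g).coeFn_toLp,
            Lp.coeFn_add f g, Lp.coeFn_add (h.choose_spec.memLp f).toLp
              (h.choose_spec.memLp g).toLp] with ξ h1 h2 h3 h4 h5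
          rw [h1, h5, Pi.add_apply, h2, h3, h4, Pi.add_apply, map_add]
        map_smul' := by
          intro c f
          ext1
          filter_upwards [(h.choose_spec.memLp (c • f)).coeFn_toLp,
            (h.choose_spec.memLp f).coeFn_toLp,
            Lp.coeFn_smul c f, Lp.coeFn_smul c (h.choose_spec.memLp f).toLp] with ξ h1 h2 h4 h5
          rw [h1, RingHom.id_apply, h5, Pi.smul_apply, h2, h4, Pi.smul_apply, map_smul] }
      h.choose (by
        intro f
        refine Lp.norm_le_mul_norm_of_ae_le_mul ?_
        filter_upwards [(h.choose_spec.memLp f).coeFn_toLp, h.choose_spec.2] with ξ h1 h2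
        simp only [LinearMap.coe_mk, AddHom.coe_mk]
        rw [h1]
        exact (ContinuousLinearMap.le_opNorm _ _).trans (by gcongr))
  else 0

lemma coeFn_mulOp {m : Space → Vec →L[ℂ] Vec} {C : ℝ} (hm : IsBddSymbol m C) (f : L2) :
    mulOp m f =ᵐ[volume] fun ξ => m ((2 * Real.pi) • ξ) (f ξ) := by
  have h : ∃ C, IsBddSymbol m C := ⟨C, hm⟩
  rw [mulOp, dif_pos h]
  exact (h.choose_spec.memLp f).coeFn_toLp

lemma norm_mulOp_apply_le {m : Space → Vec →L[ℂ] Vec} {C : ℝ} (hm : IsBddSymbol m C) (f : L2) :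
    ‖mulOp m f‖ ≤ C * ‖f‖ := by
  refine Lp.norm_le_mul_norm_of_ae_le_mul ?_
  filter_upwards [coeFn_mulOp hm f, hm.2] with ξ h1 h2
  rw [h1]
  exact (ContinuousLinearMap.le_opNorm _ _).trans (by gcongr)

attribute [irreducible] mulOp

lemma coeFn_mulOp_scalar {m : Space → ℝ} {C : ℝ} (hm : IsBddSymbol (scalarSymbol m) C) (f : L2) :
    mulOp (scalarSymbol m) f =ᵐ[volume] fun ξ => (m ((2 * Real.pi) • ξ) : ℂ) • f ξ :=
  coeFn_mulOp hm f

lemma tendsto_mulOp_of_tendsto_symbol {ι : Type*} {l : Filter ι} [l.IsCountablyGenerated]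
    {m : ι → Space → Vec →L[ℂ] Vec} {m₀ : Space → Vec →L[ℂ] Vec} {C : ℝ}
    (hm : ∀ᶠ i in l, IsBddSymbol (m i) C) (hm₀ : IsBddSymbol m₀ C)
    (hlim : ∀ᵐ ξ : Space, Tendsto (fun i => m i ((2 * Real.pi) • ξ)) l
      (𝓝 (m₀ ((2 * Real.pi) • ξ)))) (f : L2) :
    Tendsto (fun i => mulOp (m i) f) l (𝓝 (mulOp m₀ f)) := by
  refine tendsto_of_seq_tendsto fun u hu => ?_
  obtain ⟨N, hN⟩ := eventually_atTop.1 (hu.eventually hm)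
  rw [← tendsto_add_atTop_iff_nat N]
  replace hm : ∀ n, IsBddSymbol (m (u (n + N))) C := fun n => hN _ (by omega)
  have hu' : Tendsto (fun n => u (n + N)) atTop l := (tendsto_add_atTop_iff_nat N).2 hu
  rw [Lp.tendsto_Lp_iff_tendsto_eLpNorm']
  have key : Tendsto (fun n => ∫⁻ ξ, ‖m (u (n + N)) ((2 * Real.pi) • ξ) (f ξ)
      - m₀ ((2 * Real.pi) • ξ) (f ξ)‖ₑ ^ (2 : ℝ)) atTop (𝓝 (∫⁻ _ : Space, 0)) := by
    refine tendsto_lintegral_of_dominated_convergence'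
      (fun ξ => (ENNReal.ofReal (2 * C) * ‖f ξ‖ₑ) ^ (2 : ℝ)) ?_ ?_ ?_ ?_
    · exact fun n => (((hm n).memLp f).1.sub (hm₀.memLp f).1).enorm.pow_const _
    · intro n
      filter_upwards [(hm n).2, hm₀.2] with ξ h1 h2
      gcongr
      have : ‖m (u (n + N)) ((2 * Real.pi) • ξ) (f ξ) - m₀ ((2 * Real.pi) • ξ) (f ξ)‖
          ≤ (2 * C) * ‖f ξ‖ := by
        refine (norm_sub_le _ _).trans ?_
        have e1 := (ContinuousLinearMap.le_opNorm (m (u (n + N)) ((2 * Real.pi) • ξ)) (f ξ))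
        have e2 := (ContinuousLinearMap.le_opNorm (m₀ ((2 * Real.pi) • ξ)) (f ξ))
        nlinarith [norm_nonneg (f ξ)]
      have hC : 0 ≤ 2 * C := by linarith [norm_nonneg (m₀ ((2 * Real.pi) • ξ))]
      rw [← ofReal_norm, ← ofReal_norm, ← ENNReal.ofReal_mul hC]
      exact ENNReal.ofReal_le_ofReal this
    · simp_rw [ENNReal.mul_rpow_of_nonneg _ _ (by norm_num : (0:ℝ) ≤ 2)]
      rw [lintegral_const_mul'' _ ((Lp.aestronglyMeasurable f).enorm.pow_const _)]
      refine ENNReal.mul_ne_top (ENNReal.rpow_ne_top_of_nonneg (by norm_num) ENNReal.ofReal_ne_top)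
          ?_
      have := (Lp.memLp f).2
      rw [eLpNorm_lt_top_iff_lintegral_rpow_enorm_lt_top (by simp) (by simp)] at this
      simpa using this.ne
    · filter_upwards [hlim] with ξ hξ
      have h1 : Tendsto (fun n => m (u (n + N)) ((2 * Real.pi) • ξ) (f ξ)
          - m₀ ((2 * Real.pi) • ξ) (f ξ)) atTop
          (𝓝 (m₀ ((2 * Real.pi) • ξ) (f ξ) - m₀ ((2 * Real.pi) • ξ) (f ξ))) :=
        (((ContinuousLinearMap.apply ℂ Vec (f ξ)).continuous.tendsto _).comp
          (hξ.comp hu')).sub_const _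
      rw [sub_self] at h1
      have h3 : Continuous fun v : Vec => ‖v‖ₑ ^ (2 : ℝ) :=
        (ENNReal.continuous_rpow_const (y := 2)).comp continuous_enorm
      have h2 := (h3.tendsto 0).comp h1
      simpa [Function.comp_def] using h2
  simp only [lintegral_zero] at key
  have h2 := (ENNReal.continuous_rpow_const (y := (1 / 2 : ℝ))).tendsto 0 |>.comp key
  simp only [ENNReal.zero_rpow_of_pos (by norm_num : (0:ℝ) < 1 / 2)] at h2
  refine h2.congr fun n => ?_
  rw [eLpNorm_eq_lintegral_rpow_enorm_toReal (by simp) (by simp)]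
  simp only [Function.comp, ENNReal.toReal_ofNat]
  congr 1
  refine lintegral_congr_ae ?_
  filter_upwards [coeFn_mulOp (hm n) f, coeFn_mulOp hm₀ f] with ξ h1 h2
  simp [h1, h2]

/-- Joint continuity of multiplication: symbols converging boundedly pointwise, applied to
convergent vectors. -/
lemma tendsto_mulOp {ι : Type*} {l : Filter ι} [l.IsCountablyGenerated]
    {m : ι → Space → Vec →L[ℂ] Vec} {m₀ : Space → Vec →L[ℂ] Vec} {C : ℝ}
    (hm : ∀ᶠ i in l, IsBddSymbol (m i) C) (hm₀ : IsBddSymbol m₀ C)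
    (hlim : ∀ᵐ ξ : Space, Tendsto (fun i => m i ((2 * Real.pi) • ξ)) l
      (𝓝 (m₀ ((2 * Real.pi) • ξ)))) {f : ι → L2} {f₀ : L2} (hf : Tendsto f l (𝓝 f₀)) :
    Tendsto (fun i => mulOp (m i) (f i)) l (𝓝 (mulOp m₀ f₀)) := by
  have h1 : Tendsto (fun i => mulOp (m i) (f i - f₀)) l (𝓝 0) := by
    rw [tendsto_zero_iff_norm_tendsto_zero]
    have h2 : Tendsto (fun i => C * ‖f i - f₀‖) l (𝓝 0) := by
      simpa using (tendsto_iff_norm_sub_tendsto_zero.1 hf).const_mul C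
    refine squeeze_zero' (Eventually.of_forall fun _ => norm_nonneg _) ?_ h2
    filter_upwards [hm] with i hi
    exact norm_mulOp_apply_le hi _
  simpa using h1.add (tendsto_mulOp_of_tendsto_symbol hm hm₀ hlim f₀)

end

end NSE
namespace NSE

noncomputable section

/-! ### The advection term on the frequency side -/

/-- The functional `u ↦ i (M u) · p`, the symbol of `M u · ∇` at frequency `p`. -/
def advLin (M : Matrix (Fin 3) (Fin 3) ℝ) (p : Space) : Vec →L[ℂ] ℂ :=
  ∑ j, ∑ k, (Complex.I * (M j k : ℂ) * (p j : ℂ)) • (EuclideanSpace.proj k : Vec →L[ℂ] ℂ)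

/-- A bound for the bilinear map `(u, p) ↦ i (M u) · p`. -/
def matConst (M : Matrix (Fin 3) (Fin 3) ℝ) : ℝ := ∑ j, ∑ k, |M j k|

lemma matConst_nonneg (M : Matrix (Fin 3) (Fin 3) ℝ) : 0 ≤ matConst M :=
  Finset.sum_nonneg fun _ _ => Finset.sum_nonneg fun _ _ => abs_nonneg _

lemma advLin_apply (M : Matrix (Fin 3) (Fin 3) ℝ) (p : Space) (u : Vec) :
    advLin M p u = ∑ j, (∑ k, (M j k : ℂ) * u k) * (Complex.I * (p j : ℂ)) := by
  simp only [advLin, sum_apply, smul_apply, smul_eq_mul,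
    PiLp.proj_apply, Finset.sum_mul]
  refine Finset.sum_congr rfl fun j _ => Finset.sum_congr rfl fun k _ => ?_
  ring

lemma norm_advLin_apply_le (M : Matrix (Fin 3) (Fin 3) ℝ) (p : Space) (u : Vec) :
    ‖advLin M p u‖ ≤ matConst M * ‖p‖ * ‖u‖ := by
  simp only [advLin, sum_apply, smul_apply, smul_eq_mul,
    PiLp.proj_apply, matConst, Finset.sum_mul]
  refine (norm_sum_le _ _).trans (Finset.sum_le_sum fun j _ => ?_)
  refine (norm_sum_le _ _).trans (Finset.sum_le_sum fun k _ => ?_)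
  simp only [norm_mul, Complex.norm_I, one_mul, Complex.norm_real, Real.norm_eq_abs]
  gcongr
  · exact PiLp.norm_apply_le p j
  · exact PiLp.norm_apply_le u k

lemma measurable_advLin (M : Matrix (Fin 3) (Fin 3) ℝ) :
    Measurable fun x : Space × Vec => advLin M x.1 x.2 := by
  simp only [advLin_apply]
  fun_prop

/-- The integrand of the majorant of the frequency-side advection term. -/
def absKernel (a : Space → ℝ) (F G : Space → ℝ≥0∞) (ξ η : Space) : ℝ≥0∞ :=
  (ENNReal.ofReal (a ((2 * Real.pi) • η))⁻¹ * F η) *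
    (ENNReal.ofReal (‖(2 * Real.pi) • (ξ - η)‖ * (a ((2 * Real.pi) • (ξ - η)))⁻¹) * G (ξ - η))

/-- Functions `a` (the weight in which fields are measured) and `b` (the weight in which the
advection term is measured) for which `‖b(A)(Mu·∇)v‖ ≤ C ‖a(A)u‖ ‖a(A)v‖` holds, with the moduli of
the Fourier transforms in the place of the latter. The weights are such that division of an `L²`
function by `a` or `b`, or by `a` after multiplication by `|p|`, gives an element of `L¹ + L²`. -/
structure IsWeightPair (a b : Space → ℝ) (C : ℝ) : Prop where
  nonneg : 0 ≤ C
  meas_a : Measurable a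
  meas_b : Measurable b
  pos_a : ∀ p, p ≠ 0 → 0 < a p
  pos_b : ∀ p, p ≠ 0 → 0 < b p
  bilin : ∀ F G : Space → ℝ≥0∞, Measurable F → Measurable G →
    ∫⁻ ξ, (ENNReal.ofReal (b ((2 * Real.pi) • ξ)) * ∫⁻ η, absKernel a F G ξ η) ^ (2 : ℝ) ≤
      ENNReal.ofReal C ^ (2 : ℝ) * ((∫⁻ ξ, F ξ ^ (2 : ℝ)) * ∫⁻ ξ, G ξ ^ (2 : ℝ))

/-- The integrand of the frequency-side advection term `F((Mu·∇)v)`, with `h = a û`, `k = a v̂`. -/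
def interKernel (M : Matrix (Fin 3) (Fin 3) ℝ) (a : Space → ℝ) (h k : Space → Vec)
    (ξ η : Space) : Vec :=
  (advLin M ((2 * Real.pi) • (ξ - η)) (h η) *
    (((a ((2 * Real.pi) • η))⁻¹ * (a ((2 * Real.pi) • (ξ - η)))⁻¹ : ℝ) : ℂ)) • k (ξ - η)

/-- The frequency-side advection term in the weight `b`. -/
def interFun (M : Matrix (Fin 3) (Fin 3) ℝ) (a b : Space → ℝ) (h k : Space → Vec)
    (ξ : Space) : Vec :=
  (b ((2 * Real.pi) • ξ) : ℂ) • ∫ η, interKernel M a h k ξ η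

variable {M : Matrix (Fin 3) (Fin 3) ℝ} {a b : Space → ℝ} {C : ℝ}

lemma measurable_interKernel (ha : Measurable a) {h k : Space → Vec} (hh : Measurable h)
    (hk : Measurable k) : Measurable fun x : Space × Space => interKernel M a h k x.1 x.2 := by
  unfold interKernel
  have h1 : Measurable fun x : Space × Space => ((2 * Real.pi) • (x.1 - x.2), h x.2) := by fun_prop
  have h2 := (measurable_advLin M).comp h1
  exact (h2.mul (by fun_prop)).smul (by fun_prop)

lemma measurable_absKernel (ha : Measurable a) {F G : Space → ℝ≥0∞} (hF : Measurable F)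
    (hG : Measurable G) : Measurable fun x : Space × Space => absKernel a F G x.1 x.2 := by
  unfold absKernel
  fun_prop

lemma IsWeightPair.enorm_interKernel_le (hw : IsWeightPair a b C) (h k : Space → Vec)
    (ξ η : Space) (h0 : η ≠ 0) (h1 : ξ - η ≠ 0) : ‖interKernel M a h k ξ η‖ₑ ≤
      ENNReal.ofReal (matConst M) * absKernel a (fun x => ‖h x‖ₑ) (fun x => ‖k x‖ₑ) ξ η := by
  have p1 := hw.pos_a _ (two_pi_smul_ne_zero h0)
  have p2 := hw.pos_a _ (two_pi_smul_ne_zero h1)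
  simp only [interKernel, absKernel]
  rw [← ofReal_norm, ← ofReal_norm, ← ofReal_norm, ← ENNReal.ofReal_mul (by positivity),
    ← ENNReal.ofReal_mul (by positivity), ← ENNReal.ofReal_mul (by positivity),
    ← ENNReal.ofReal_mul (matConst_nonneg M)]
  refine ENNReal.ofReal_le_ofReal ?_
  rw [norm_smul, norm_mul, Complex.norm_real, Real.norm_eq_abs, abs_of_pos (by positivity)]
  calc _ ≤ (matConst M * ‖(2 * Real.pi) • (ξ - η)‖ * ‖h η‖) * ((a ((2 * Real.pi) • η))⁻¹ *
        (a ((2 * Real.pi) • (ξ - η)))⁻¹) * ‖k (ξ - η)‖ := by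
        gcongr; exact norm_advLin_apply_le _ _ _
    _ = _ := by ring

lemma ae_sub_ne_zero (ξ : Space) : ∀ᵐ η : Space, ξ - η ≠ 0 := by
  have : {η : Space | ¬ (ξ - η ≠ 0)} = {ξ} := by ext; simp [sub_eq_zero, eq_comm]
  rw [ae_iff, this]; simp

lemma IsWeightPair.lintegral_interKernel_le (hw : IsWeightPair a b C) (h k : Space → Vec)
    (ξ : Space) : ∫⁻ η, ‖interKernel M a h k ξ η‖ₑ ≤ ENNReal.ofReal (matConst M) *
      ∫⁻ η, absKernel a (fun x => ‖h x‖ₑ) (fun x => ‖k x‖ₑ) ξ η := by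
  rw [← lintegral_const_mul' _ _ (by simp)]
  refine lintegral_mono_ae ?_
  filter_upwards [ae_ne_zero, ae_sub_ne_zero ξ] with η h0 h1
  exact hw.enorm_interKernel_le h k ξ η h0 h1

lemma IsWeightPair.enorm_interFun_le (hw : IsWeightPair a b C) (h k : Space → Vec)
    {ξ : Space} (hξ : ξ ≠ 0) : ‖interFun M a b h k ξ‖ₑ ≤ ENNReal.ofReal (matConst M) *
      (ENNReal.ofReal (b ((2 * Real.pi) • ξ)) *
        ∫⁻ η, absKernel a (fun x => ‖h x‖ₑ) (fun x => ‖k x‖ₑ) ξ η) := by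
  unfold interFun
  rw [enorm_smul, ← ofReal_norm (_ : ℂ), Complex.norm_real, Real.norm_eq_abs,
    abs_of_pos (hw.pos_b _ (two_pi_smul_ne_zero hξ)), mul_left_comm]
  gcongr
  exact (enorm_integral_le_lintegral_enorm _).trans (hw.lintegral_interKernel_le h k ξ)

lemma lintegral_enorm_sq_coeFn (h : L2) : ∫⁻ ξ, ‖h ξ‖ₑ ^ (2 : ℝ) = ‖h‖ₑ ^ (2 : ℝ) := by
  rw [Lp.enorm_def, eLpNorm_eq_lintegral_rpow_enorm_toReal (by simp) (by simp),
    ← ENNReal.rpow_mul]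
  simp

/-- A function majorised by the majorant of the advection term has a controlled `L²` norm. -/
lemma IsWeightPair.eLpNorm_le (hw : IsWeightPair a b C) (h k : L2) {A : ℝ≥0∞} {u : Space → Vec}
    (hu : ∀ᵐ ξ, ‖u ξ‖ₑ ≤ A * (ENNReal.ofReal (b ((2 * Real.pi) • ξ)) *
        ∫⁻ η, absKernel a (fun x => ‖h x‖ₑ) (fun x => ‖k x‖ₑ) ξ η)) :
    eLpNorm u 2 volume ≤ A * (ENNReal.ofReal C * (‖h‖ₑ * ‖k‖ₑ)) := by
  rw [eLpNorm_eq_lintegral_rpow_enorm_toReal (by simp) (by simp)]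
  have mh : Measurable fun x => ‖h x‖ₑ := (Lp.stronglyMeasurable h).enorm
  have mk : Measurable fun x => ‖k x‖ₑ := (Lp.stronglyMeasurable k).enorm
  have h1 : ∫⁻ ξ, ‖u ξ‖ₑ ^ (2 : ℝ) ≤ (A * (ENNReal.ofReal C * (‖h‖ₑ * ‖k‖ₑ))) ^ (2 : ℝ) := by
    calc _ ≤ ∫⁻ ξ, (A * (ENNReal.ofReal (b ((2 * Real.pi) • ξ)) *
        ∫⁻ η, absKernel a (fun x => ‖h x‖ₑ) (fun x => ‖k x‖ₑ) ξ η)) ^ (2 : ℝ) := by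
          refine lintegral_mono_ae ?_
          filter_upwards [hu] with ξ hξ
          gcongr
      _ = A ^ (2 : ℝ) * ∫⁻ ξ, (ENNReal.ofReal (b ((2 * Real.pi) • ξ)) *
        ∫⁻ η, absKernel a (fun x => ‖h x‖ₑ) (fun x => ‖k x‖ₑ) ξ η) ^ (2 : ℝ) := by
          simp_rw [ENNReal.mul_rpow_of_nonneg A _ (by norm_num : (0:ℝ) ≤ 2)]
          rw [lintegral_const_mul]
          have e1 : Measurable fun ξ => ∫⁻ η, absKernel a (fun x => ‖h x‖ₑ) (fun x => ‖k x‖ₑ) ξ η :=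
            (measurable_absKernel hw.meas_a mh mk).lintegral_prod_right'
          have e2 : Measurable fun ξ : Space => ENNReal.ofReal (b ((2 * Real.pi) • ξ)) :=
            (hw.meas_b.comp (measurable_const_smul _)).ennreal_ofReal
          exact (e2.mul e1).pow_const _
      _ ≤ A ^ (2 : ℝ) * (ENNReal.ofReal C ^ (2 : ℝ) * (‖h‖ₑ ^ (2 : ℝ) * ‖k‖ₑ ^ (2 : ℝ))) := by
          gcongr
          refine (hw.bilin _ _ mh mk).trans (le_of_eq ?_)
          rw [lintegral_enorm_sq_coeFn, lintegral_enorm_sq_coeFn]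
      _ = _ := by
          simp only [ENNReal.mul_rpow_of_nonneg _ _ (by norm_num : (0:ℝ) ≤ 2)]
  calc _ ≤ ((A * (ENNReal.ofReal C * (‖h‖ₑ * ‖k‖ₑ))) ^ (2 : ℝ)) ^ (1 / (2 : ℝ≥0∞).toReal) := by
        gcongr; exact h1
    _ = _ := by rw [← ENNReal.rpow_mul]; simp

lemma IsWeightPair.memLp_interFun (hw : IsWeightPair a b C) (h k : L2) :
    MemLp (interFun M a b h k) 2 (volume : Measure Space) := by
  constructor
  · have e1 : StronglyMeasurable fun x : Space × Space => interKernel M a h k x.1 x.2 :=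
      (measurable_interKernel hw.meas_a (Lp.stronglyMeasurable h).measurable
        (Lp.stronglyMeasurable k).measurable).stronglyMeasurable
    have e2 : Measurable fun ξ : Space => (b ((2 * Real.pi) • ξ) : ℂ) :=
      Complex.measurable_ofReal.comp (hw.meas_b.comp (measurable_const_smul _))
    exact e2.aestronglyMeasurable.smul e1.integral_prod_right.aestronglyMeasurable
  · refine (hw.eLpNorm_le h k (A := ENNReal.ofReal (matConst M)) ?_).trans_lt ?_
    · filter_upwards [ae_ne_zero] with ξ hξ
      exact hw.enorm_interFun_le _ _ hξ
    · exact ENNReal.mul_lt_top (by simp) (ENNReal.mul_lt_top (by simp)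
        (ENNReal.mul_lt_top (by simp) (by simp)))

lemma IsWeightPair.ae_integrable_interKernel (hw : IsWeightPair a b C) (h k : L2) :
    ∀ᵐ ξ, Integrable (interKernel M a h k ξ) := by
  have mh : Measurable fun x => ‖h x‖ₑ := (Lp.stronglyMeasurable h).enorm
  have mk : Measurable fun x => ‖k x‖ₑ := (Lp.stronglyMeasurable k).enorm
  have e1 : Measurable fun ξ => ∫⁻ η, absKernel a (fun x => ‖h x‖ₑ) (fun x => ‖k x‖ₑ) ξ η :=
    (measurable_absKernel hw.meas_a mh mk).lintegral_prod_right'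
  have e2 : Measurable fun ξ : Space => ENNReal.ofReal (b ((2 * Real.pi) • ξ)) :=
    (hw.meas_b.comp (measurable_const_smul _)).ennreal_ofReal
  have h1 := hw.bilin _ _ mh mk
  rw [lintegral_enorm_sq_coeFn, lintegral_enorm_sq_coeFn] at h1
  have h2 := ae_lt_top ((e2.mul e1).pow_const 2) (h1.trans_lt (by
    exact ENNReal.mul_lt_top (ENNReal.rpow_lt_top_of_nonneg (by norm_num) (by simp))
      (ENNReal.mul_lt_top (ENNReal.rpow_lt_top_of_nonneg (by norm_num) (by simp))
        (ENNReal.rpow_lt_top_of_nonneg (by norm_num) (by simp))))).ne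
  filter_upwards [h2, ae_ne_zero] with ξ hξ h0
  refine ⟨((measurable_interKernel hw.meas_a (Lp.stronglyMeasurable h).measurable
    (Lp.stronglyMeasurable k).measurable).comp measurable_prodMk_left).aestronglyMeasurable, ?_⟩
  refine (hw.lintegral_interKernel_le _ _ ξ).trans_lt ?_
  refine ENNReal.mul_lt_top (by simp) ?_
  by_contra hcon
  rw [not_lt, top_le_iff] at hcon
  simp only [Pi.mul_apply] at hξ
  rw [hcon, ENNReal.mul_top] at hξ
  · simp at hξ
  · simpa using hw.pos_b _ (two_pi_smul_ne_zero h0)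

lemma interKernel_congr {h h' k k' : Space → Vec} (hh : h =ᵐ[volume] h') (hk : k =ᵐ[volume] k')
    (ξ : Space) : interKernel M a h k ξ =ᵐ[volume] interKernel M a h' k' ξ := by
  have := (quasiMeasurePreserving_sub_left_of_right_invariant (volume : Measure Space)
      ξ).ae_eq_comp hk
  filter_upwards [hh, this] with η h1 h2
  simp only [Function.comp] at h2
  simp only [interKernel, h1, h2]

lemma interFun_congr {h h' k k' : Space → Vec} (hh : h =ᵐ[volume] h') (hk : k =ᵐ[volume] k') :
    interFun M a b h k = interFun M a b h' k' := by
  ext1 ξ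
  simp only [interFun, integral_congr_ae (interKernel_congr hh hk ξ)]

variable (M) in
/-- The frequency-side advection term as a bounded bilinear map on `L²`. -/
def interOp (hw : IsWeightPair a b C) : L2 →L[ℂ] L2 →L[ℂ] L2 :=
  LinearMap.mkContinuous₂
    (LinearMap.mk₂ ℂ (fun h k : L2 => (hw.memLp_interFun (M := M) h k).toLp)
      (by
        intro h h' k
        rw [← MemLp.toLp_add]
        refine MemLp.toLp_congr _ _ ?_
        filter_upwards [hw.ae_integrable_interKernel (M := M) h k,
          hw.ae_integrable_interKernel (M := M) h' k] with ξ h1 h2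
        rw [interFun_congr (Lp.coeFn_add h h') (ae_eq_refl k), Pi.add_apply]
        unfold interFun
        rw [← smul_add, ← integral_add h1 h2]
        simp only [interKernel, Pi.add_apply, map_add, add_mul, add_smul])
      (by
        intro c h k
        rw [← MemLp.toLp_const_smul]
        refine MemLp.toLp_congr _ _ (.of_forall fun ξ => ?_)
        rw [interFun_congr (Lp.coeFn_smul c h) (ae_eq_refl k), Pi.smul_apply]
        unfold interFun
        rw [smul_comm c, ← integral_smul c (interKernel M a h k ξ)]
        simp only [interKernel, Pi.smul_apply, map_smul, smul_smul, smul_eq_mul, mul_assoc])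
      (by
        intro h k k'
        rw [← MemLp.toLp_add]
        refine MemLp.toLp_congr _ _ ?_
        filter_upwards [hw.ae_integrable_interKernel (M := M) h k,
          hw.ae_integrable_interKernel (M := M) h k'] with ξ h1 h2
        rw [interFun_congr (ae_eq_refl h) (Lp.coeFn_add k k'), Pi.add_apply]
        unfold interFun
        rw [← smul_add, ← integral_add h1 h2]
        simp only [interKernel, Pi.add_apply, smul_add])
      (by
        intro c h k
        rw [← MemLp.toLp_const_smul]
        refine MemLp.toLp_congr _ _ (.of_forall fun ξ => ?_)
        rw [interFun_congr (ae_eq_refl h) (Lp.coeFn_smul c k), Pi.smul_apply]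
        unfold interFun
        rw [smul_comm c, ← integral_smul c (interKernel M a h k ξ)]
        simp only [interKernel, Pi.smul_apply, smul_comm c]))
    (matConst M * C) (by
      intro h k
      rw [LinearMap.mk₂_apply, Lp.norm_toLp]
      refine ENNReal.toReal_le_of_le_ofReal
        (by have := matConst_nonneg M; have := hw.nonneg; positivity) ?_
      refine (hw.eLpNorm_le h k (A := ENNReal.ofReal (matConst M)) ?_).trans (le_of_eq ?_)
      · filter_upwards [ae_ne_zero] with ξ hξ
        exact hw.enorm_interFun_le _ _ hξ
      · rw [← ofReal_norm, ← ofReal_norm, ← ENNReal.ofReal_mul (by positivity),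
          ← ENNReal.ofReal_mul hw.nonneg, ← ENNReal.ofReal_mul (matConst_nonneg M)]
        congr 1; ring)

lemma coeFn_interOp (hw : IsWeightPair a b C) (h k : L2) :
    interOp M hw h k =ᵐ[volume] interFun M a b h k :=
  (hw.memLp_interFun h k).coeFn_toLp

attribute [irreducible] interOp

end

end NSE
namespace NSE

noncomputable section

/-! ### A product estimate with power weights -/

/-- The weight `‖x‖^(-s)` with values in `[0, ∞]`. -/
def negPow (s : ℝ) (x : Space) : ℝ≥0∞ := ENNReal.ofReal (‖x‖ ^ (-s))

@[fun_prop]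
lemma measurable_negPow (s : ℝ) : Measurable (negPow s) := by
  unfold negPow
  exact (measurable_norm.pow_const _).ennreal_ofReal

lemma negPow_anti {s : ℝ} (hs : 0 ≤ s) {x : Space} {r : ℝ} (hr : 0 < r) (h : r ≤ ‖x‖) :
    negPow s x ≤ ENNReal.ofReal (r ^ (-s)) :=
  ENNReal.ofReal_le_ofReal (Real.rpow_le_rpow_of_nonpos hr h (by linarith))

lemma lintegral_negPow_unitBall_ne_top {c : ℝ} (hc : c < 3) :
    ∫⁻ x in Metric.ball (0 : Space) 1, negPow c x ≠ ∞ := by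
  have h1 : IntegrableOn (fun x : Space => ‖x‖ ^ (-c)) (Metric.ball 0 1) := by
    rw [integrableOn_fun_norm_addHaar volume (f := fun y : ℝ => y ^ (-c))]
    have h2 : IntegrableOn (fun y : ℝ => y ^ (2 - c)) (Ioo 0 1) :=
      (intervalIntegral.integrableOn_Ioo_rpow_iff one_pos).2 (by linarith)
    refine h2.congr_fun (fun y hy => ?_) measurableSet_Ioo
    simp only [finrank_euclideanSpace, Fintype.card_fin, smul_eq_mul]
    rw [sub_eq_add_neg, Real.rpow_add hy.1]
    norm_num
  refine ne_of_lt ?_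
  have h3 := h1.2
  rw [hasFiniteIntegral_iff_ofReal (.of_forall fun x => by positivity)] at h3
  exact h3

lemma lintegral_comp_smul_space (f : Space → ℝ≥0∞) (hf : Measurable f) {R : ℝ} (hR : 0 < R) :
    ∫⁻ x, f x = ENNReal.ofReal (R ^ 3) * ∫⁻ x, f (R • x) := by
  have h1 : ∫⁻ x, f (R • x) = ∫⁻ y, f y ∂(Measure.map (fun x : Space => R • x) volume) :=
    (lintegral_map hf (measurable_const_smul R)).symm
  rw [h1, Measure.map_addHaar_smul volume hR.ne', lintegral_smul_measure, smul_eq_mul, ← mul_assoc]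
  simp only [finrank_euclideanSpace, Fintype.card_fin]
  rw [← ENNReal.ofReal_mul (by positivity), abs_of_pos (by positivity),
    mul_inv_cancel₀ (by positivity), ENNReal.ofReal_one, one_mul]

lemma lintegral_negPow_ball {c : ℝ} {R : ℝ} (hR : 0 < R) :
    ∫⁻ x in Metric.ball (0 : Space) R, negPow c x =
      ENNReal.ofReal (R ^ (3 - c)) * ∫⁻ x in Metric.ball (0 : Space) 1, negPow c x := by
  rw [← lintegral_indicator measurableSet_ball, ← lintegral_indicator measurableSet_ball,
    lintegral_comp_smul_space _ ((measurable_negPow c).indicator measurableSet_ball) hR]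
  have : ∀ x : Space, (Metric.ball (0 : Space) R).indicator (negPow c) (R • x) =
      ENNReal.ofReal (R ^ (-c)) * (Metric.ball (0 : Space) 1).indicator (negPow c) x := by
    intro x
    by_cases hx : x ∈ Metric.ball (0 : Space) 1
    · have hx' : R • x ∈ Metric.ball (0 : Space) R := by
        rw [mem_ball_zero_iff] at hx ⊢
        rw [norm_smul, Real.norm_of_nonneg hR.le]
        nlinarith
      rw [indicator_of_mem hx, indicator_of_mem hx', negPow, negPow,
        ← ENNReal.ofReal_mul (by positivity), norm_smul, Real.norm_of_nonneg hR.le,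
        Real.mul_rpow hR.le (norm_nonneg _)]
    · have hx' : R • x ∉ Metric.ball (0 : Space) R := by
        rw [mem_ball_zero_iff, not_lt] at hx ⊢
        rw [norm_smul, Real.norm_of_nonneg hR.le]
        nlinarith
      rw [indicator_of_notMem hx, indicator_of_notMem hx', mul_zero]
  simp_rw [this]
  rw [lintegral_const_mul _ ((measurable_negPow c).indicator measurableSet_ball), ← mul_assoc,
    ← ENNReal.ofReal_mul (by positivity), sub_eq_add_neg, Real.rpow_add hR]
  norm_num

lemma sq_lintegral_mul_le {α : Type*} [MeasurableSpace α] {μ : Measure α} {f g : α → ℝ≥0∞}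
    (hf : AEMeasurable f μ) (hg : AEMeasurable g μ) :
    (∫⁻ x, f x * g x ∂μ) ^ (2 : ℝ) ≤ (∫⁻ x, f x ^ (2 : ℝ) ∂μ) * ∫⁻ x, g x ^ (2 : ℝ) ∂μ := by
  have h := ENNReal.lintegral_mul_le_Lp_mul_Lq μ Real.HolderConjugate.two_two hf hg
  calc _ ≤ ((∫⁻ x, f x ^ (2 : ℝ) ∂μ) ^ (1 / (2:ℝ)) * (∫⁻ x, g x ^ (2 : ℝ) ∂μ) ^ (1 / (2:ℝ))) ^
      (2:ℝ) := by
        gcongr; exact h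
    _ = _ := by
        rw [ENNReal.mul_rpow_of_nonneg _ _ (by norm_num), ← ENNReal.rpow_mul, ← ENNReal.rpow_mul]
        norm_num

lemma lintegral_conv_sq (F G : Space → ℝ≥0∞) (hF : Measurable F) (hG : Measurable G) :
    ∫⁻ ξ, ∫⁻ η, F η * G (ξ - η) = (∫⁻ η, F η) * ∫⁻ η, G η := by
  rw [lintegral_lintegral_swap (by fun_prop), ← lintegral_mul_const _ hF]
  refine lintegral_congr fun η => ?_
  rw [lintegral_const_mul _ (by fun_prop), lintegral_sub_right_eq_self G η]

/-- The region `‖η‖ ≤ 2‖ξ‖`: the kernel `‖η‖^(-c) ‖ξ - η‖^(c-3)` has bounded integral there. -/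
lemma lintegral_near_kernel {c : ℝ} (h0 : 0 < c) (h3 : c < 3) :
    ∃ K : ℝ≥0∞, K ≠ ∞ ∧ ∀ ξ : Space, ξ ≠ 0 →
      ∫⁻ η in {η | ‖η‖ ≤ 2 * ‖ξ‖}, negPow c η * negPow (3 - c) (ξ - η) ≤ K := by
  set K₁ := ∫⁻ x in Metric.ball (0 : Space) 1, negPow c x
  set K₂ := ∫⁻ x in Metric.ball (0 : Space) 1, negPow (3 - c) x
  refine ⟨K₁ + ENNReal.ofReal (8 ^ c) * K₂, ?_, fun ξ hξ => ?_⟩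
  · exact ENNReal.add_ne_top.2 ⟨lintegral_negPow_unitBall_ne_top h3,
      ENNReal.mul_ne_top (by simp) (lintegral_negPow_unitBall_ne_top (by linarith))⟩
  have hn : 0 < ‖ξ‖ := norm_pos_iff.2 hξ
  have hsub : {η : Space | ‖η‖ ≤ 2 * ‖ξ‖} ⊆ Metric.ball 0 (‖ξ‖ / 2) ∪
      ({η | ‖ξ‖ / 2 ≤ ‖η‖} ∩ Metric.ball ξ (4 * ‖ξ‖)) := by
    intro η hη
    simp only [mem_ofPred_eq] at hη
    rcases lt_or_ge ‖η‖ (‖ξ‖ / 2) with h | h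
    · exact Or.inl (by simpa using h)
    · refine Or.inr ⟨h, ?_⟩
      rw [mem_ball_iff_norm]
      linarith [norm_sub_le η ξ]
  refine (lintegral_mono_set hsub).trans ((lintegral_union_le _ _ _).trans ?_)
  gcongr ?_ + ?_
  · calc _ ≤ ∫⁻ η in Metric.ball (0 : Space) (‖ξ‖ / 2), negPow c η *
          ENNReal.ofReal ((‖ξ‖ / 2) ^ (-(3 - c))) := by
          refine setLIntegral_mono (by fun_prop) fun η hη => ?_
          gcongr
          refine negPow_anti (by linarith) (by positivity) ?_
          rw [mem_ball_zero_iff] at hη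
          linarith [norm_sub_norm_le ξ η]
      _ = _ := by
          rw [lintegral_mul_const _ (by fun_prop), lintegral_negPow_ball (by positivity), mul_comm,
            ← mul_assoc, ← ENNReal.ofReal_mul (by positivity), ← Real.rpow_add (by positivity)]
          simp [K₁]
  · calc _ ≤ ∫⁻ η in {η | ‖ξ‖ / 2 ≤ ‖η‖} ∩ Metric.ball ξ (4 * ‖ξ‖),
          ENNReal.ofReal ((‖ξ‖ / 2) ^ (-c)) * negPow (3 - c) (ξ - η) := by
          refine setLIntegral_mono (by fun_prop) fun η hη => ?_
          gcongr
          exact negPow_anti h0.le (by positivity) hη.1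
      _ ≤ ∫⁻ η in Metric.ball ξ (4 * ‖ξ‖),
          ENNReal.ofReal ((‖ξ‖ / 2) ^ (-c)) * negPow (3 - c) (ξ - η) :=
          lintegral_mono_set inter_subset_right
      _ = ENNReal.ofReal ((‖ξ‖ / 2) ^ (-c)) *
          ∫⁻ η in Metric.ball (0 : Space) (4 * ‖ξ‖), negPow (3 - c) η := by
          rw [lintegral_const_mul _ (by fun_prop)]
          congr 1
          rw [← lintegral_indicator measurableSet_ball, ← lintegral_indicator measurableSet_ball,
            ← lintegral_sub_left_eq_self ((Metric.ball (0 : Space) (4 * ‖ξ‖)).indicator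
              (negPow (3 - c))) ξ]
          refine lintegral_congr fun η => ?_
          have : η ∈ Metric.ball ξ (4 * ‖ξ‖) ↔ ξ - η ∈ Metric.ball (0 : Space) (4 * ‖ξ‖) := by
            rw [mem_ball_iff_norm, mem_ball_zero_iff, norm_sub_rev]
          by_cases h : η ∈ Metric.ball ξ (4 * ‖ξ‖)
          · rw [indicator_of_mem h, indicator_of_mem (this.1 h)]
          · rw [indicator_of_notMem h, indicator_of_notMem (fun h' => h (this.2 h'))]
      _ = _ := by
          rw [lintegral_negPow_ball (by positivity), ← mul_assoc,
            ← ENNReal.ofReal_mul (by positivity)]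
          congr 2
          have e : (4 * ‖ξ‖) = 8 * (‖ξ‖ / 2) := by ring
          rw [sub_sub_cancel, e, Real.mul_rpow (by norm_num) (by positivity), mul_left_comm,
            ← Real.rpow_add (by positivity)]
          simp

/-- The region `‖η‖ > 2‖ξ‖`, where `‖η‖` and `‖ξ - η‖` are comparable and an output of low
frequency arises from two high ones. -/
lemma lintegral_far_le :
    ∃ K : ℝ≥0∞, K ≠ ∞ ∧ ∀ F G : Space → ℝ≥0∞, Measurable F → Measurable G →
      ∫⁻ ξ, (∫⁻ η in {η | 2 * ‖ξ‖ < ‖η‖}, (negPow (3 / 2) η * F η) * G (ξ - η)) ^ (2 : ℝ) ≤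
        K * ((∫⁻ ξ, F ξ ^ (2 : ℝ)) * ∫⁻ ξ, G ξ ^ (2 : ℝ)) := by
  set K := ∫⁻ x in Metric.ball (0 : Space) 1, negPow 0 x
  refine ⟨K, lintegral_negPow_unitBall_ne_top (by norm_num), fun F G hF hG => ?_⟩
  have hS : MeasurableSet {x : Space × Space | 2 * ‖x.1‖ < ‖x.2‖} :=
    measurableSet_lt (by fun_prop) (by fun_prop)
  have hS1 : ∀ ξ : Space, MeasurableSet {η : Space | 2 * ‖ξ‖ < ‖η‖} := fun ξ =>
    measurableSet_lt (by fun_prop) (by fun_prop)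
  calc _ ≤ ∫⁻ ξ, (∫⁻ η in {η | 2 * ‖ξ‖ < ‖η‖}, (negPow (3 / 2) η * F η) ^ (2 : ℝ)) *
        ∫⁻ η, G η ^ (2 : ℝ) := by
        refine lintegral_mono fun ξ => ?_
        refine (sq_lintegral_mul_le (by fun_prop) (by fun_prop)).trans ?_
        refine mul_le_mul' le_rfl ((setLIntegral_le_lintegral _ _).trans (le_of_eq ?_))
        exact lintegral_sub_left_eq_self (fun η => G η ^ (2 : ℝ)) ξ
    _ = (∫⁻ ξ, ∫⁻ η, {x : Space × Space | 2 * ‖x.1‖ < ‖x.2‖}.indicator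
          (fun x => (negPow (3 / 2) x.2 * F x.2) ^ (2 : ℝ)) (ξ, η)) * ∫⁻ η, G η ^ (2 : ℝ) := by
        have e : Measurable fun x : Space × Space => (negPow (3 / 2) x.2 * F x.2) ^ (2 : ℝ) := by
          fun_prop
        rw [← lintegral_mul_const _ (e.indicator hS).lintegral_prod_right']
        refine lintegral_congr fun ξ => ?_
        rw [← lintegral_indicator (hS1 ξ)]
        rfl
    _ ≤ (∫⁻ η, K * F η ^ (2 : ℝ)) * ∫⁻ η, G η ^ (2 : ℝ) := by
        have e : Measurable fun x : Space × Space => (negPow (3 / 2) x.2 * F x.2) ^ (2 : ℝ) := by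
          fun_prop
        gcongr ?_ * _
        rw [lintegral_lintegral_swap (f := fun ξ η =>
            {x : Space × Space | 2 * ‖x.1‖ < ‖x.2‖}.indicator
          (fun x => (negPow (3 / 2) x.2 * F x.2) ^ (2 : ℝ)) (ξ, η)) (e.indicator hS).aemeasurable]
        refine lintegral_mono_ae ?_
        filter_upwards [ae_ne_zero] with η hη
        have hn : 0 < ‖η‖ := norm_pos_iff.2 hη
        have e1 : ∀ ξ : Space, {x : Space × Space | 2 * ‖x.1‖ < ‖x.2‖}.indicator
          (fun x => (negPow (3 / 2) x.2 * F x.2) ^ (2 : ℝ)) (ξ, η) ≤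
            (Metric.ball (0 : Space) ‖η‖).indicator
              (fun ξ => negPow 0 ξ * (negPow (3 / 2) η * F η) ^ (2 : ℝ)) ξ := by
          intro ξ
          by_cases h : ξ ∈ Metric.ball (0 : Space) ‖η‖
          · rw [indicator_of_mem h]
            refine (indicator_le_self _ _ _).trans ?_
            simp [negPow]
          · rw [indicator_of_notMem h, indicator_of_notMem]
            simp only [mem_ball_zero_iff, not_lt] at h
            simp only [mem_ofPred_eq, not_lt]
            linarith
        refine (lintegral_mono e1).trans ?_
        rw [lintegral_indicator measurableSet_ball, lintegral_mul_const _ (by fun_prop),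
          lintegral_negPow_ball hn, ENNReal.mul_rpow_of_nonneg _ _ (by norm_num)]
        have e2 : ENNReal.ofReal (‖η‖ ^ (3 - 0 : ℝ)) * negPow (3 / 2) η ^ (2 : ℝ) = 1 := by
          rw [negPow, ENNReal.ofReal_rpow_of_nonneg (by positivity) (by norm_num),
            ← ENNReal.ofReal_mul (by positivity), ← Real.rpow_mul (by positivity),
            ← Real.rpow_add hn]
          norm_num
        calc _ = (ENNReal.ofReal (‖η‖ ^ (3 - 0 : ℝ)) * negPow (3 / 2) η ^ (2 : ℝ)) *
              (K * F η ^ (2 : ℝ)) := by ring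
          _ ≤ _ := by rw [e2, one_mul]
    _ = _ := by rw [lintegral_const_mul _ (by fun_prop), mul_assoc]

lemma add_sq_le_ennreal (x y : ℝ≥0∞) : (x + y) ^ (2 : ℝ) ≤ 2 * (x ^ (2 : ℝ) + y ^ (2 : ℝ)) := by
  have := ENNReal.rpow_add_le_mul_rpow_add_rpow x y (p := 2) (by norm_num)
  norm_num at this ⊢
  exact this

/-- The product estimate `Ḣ^α · Ḣ^(3/2-α) ⊂ L²` in `ℝ³`, for `0 < α < 3/2`. -/
lemma lintegral_conv_negPow_le {α : ℝ} (h0 : 0 < α) (h1 : α < 3 / 2) :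
    ∃ K : ℝ≥0∞, K ≠ ∞ ∧ ∀ F G : Space → ℝ≥0∞, Measurable F → Measurable G →
      ∫⁻ ξ, (∫⁻ η, (negPow α η * F η) * (negPow (3 / 2 - α) (ξ - η) * G (ξ - η))) ^ (2 : ℝ) ≤
        K * ((∫⁻ ξ, F ξ ^ (2 : ℝ)) * ∫⁻ ξ, G ξ ^ (2 : ℝ)) := by
  obtain ⟨K₁, hK₁, hnear⟩ := lintegral_near_kernel (c := 2 * α) (by linarith) (by linarith)
  obtain ⟨K₂, hK₂, hfar⟩ := lintegral_far_le
  set D := ENNReal.ofReal (2 ^ (3 / 2 - α))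
  refine ⟨2 * (K₁ + D ^ (2 : ℝ) * K₂), ?_, fun F G hF hG => ?_⟩
  · exact ENNReal.mul_ne_top (by simp) (ENNReal.add_ne_top.2 ⟨hK₁, ENNReal.mul_ne_top
      (ENNReal.rpow_ne_top_of_nonneg (by norm_num) ENNReal.ofReal_ne_top) hK₂⟩)
  set k : Space → Space → ℝ≥0∞ := fun ξ η =>
    (negPow α η * F η) * (negPow (3 / 2 - α) (ξ - η) * G (ξ - η))
  have hS1 : ∀ ξ : Space, MeasurableSet {η : Space | ‖η‖ ≤ 2 * ‖ξ‖} := fun ξ =>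
    measurableSet_le (by fun_prop) (by fun_prop)
  have hsplit : ∀ ξ, ∫⁻ η, k ξ η = (∫⁻ η in {η | ‖η‖ ≤ 2 * ‖ξ‖}, k ξ η) +
      ∫⁻ η in {η | 2 * ‖ξ‖ < ‖η‖}, k ξ η := by
    intro ξ
    have : {η : Space | 2 * ‖ξ‖ < ‖η‖} = {η | ‖η‖ ≤ 2 * ‖ξ‖}ᶜ := by ext; simp
    rw [this, lintegral_add_compl _ (hS1 ξ)]
  have hA : ∀ ξ, ξ ≠ 0 → (∫⁻ η in {η | ‖η‖ ≤ 2 * ‖ξ‖}, k ξ η) ^ (2 : ℝ) ≤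
      K₁ * ∫⁻ η, F η ^ (2 : ℝ) * G (ξ - η) ^ (2 : ℝ) := by
    intro ξ hξ
    have e : ∀ η, k ξ η = (negPow α η * negPow (3 / 2 - α) (ξ - η)) * (F η * G (ξ - η)) :=
      fun η => by simp only [k]; ring
    simp_rw [e]
    refine (sq_lintegral_mul_le (by fun_prop) (by fun_prop)).trans ?_
    have hp : ∀ (s : ℝ) (x : Space), negPow s x ^ (2 : ℝ) = negPow (2 * s) x := by
      intro s x
      rw [negPow, negPow, ENNReal.ofReal_rpow_of_nonneg (by positivity) (by norm_num),
        ← Real.rpow_mul (norm_nonneg _)]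
      congr 2; ring
    refine mul_le_mul' ?_ ?_
    · refine le_trans (le_of_eq ?_) (hnear ξ hξ)
      refine lintegral_congr fun η => ?_
      rw [ENNReal.mul_rpow_of_nonneg _ _ (by norm_num), hp, hp]
      congr 2; ring
    · refine (setLIntegral_le_lintegral _ _).trans (le_of_eq (lintegral_congr fun η => ?_))
      rw [ENNReal.mul_rpow_of_nonneg _ _ (by norm_num)]
  have hB : ∀ ξ, (∫⁻ η in {η | 2 * ‖ξ‖ < ‖η‖}, k ξ η) ≤
      D * ∫⁻ η in {η | 2 * ‖ξ‖ < ‖η‖}, (negPow (3 / 2) η * F η) * G (ξ - η) := by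
    intro ξ
    rw [← lintegral_const_mul _ (by fun_prop)]
    refine setLIntegral_mono (by fun_prop) fun η hη => ?_
    simp only [mem_ofPred_eq] at hη
    have hn : 0 < ‖η‖ := by linarith [norm_nonneg ξ]
    have h2 : ‖η‖ / 2 ≤ ‖ξ - η‖ := by
      have := norm_sub_norm_le η ξ
      rw [norm_sub_rev] at this
      linarith
    have h3 : negPow α η * negPow (3 / 2 - α) (ξ - η) ≤ D * negPow (3 / 2) η := by
      calc _ ≤ negPow α η * ENNReal.ofReal ((‖η‖ / 2) ^ (-(3 / 2 - α))) := by
            gcongr; exact negPow_anti (by linarith) (by positivity) h2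
        _ = _ := by
            simp only [negPow, D]
            rw [← ENNReal.ofReal_mul (by positivity), ← ENNReal.ofReal_mul (by positivity),
              Real.div_rpow hn.le (by norm_num), Real.rpow_neg (by norm_num : (0:ℝ) ≤ 2),
              div_inv_eq_mul, ← mul_assoc, ← Real.rpow_add hn, mul_comm]
            congr 3; ring
    calc k ξ η = (negPow α η * negPow (3 / 2 - α) (ξ - η)) * (F η * G (ξ - η)) := by
          simp only [k]; ring
      _ ≤ (D * negPow (3 / 2) η) * (F η * G (ξ - η)) := by gcongr
      _ = _ := by ring
  calc _ ≤ ∫⁻ ξ, 2 * (K₁ * (∫⁻ η, F η ^ (2 : ℝ) * G (ξ - η) ^ (2 : ℝ)) +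
        D ^ (2 : ℝ) * (∫⁻ η in {η | 2 * ‖ξ‖ < ‖η‖}, (negPow (3 / 2) η * F η) * G (ξ - η)) ^
            (2 : ℝ)) := by
        refine lintegral_mono_ae ?_
        filter_upwards [ae_ne_zero] with ξ hξ
        change (∫⁻ η, k ξ η) ^ (2 : ℝ) ≤ _
        rw [hsplit]
        refine (add_sq_le_ennreal _ _).trans ?_
        gcongr
        · exact hA ξ hξ
        · rw [← ENNReal.mul_rpow_of_nonneg _ _ (by norm_num)]
          gcongr
          exact hB ξ
    _ = 2 * (K₁ * (∫⁻ ξ, ∫⁻ η, F η ^ (2 : ℝ) * G (ξ - η) ^ (2 : ℝ)) + D ^ (2 : ℝ) *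
        ∫⁻ ξ, (∫⁻ η in {η | 2 * ‖ξ‖ < ‖η‖}, (negPow (3 / 2) η * F η) * G (ξ - η)) ^ (2 : ℝ)) := by
        have e1 : Measurable fun ξ => ∫⁻ η, F η ^ (2 : ℝ) * G (ξ - η) ^ (2 : ℝ) := by
          refine Measurable.lintegral_prod_right' (f := fun x : Space × Space =>
            F x.2 ^ (2 : ℝ) * G (x.1 - x.2) ^ (2 : ℝ)) ?_
          fun_prop
        rw [lintegral_const_mul' _ _ (by simp), lintegral_add_left (e1.const_mul _),
          lintegral_const_mul _ e1, lintegral_const_mul']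
        exact ENNReal.rpow_ne_top_of_nonneg (by norm_num) ENNReal.ofReal_ne_top
    _ ≤ 2 * (K₁ * ((∫⁻ ξ, F ξ ^ (2 : ℝ)) * ∫⁻ ξ, G ξ ^ (2 : ℝ)) + D ^ (2 : ℝ) *
        (K₂ * ((∫⁻ ξ, F ξ ^ (2 : ℝ)) * ∫⁻ ξ, G ξ ^ (2 : ℝ)))) := by
        rw [lintegral_conv_sq (fun η => F η ^ (2 : ℝ)) (fun η => G η ^ (2 : ℝ)) (by fun_prop)
          (by fun_prop)]
        gcongr
        exact hfar F G hF hG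
    _ = _ := by ring

end

end NSE
namespace NSE

noncomputable section

/-! ### The weights of the two parts of the theorem -/

lemma one_le_bracket (x : ℝ) : 1 ≤ bracket x := by
  unfold bracket
  rw [Real.one_le_sqrt]; nlinarith [sq_nonneg x]

lemma bracket_pos (x : ℝ) : 0 < bracket x := lt_of_lt_of_le one_pos (one_le_bracket x)

lemma sq_bracket (x : ℝ) : bracket x ^ 2 = 1 + x ^ 2 := Real.sq_sqrt (by positivity)

lemma abs_le_bracket (x : ℝ) : |x| ≤ bracket x := by
  refine abs_le_of_sq_le_sq' (by rw [sq_abs, sq_bracket]; linarith) (bracket_pos x).le |>.2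

lemma bracket_le_one_add {x : ℝ} (hx : 0 ≤ x) : bracket x ≤ 1 + x := by
  refine abs_le_of_sq_le_sq' (by rw [sq_bracket]; nlinarith) (by positivity) |>.2

lemma bracket_mono {x y : ℝ} (hx : 0 ≤ x) (h : x ≤ y) : bracket x ≤ bracket y := by
  unfold bracket; gcongr

lemma bracket_add_le (x y : ℝ) : bracket (x + y) ≤ 2 * bracket x * bracket y := by
  have hx := bracket_pos x
  have hy := bracket_pos y
  refine abs_le_of_sq_le_sq' ?_ (by positivity) |>.2
  have e : (2 * bracket x * bracket y) ^ 2 = 4 * (bracket x ^ 2 * bracket y ^ 2) := by ring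
  rw [e, sq_bracket, sq_bracket, sq_bracket]
  nlinarith [sq_nonneg (x - y), sq_nonneg (x * y)]

lemma continuous_bracket : Continuous bracket := by unfold bracket; fun_prop

lemma measurable_homSymbol (s : ℝ) : Measurable (homSymbol s) := by
  unfold homSymbol; exact measurable_norm.pow_const _

lemma measurable_inhomSymbol (s : ℝ) : Measurable (inhomSymbol s) := by
  unfold inhomSymbol
  exact (continuous_bracket.measurable.comp measurable_norm).pow_const _

lemma homSymbol_pos (s : ℝ) {p : Space} (hp : p ≠ 0) : 0 < homSymbol s p :=
  Real.rpow_pos_of_pos (norm_pos_iff.2 hp) _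

lemma inhomSymbol_pos (s : ℝ) (p : Space) : 0 < inhomSymbol s p :=
  Real.rpow_pos_of_pos (bracket_pos _) _

lemma negPow_two_pi_le {s : ℝ} (hs : 0 ≤ s) {x : Space} (hx : x ≠ 0) :
    ‖(2 * Real.pi) • x‖ ^ (-s) ≤ ‖x‖ ^ (-s) := by
  refine Real.rpow_le_rpow_of_nonpos (norm_pos_iff.2 hx) ?_ (by linarith)
  rw [norm_smul, Real.norm_of_nonneg (by positivity)]
  nlinarith [norm_nonneg x, Real.pi_gt_three]

lemma sum_three_sq_le (x : Fin 3 → ℝ≥0∞) : (∑ i, x i) ^ (2 : ℝ) ≤ 4 * ∑ i, x i ^ (2 : ℝ) := by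
  rw [Fin.sum_univ_three, Fin.sum_univ_three]
  refine (add_sq_le_ennreal _ _).trans ?_
  calc 2 * ((x 0 + x 1) ^ (2 : ℝ) + x 2 ^ (2 : ℝ))
      ≤ 2 * (2 * (x 0 ^ (2 : ℝ) + x 1 ^ (2 : ℝ)) + 2 * x 2 ^ (2 : ℝ)) := by
        gcongr
        · exact add_sq_le_ennreal _ _
        · exact le_mul_of_one_le_left' (by norm_num)
    _ = _ := by ring

/-- Weights whose kernel is dominated by products of powers of total homogeneity `-3/2`. -/
lemma exists_isWeightPair {a b : Space → ℝ} (ha : Measurable a) (hb : Measurable b)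
    (pa : ∀ p, p ≠ 0 → 0 < a p) (pb : ∀ p, p ≠ 0 → 0 < b p) (α : Fin 3 → ℝ)
    (hα : ∀ i, 0 < α i ∧ α i < 3 / 2) {D : ℝ} (hD : 0 ≤ D)
    (hle : ∀ p q, p ≠ 0 → q ≠ 0 → b (p + q) * ((a p)⁻¹ * (‖q‖ * (a q)⁻¹)) ≤
      D * ∑ i, ‖p‖ ^ (-α i) * ‖q‖ ^ (-(3 / 2 - α i))) :
    ∃ C, IsWeightPair a b C := by
  choose K hK hest using fun i => lintegral_conv_negPow_le (hα i).1 (hα i).2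
  set K' : ℝ≥0∞ := ENNReal.ofReal D ^ (2 : ℝ) * (4 * ∑ i, K i)
  have hK' : K' ≠ ∞ := by
    refine ENNReal.mul_ne_top (ENNReal.rpow_ne_top_of_nonneg (by norm_num) ENNReal.ofReal_ne_top) ?_
    exact ENNReal.mul_ne_top (by simp) (ENNReal.sum_ne_top.2 fun i _ => hK i)
  have hC : K' ≤ ENNReal.ofReal (K'.toReal + 1) ^ (2 : ℝ) := by
    rw [ENNReal.ofReal_rpow_of_nonneg (by positivity) (by norm_num)]
    conv_lhs => rw [← ENNReal.ofReal_toReal hK']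
    refine ENNReal.ofReal_le_ofReal ?_
    norm_num
    nlinarith [ENNReal.toReal_nonneg (a := K')]
  refine ⟨K'.toReal + 1, by positivity, ha, hb, pa, pb, fun F G hF hG => ?_⟩
  set k : Fin 3 → Space → Space → ℝ≥0∞ := fun i ξ η =>
    (negPow (α i) η * F η) * (negPow (3 / 2 - α i) (ξ - η) * G (ξ - η))
  have hm : ∀ i, Measurable fun x : Space × Space => k i x.1 x.2 := by
    intro i; simp only [k]; fun_prop
  have hpt : ∀ ξ, ENNReal.ofReal (b ((2 * Real.pi) • ξ)) * ∫⁻ η, absKernel a F G ξ η ≤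
      ENNReal.ofReal D * ∑ i, ∫⁻ η, k i ξ η := by
    intro ξ
    have h1 : ∀ i, Measurable fun η => k i ξ η := by
      intro i; simp only [k]; fun_prop
    have hs : ∑ i, ∫⁻ η, k i ξ η = ∫⁻ η, ∑ i, k i ξ η :=
      (lintegral_finsetSum Finset.univ fun i _ => h1 i).symm
    rw [hs, ← lintegral_const_mul' (ENNReal.ofReal D) _ ENNReal.ofReal_ne_top,
      ← lintegral_const_mul' (ENNReal.ofReal (b ((2 * Real.pi) • ξ))) _ ENNReal.ofReal_ne_top]
    refine lintegral_mono_ae ?_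
    filter_upwards [ae_ne_zero, ae_sub_ne_zero ξ] with η h0 h1
    have q0 := two_pi_smul_ne_zero h0
    have q1 := two_pi_smul_ne_zero h1
    have hsum : (2 * Real.pi) • ξ = (2 * Real.pi) • η + (2 * Real.pi) • (ξ - η) := by
      rw [← smul_add]; simp
    have e1 := hle _ _ q0 q1
    rw [← hsum] at e1
    have e2 : b ((2 * Real.pi) • ξ) * ((a ((2 * Real.pi) • η))⁻¹ *
        (‖(2 * Real.pi) • (ξ - η)‖ * (a ((2 * Real.pi) • (ξ - η)))⁻¹)) ≤
        D * ∑ i, ‖η‖ ^ (-α i) * ‖ξ - η‖ ^ (-(3 / 2 - α i)) := by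
      refine e1.trans ?_
      refine mul_le_mul_of_nonneg_left (Finset.sum_le_sum fun i _ => ?_) hD
      exact mul_le_mul (negPow_two_pi_le (hα i).1.le h0)
        (negPow_two_pi_le (by linarith [(hα i).2]) h1) (by positivity) (by positivity)
    have e3 : ENNReal.ofReal (b ((2 * Real.pi) • ξ)) * (ENNReal.ofReal (a ((2 * Real.pi) • η))⁻¹ *
        ENNReal.ofReal (‖(2 * Real.pi) • (ξ - η)‖ * (a ((2 * Real.pi) • (ξ - η)))⁻¹)) ≤
        ENNReal.ofReal D * ∑ i, negPow (α i) η * negPow (3 / 2 - α i) (ξ - η) := by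
      have p0 := pa _ q0
      have p1 := pa _ q1
      rw [← ENNReal.ofReal_mul (by positivity), ← ENNReal.ofReal_mul' (by positivity)]
      refine (ENNReal.ofReal_le_ofReal e2).trans (le_of_eq ?_)
      rw [ENNReal.ofReal_mul hD, ENNReal.ofReal_sum_of_nonneg (fun i _ => by positivity)]
      simp only [negPow]
      congr 1
      exact Finset.sum_congr rfl fun i _ => ENNReal.ofReal_mul (by positivity)
    calc _ = (ENNReal.ofReal (b ((2 * Real.pi) • ξ)) * (ENNReal.ofReal (a ((2 * Real.pi) • η))⁻¹ *
        ENNReal.ofReal (‖(2 * Real.pi) • (ξ - η)‖ * (a ((2 * Real.pi) • (ξ - η)))⁻¹))) *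
          (F η * G (ξ - η)) := by simp only [absKernel]; ring
      _ ≤ (ENNReal.ofReal D * ∑ i, negPow (α i) η * negPow (3 / 2 - α i) (ξ - η)) *
          (F η * G (ξ - η)) := by gcongr
      _ = _ := by
        rw [mul_assoc, Finset.sum_mul]
        congr 1
        refine Finset.sum_congr rfl fun i _ => ?_
        simp only [k]; ring
  calc _ ≤ ∫⁻ ξ, ENNReal.ofReal D ^ (2 : ℝ) * (4 * ∑ i, (∫⁻ η, k i ξ η) ^ (2 : ℝ)) := by
        refine lintegral_mono fun ξ => ?_
        calc _ ≤ (ENNReal.ofReal D * ∑ i, ∫⁻ η, k i ξ η) ^ (2 : ℝ) :=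
              ENNReal.rpow_le_rpow (hpt ξ) (by norm_num)
          _ ≤ _ := by
            rw [ENNReal.mul_rpow_of_nonneg _ _ (by norm_num)]
            gcongr
            exact sum_three_sq_le _
    _ = ENNReal.ofReal D ^ (2 : ℝ) * (4 * ∑ i, ∫⁻ ξ, (∫⁻ η, k i ξ η) ^ (2 : ℝ)) := by
        rw [lintegral_const_mul', lintegral_const_mul', lintegral_finsetSum]
        · exact fun i _ => ((hm i).lintegral_prod_right').pow_const _
        · simp
        · exact ENNReal.rpow_ne_top_of_nonneg (by norm_num) ENNReal.ofReal_ne_top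
    _ ≤ ENNReal.ofReal D ^ (2 : ℝ) * (4 * ∑ i, K i *
          ((∫⁻ ξ, F ξ ^ (2 : ℝ)) * ∫⁻ ξ, G ξ ^ (2 : ℝ))) := by
        gcongr with i
        exact hest i F G hF hG
    _ = K' * ((∫⁻ ξ, F ξ ^ (2 : ℝ)) * ∫⁻ ξ, G ξ ^ (2 : ℝ)) := by
        simp only [K', ← Finset.sum_mul]; ring
    _ ≤ _ := by gcongr

lemma rpow_norm_add_le {β : ℝ} (h0 : 0 ≤ β) (h1 : β ≤ 1) (p q : Space) :
    ‖p + q‖ ^ β ≤ ‖p‖ ^ β + ‖q‖ ^ β :=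
  (Real.rpow_le_rpow (norm_nonneg _) (norm_add_le p q) h0).trans
    (Real.rpow_add_le_add_rpow (norm_nonneg _) (norm_nonneg _) h0 h1)

lemma exists_isWeightPair_hom {σ : ℝ} (h0 : 5 / 4 ≤ σ) (h1 : σ < 3 / 2) :
    ∃ C, IsWeightPair (homSymbol σ) (homSymbol (2 * σ - 5 / 2)) C := by
  refine exists_isWeightPair (measurable_homSymbol _) (measurable_homSymbol _)
    (fun p => homSymbol_pos _) (fun p => homSymbol_pos _) ![5 / 4, 5 / 2 - σ, σ]
    (fun i => by fin_cases i <;> constructor <;> norm_num <;> linarith) zero_le_one ?_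
  intro p q hp hq
  have np : 0 < ‖p‖ := norm_pos_iff.2 hp
  have nq : 0 < ‖q‖ := norm_pos_iff.2 hq
  simp only [homSymbol, Fin.sum_univ_three, one_mul, Matrix.cons_val]
  have e1 : (‖p‖ ^ (2 * σ - 5 / 2) + ‖q‖ ^ (2 * σ - 5 / 2)) *
      ((‖p‖ ^ σ)⁻¹ * (‖q‖ * (‖q‖ ^ σ)⁻¹)) = ‖p‖ ^ (-(5 / 2 - σ)) * ‖q‖ ^ (-(3 / 2 - (5 / 2 - σ))) +
        ‖p‖ ^ (-σ) * ‖q‖ ^ (-(3 / 2 - σ)) := by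
    have a1 : ‖p‖ ^ (-(5 / 2 - σ)) = ‖p‖ ^ (2 * σ - 5 / 2) * (‖p‖ ^ σ)⁻¹ := by
      rw [← Real.rpow_neg np.le, ← Real.rpow_add np]; congr 1; ring
    have a2 : ‖q‖ ^ (-(3 / 2 - (5 / 2 - σ))) = ‖q‖ * (‖q‖ ^ σ)⁻¹ := by
      rw [← Real.rpow_neg nq.le]; nth_rewrite 2 [← Real.rpow_one ‖q‖]
      rw [← Real.rpow_add nq]; congr 1; ring
    have a3 : ‖q‖ ^ (-(3 / 2 - σ)) = ‖q‖ ^ (2 * σ - 5 / 2) * (‖q‖ * (‖q‖ ^ σ)⁻¹) := by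
      rw [← a2, ← Real.rpow_add nq]; congr 1; ring
    rw [a1, a2, a3, Real.rpow_neg np.le]; ring
  calc _ ≤ (‖p‖ ^ (2 * σ - 5 / 2) + ‖q‖ ^ (2 * σ - 5 / 2)) *
      ((‖p‖ ^ σ)⁻¹ * (‖q‖ * (‖q‖ ^ σ)⁻¹)) := by
        gcongr; exact rpow_norm_add_le (by linarith) (by linarith) p q
    _ ≤ _ := by
      rw [e1, add_assoc]
      exact le_add_of_nonneg_left (by positivity)

lemma exists_isWeightPair_inhom {r σ : ℝ} (h0 : 5 / 4 ≤ σ) (h1 : σ < 3 / 2) (hr : σ ≤ r) :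
    ∃ C, IsWeightPair (inhomSymbol r) (inhomSymbol (r + σ - 5 / 2)) C := by
  refine exists_isWeightPair (measurable_inhomSymbol _) (measurable_inhomSymbol _)
    (fun p _ => inhomSymbol_pos _ p) (fun p _ => inhomSymbol_pos _ p) ![5 / 4, 5 / 2 - σ, σ]
    (fun i => by fin_cases i <;> constructor <;> norm_num <;> linarith)
    (D := 2 ^ (r - σ)) (by positivity) ?_
  intro p q hp hq
  have np : 0 < ‖p‖ := norm_pos_iff.2 hp
  have nq : 0 < ‖q‖ := norm_pos_iff.2 hq
  have bp := bracket_pos ‖p‖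
  have bq := bracket_pos ‖q‖
  have bpq := bracket_pos ‖p + q‖
  have lp : ‖p‖ ≤ bracket ‖p‖ := (le_abs_self _).trans (abs_le_bracket _)
  have lq : ‖q‖ ≤ bracket ‖q‖ := (le_abs_self _).trans (abs_le_bracket _)
  simp only [inhomSymbol, Fin.sum_univ_three, Matrix.cons_val]
  set β := 2 * σ - 5 / 2
  -- the factor `⟨p⟩^(r-σ)` is submultiplicative and passes to the two inputs
  have s1 : bracket ‖p + q‖ ^ (r - σ) ≤
      2 ^ (r - σ) * bracket ‖p‖ ^ (r - σ) * bracket ‖q‖ ^ (r - σ) := by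
    rw [← Real.mul_rpow (by norm_num) bp.le, ← Real.mul_rpow (by positivity) bq.le]
    refine Real.rpow_le_rpow bpq.le ?_ (by linarith)
    exact (bracket_mono (norm_nonneg _) (norm_add_le p q)).trans (bracket_add_le _ _)
  have s2 : bracket ‖p + q‖ ^ β ≤ 1 + ‖p‖ ^ β + ‖q‖ ^ β := by
    have b0 : 0 ≤ β := by simp only [β]; linarith
    have b1 : β ≤ 1 := by simp only [β]; linarith
    calc _ ≤ (1 + ‖p + q‖) ^ β := Real.rpow_le_rpow bpq.le (bracket_le_one_add (norm_nonneg _)) b0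
      _ ≤ 1 ^ β + ‖p + q‖ ^ β := Real.rpow_add_le_add_rpow zero_le_one (norm_nonneg _) b0 b1
      _ ≤ _ := by
        rw [Real.one_rpow, add_assoc]
        gcongr
        exact rpow_norm_add_le b0 b1 p q
  have inv1 : ∀ x : ℝ, 0 < x → x ^ (r - σ) * (x ^ r)⁻¹ = x ^ (-σ) := fun x hx => by
    rw [← Real.rpow_neg hx.le, ← Real.rpow_add hx]; congr 1; ring
  have dec : ∀ (x s : ℝ), 0 < x → 0 ≤ s → s ≤ σ → bracket x ^ (-σ) ≤ x ^ (-s) := by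
    intro x s hx hs hsσ
    have l1 : x ≤ bracket x := (le_abs_self _).trans (abs_le_bracket _)
    calc _ ≤ bracket x ^ (-s) := Real.rpow_le_rpow_of_exponent_le (one_le_bracket x) (by linarith)
      _ ≤ _ := Real.rpow_le_rpow_of_nonpos hx l1 (by linarith)
  have dec' : ∀ (x s : ℝ), 0 < x → 0 ≤ s → s ≤ σ → x * bracket x ^ (-σ) ≤ x ^ (-(s - 1)) := by
    intro x s hx hs hsσ
    calc _ ≤ x ^ (1 : ℝ) * x ^ (-s) := by
          rw [Real.rpow_one]; exact mul_le_mul_of_nonneg_left (dec x s hx hs hsσ) hx.le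
      _ = _ := by rw [← Real.rpow_add hx]; congr 1; ring
  have t1 : bracket ‖p‖ ^ (-σ) * (‖q‖ * bracket ‖q‖ ^ (-σ)) ≤
      ‖p‖ ^ (-(5 / 4 : ℝ)) * ‖q‖ ^ (-(3 / 2 - 5 / 4) : ℝ) := by
    refine mul_le_mul ?_ ?_ (by positivity) (by positivity)
    · exact dec _ _ np (by norm_num) h0
    · refine (dec' _ (5 / 4) nq (by norm_num) h0).trans_eq ?_
      norm_num
  have t2 : ‖p‖ ^ β * bracket ‖p‖ ^ (-σ) * (‖q‖ * bracket ‖q‖ ^ (-σ)) ≤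
      ‖p‖ ^ (-(5 / 2 - σ)) * ‖q‖ ^ (-(3 / 2 - (5 / 2 - σ))) := by
    refine mul_le_mul ?_ ?_ (by positivity) (by positivity)
    · calc _ ≤ ‖p‖ ^ β * ‖p‖ ^ (-σ) :=
            mul_le_mul_of_nonneg_left (dec _ _ np (by linarith) le_rfl) (by positivity)
        _ = _ := by rw [← Real.rpow_add np]; congr 1; simp only [β]; ring
    · refine (dec' _ σ nq (by linarith) le_rfl).trans_eq ?_
      congr 1; ring
  have t3 : bracket ‖p‖ ^ (-σ) * (‖q‖ ^ β * (‖q‖ * bracket ‖q‖ ^ (-σ))) ≤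
      ‖p‖ ^ (-σ) * ‖q‖ ^ (-(3 / 2 - σ)) := by
    refine mul_le_mul ?_ ?_ (by positivity) (by positivity)
    · exact dec _ _ np (by linarith) le_rfl
    · calc _ ≤ ‖q‖ ^ β * ‖q‖ ^ (-(σ - 1)) :=
            mul_le_mul_of_nonneg_left (dec' _ _ nq (by linarith) le_rfl) (by positivity)
        _ = _ := by rw [← Real.rpow_add nq]; congr 1; simp only [β]; ring
  calc bracket ‖p + q‖ ^ (r + σ - 5 / 2) * ((bracket ‖p‖ ^ r)⁻¹ * (‖q‖ * (bracket ‖q‖ ^ r)⁻¹))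
      = bracket ‖p + q‖ ^ (r - σ) * bracket ‖p + q‖ ^ β *
          ((bracket ‖p‖ ^ r)⁻¹ * (‖q‖ * (bracket ‖q‖ ^ r)⁻¹)) := by
        rw [← Real.rpow_add bpq]; congr 2; simp only [β]; ring
    _ ≤ (2 ^ (r - σ) * bracket ‖p‖ ^ (r - σ) * bracket ‖q‖ ^ (r - σ)) *
          (1 + ‖p‖ ^ β + ‖q‖ ^ β) *
          ((bracket ‖p‖ ^ r)⁻¹ * (‖q‖ * (bracket ‖q‖ ^ r)⁻¹)) := by gcongr
    _ = 2 ^ (r - σ) * ((1 + ‖p‖ ^ β + ‖q‖ ^ β) * ((bracket ‖p‖ ^ (r - σ) * (bracket ‖p‖ ^ r)⁻¹) *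
          (‖q‖ * (bracket ‖q‖ ^ (r - σ) * (bracket ‖q‖ ^ r)⁻¹)))) := by ring
    _ = 2 ^ (r - σ) * (bracket ‖p‖ ^ (-σ) * (‖q‖ * bracket ‖q‖ ^ (-σ)) +
          ‖p‖ ^ β * bracket ‖p‖ ^ (-σ) * (‖q‖ * bracket ‖q‖ ^ (-σ)) +
          bracket ‖p‖ ^ (-σ) * (‖q‖ ^ β * (‖q‖ * bracket ‖q‖ ^ (-σ)))) := by
        rw [inv1 _ bp, inv1 _ bq]; ring
    _ ≤ _ := by gcongr

end

end NSE
namespace NSE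

noncomputable section

/-! ### The Duhamel kernel in exponential weights -/

/-- Completing the square: `τ (μx - x²) = τμ²/4 - y²` with `y = √τ (x - μ/2)`, and powers of
`⟨√τ x⟩` are absorbed by the Gaussian at the price of powers of `⟨μ√τ⟩`. -/
lemma bracket_rpow_mul_exp_le {τ μ x γ : ℝ} (hτ : 0 ≤ τ) (hμ : 0 ≤ μ) (h0 : 0 ≤ γ) (h2 : γ ≤ 2) :
    bracket (Real.sqrt τ * x) ^ γ * Real.exp (τ * (μ * x - x ^ 2)) ≤
      4 * bracket (μ * Real.sqrt τ) ^ γ * Real.exp (μ ^ 2 * τ / 4) := by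
  set w := Real.sqrt τ
  have hw : w ^ 2 = τ := Real.sq_sqrt hτ
  have hw0 : 0 ≤ w := Real.sqrt_nonneg _
  set y := w * (x - μ / 2)
  have e1 : w * x = μ * w / 2 + y := by simp only [y]; ring
  have e2 : τ * (μ * x - x ^ 2) = μ ^ 2 * τ / 4 + -y ^ 2 := by
    simp only [y]; rw [mul_pow, hw]; ring
  have b1 : bracket (w * x) ≤ 2 * bracket (μ * w) * bracket y := by
    rw [e1]
    refine (bracket_add_le _ _).trans ?_
    have := bracket_pos y
    gcongr
    exact bracket_mono (by positivity) (by nlinarith [mul_nonneg hμ hw0])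
  have b2 : bracket y ^ γ ≤ Real.exp (y ^ 2) := by
    calc _ ≤ bracket y ^ (2 : ℝ) := Real.rpow_le_rpow_of_exponent_le (one_le_bracket y) h2
      _ = y ^ 2 + 1 := by rw [Real.rpow_two, sq_bracket]; ring
      _ ≤ _ := Real.add_one_le_exp _
  have b3 : (2 : ℝ) ^ γ ≤ 4 := by
    calc (2 : ℝ) ^ γ ≤ 2 ^ (2 : ℝ) := Real.rpow_le_rpow_of_exponent_le (by norm_num) h2
      _ = 4 := by norm_num
  have p1 := bracket_pos (μ * w)
  have p2 := bracket_pos y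
  calc _ ≤ (2 * bracket (μ * w) * bracket y) ^ γ * Real.exp (τ * (μ * x - x ^ 2)) := by
        exact mul_le_mul_of_nonneg_right (Real.rpow_le_rpow (bracket_pos _).le b1 h0)
          (Real.exp_pos _).le
    _ = 2 ^ γ * bracket (μ * w) ^ γ * Real.exp (μ ^ 2 * τ / 4) *
          (bracket y ^ γ * Real.exp (-y ^ 2)) := by
        rw [Real.mul_rpow (by positivity) p2.le, Real.mul_rpow (by norm_num) p1.le, e2,
          Real.exp_add]
        ring
    _ ≤ 4 * bracket (μ * w) ^ γ * Real.exp (μ ^ 2 * τ / 4) * 1 := by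
        gcongr
        calc _ ≤ Real.exp (y ^ 2) * Real.exp (-y ^ 2) := by gcongr
          _ = 1 := by rw [← Real.exp_add]; simp
    _ = _ := mul_one _

lemma rpow_bracket_mul_exp_le {τ μ x γ : ℝ} (hτ : 0 < τ) (hτ1 : τ ≤ 1) (hμ : 0 ≤ μ)
    (h0 : 0 ≤ γ) (h2 : γ ≤ 2) :
    bracket x ^ γ * Real.exp (τ * (μ * x - x ^ 2)) ≤
      4 * bracket (μ * Real.sqrt τ) ^ γ * Real.exp (μ ^ 2 * τ / 4) * τ ^ (-(γ / 2)) := by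
  have hw : 0 < Real.sqrt τ := Real.sqrt_pos.2 hτ
  have b1 : Real.sqrt τ * bracket x ≤ bracket (Real.sqrt τ * x) := by
    refine abs_le_of_sq_le_sq' ?_ (bracket_pos _).le |>.2
    rw [mul_pow, sq_bracket, sq_bracket, mul_pow, Real.sq_sqrt hτ.le]
    nlinarith
  have e : τ ^ (-(γ / 2)) = (Real.sqrt τ ^ γ)⁻¹ := by
    rw [Real.sqrt_eq_rpow, ← Real.rpow_mul hτ.le, ← Real.rpow_neg hτ.le]; congr 1; ring
  rw [e, ← div_eq_mul_inv, le_div_iff₀ (by positivity)]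
  refine le_trans (le_of_eq ?_) ((mul_le_mul_of_nonneg_right
    (Real.rpow_le_rpow (by have := bracket_pos x; positivity) b1 h0) (Real.exp_pos _).le).trans
    (bracket_rpow_mul_exp_le hτ.le hμ h0 h2))
  rw [Real.mul_rpow hw.le (bracket_pos x).le]; ring

lemma rpow_mul_exp_le {τ μ x γ : ℝ} (hτ : 0 < τ) (hx : 0 ≤ x) (hμ : 0 ≤ μ)
    (h0 : 0 ≤ γ) (h2 : γ ≤ 2) :
    x ^ γ * Real.exp (τ * (μ * x - x ^ 2)) ≤
      4 * bracket (μ * Real.sqrt τ) ^ γ * Real.exp (μ ^ 2 * τ / 4) * τ ^ (-(γ / 2)) := by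
  have hw : 0 < Real.sqrt τ := Real.sqrt_pos.2 hτ
  have e : τ ^ (-(γ / 2)) = (Real.sqrt τ ^ γ)⁻¹ := by
    rw [Real.sqrt_eq_rpow, ← Real.rpow_mul hτ.le, ← Real.rpow_neg hτ.le]; congr 1; ring
  rw [e, ← div_eq_mul_inv, le_div_iff₀ (by positivity)]
  refine le_trans (le_of_eq ?_) ((mul_le_mul_of_nonneg_right
    (Real.rpow_le_rpow (z := γ) (by positivity)
      ((le_abs_self _).trans (abs_le_bracket (Real.sqrt τ * x))) h0) (Real.exp_pos _).le).trans
    (bracket_rpow_mul_exp_le hτ.le hμ h0 h2))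
  rw [Real.mul_rpow hw.le hx]; ring

/-- A symbol `d` that exceeds the weight `b` by at most the power `⟨p⟩^γ`, with `γ < 2`, so that
the heat semigroup gains it with an integrable singularity. -/
structure IsTarget (d b : Space → ℝ) (γ : ℝ) : Prop where
  meas : Measurable d
  pos : ∀ p, p ≠ 0 → 0 < d p
  le : ∀ p, p ≠ 0 → d p ≤ b p * bracket ‖p‖ ^ γ
  nonneg : 0 ≤ γ
  lt_two : γ < 2

/-- The symbol `(d/b) e^{μt|p|} e^{-(t-s)|p|²}`. -/
def kerSymbol (d b : Space → ℝ) (μ t s : ℝ) (p : Space) : ℝ :=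
  d p / b p * Real.exp (μ * t * ‖p‖ - (t - s) * ‖p‖ ^ 2)

lemma isBddSymbol_exp_neg {c : ℝ} (hc : 0 ≤ c) :
    IsBddSymbol (scalarSymbol (expSymbol (-c))) 1 := by
  refine isBddSymbol_scalar (by unfold expSymbol; fun_prop) fun p _ => ?_
  rw [expSymbol, abs_of_pos (Real.exp_pos _), Real.exp_le_one_iff]
  nlinarith [mul_nonneg hc (norm_nonneg p)]

section

variable {M : Matrix (Fin 3) (Fin 3) ℝ} {P : Space → Vec →L[ℂ] Vec} {a b d : Space → ℝ} {C γ μ : ℝ}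

lemma measurable_kerSymbol (hw : IsWeightPair a b C) (hd : IsTarget d b γ) (t s : ℝ) :
    Measurable (kerSymbol d b μ t s) := by
  have := hw.meas_b
  have := hd.meas
  unfold kerSymbol
  fun_prop

lemma IsTarget.div_le (hw : IsWeightPair a b C) (hd : IsTarget d b γ) {p : Space} (hp : p ≠ 0) :
    0 ≤ d p / b p ∧ d p / b p ≤ bracket ‖p‖ ^ γ := by
  have h1 := hw.pos_b p hp
  have h2 := hd.pos p hp
  refine ⟨by positivity, ?_⟩
  rw [div_le_iff₀ h1, mul_comm]
  exact hd.le p hp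

/-- The symbols `kerSymbol` are bounded locally uniformly in `s < t`. -/
lemma isBddSymbol_kerSymbol (hw : IsWeightPair a b C) (hd : IsTarget d b γ) (hμ : 0 ≤ μ)
    {T' δ : ℝ} (hT : 0 ≤ T') (hδ : 0 < δ) :
    ∃ K, ∀ t s, t ≤ T' → δ ≤ t - s → IsBddSymbol (scalarSymbol (kerSymbol d b μ t s)) K := by
  set τ := min δ 1
  have hτ : 0 < τ := lt_min hδ one_pos
  refine ⟨_, fun t s ht hs => isBddSymbol_scalar (measurable_kerSymbol hw hd t s) fun p hp =>
    le_trans ?_ (rpow_bracket_mul_exp_le (x := ‖p‖) hτ (min_le_right _ _)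
      (μ := μ * T' / τ) (by positivity) hd.nonneg hd.lt_two.le)⟩
  · obtain ⟨h1, h2⟩ := hd.div_le hw hp
    rw [kerSymbol, abs_of_nonneg (by positivity)]
    refine mul_le_mul h2 ?_ (Real.exp_pos _).le (h1.trans h2)
    have e : τ * (μ * T' / τ * ‖p‖ - ‖p‖ ^ 2) = μ * T' * ‖p‖ - τ * ‖p‖ ^ 2 := by
      field_simp
    rw [e]
    have : τ ≤ t - s := (min_le_left _ _).trans hs
    gcongr

variable (M P) in
/-- The Duhamel integrand
`(h, k) ↦ e^{μtA} d(A) e^{-(t-s)A²} P (M u · ∇) v` on the frequency side, where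
`h = e^{μsA} a(A) u` and `k = e^{μsA} a(A) v`. -/
def kerOp (hw : IsWeightPair a b C) (d : Space → ℝ) (μ t s : ℝ) (h k : L2) : L2 :=
  mulOp (scalarSymbol (kerSymbol d b μ t s)) (mulOp P (interOp M hw
    (mulOp (scalarSymbol (expSymbol (-(μ * s)))) h)
        (mulOp (scalarSymbol (expSymbol (-(μ * s)))) k)))

lemma kerOp_sub (hw : IsWeightPair a b C) (t s : ℝ) (h k : L2) :
    kerOp M P hw d μ t s h h - kerOp M P hw d μ t s k k =
      kerOp M P hw d μ t s (h - k) h + kerOp M P hw d μ t s k (h - k) := by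
  simp only [kerOp, map_sub, sub_apply]
  abel

lemma absKernel_exp_le {c : ℝ} (hc : 0 ≤ c) (h k : Space → Vec)
    (ξ η : Space) :
    absKernel a (fun x => ‖(expSymbol (-c) ((2 * Real.pi) • x) : ℂ) • h x‖ₑ)
      (fun x => ‖(expSymbol (-c) ((2 * Real.pi) • x) : ℂ) • k x‖ₑ) ξ η ≤
    ENNReal.ofReal (expSymbol (-c) ((2 * Real.pi) • ξ)) *
      absKernel a (fun x => ‖h x‖ₑ) (fun x => ‖k x‖ₑ) ξ η := by
  have e : ∀ x : Space, ‖((expSymbol (-c) ((2 * Real.pi) • x) : ℝ) : ℂ)‖ₑ =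
      ENNReal.ofReal (expSymbol (-c) ((2 * Real.pi) • x)) := by
    intro x
    rw [← ofReal_norm, Complex.norm_real, Real.norm_of_nonneg (by unfold expSymbol; positivity)]
  simp only [absKernel, enorm_smul, e]
  have key : ENNReal.ofReal (expSymbol (-c) ((2 * Real.pi) • η)) *
      ENNReal.ofReal (expSymbol (-c) ((2 * Real.pi) • (ξ - η))) ≤
      ENNReal.ofReal (expSymbol (-c) ((2 * Real.pi) • ξ)) := by
    rw [← ENNReal.ofReal_mul (by unfold expSymbol; positivity)]
    refine ENNReal.ofReal_le_ofReal ?_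
    simp only [expSymbol]
    rw [← Real.exp_add, Real.exp_le_exp]
    have h1 : ‖(2 * Real.pi) • ξ‖ ≤ ‖(2 * Real.pi) • η‖ + ‖(2 * Real.pi) • (ξ - η)‖ := by
      refine le_trans (le_of_eq ?_) (norm_add_le _ _)
      rw [← smul_add]; simp
    nlinarith
  set A := ENNReal.ofReal (a ((2 * Real.pi) • η))⁻¹
  set B := ENNReal.ofReal (‖(2 * Real.pi) • (ξ - η)‖ * (a ((2 * Real.pi) • (ξ - η)))⁻¹)
  set x := ENNReal.ofReal (expSymbol (-c) ((2 * Real.pi) • η))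
  set y := ENNReal.ofReal (expSymbol (-c) ((2 * Real.pi) • (ξ - η)))
  calc A * (x * ‖h η‖ₑ) * (B * (y * ‖k (ξ - η)‖ₑ)) =
        (x * y) * (A * ‖h η‖ₑ * (B * ‖k (ξ - η)‖ₑ)) := by ring
    _ ≤ _ := by gcongr

lemma enorm_interOp_exp_le (hw : IsWeightPair a b C) {c : ℝ} (hc : 0 ≤ c) (h k : L2) :
    ∀ᵐ ξ, ‖interOp M hw (mulOp (scalarSymbol (expSymbol (-c))) h)
      (mulOp (scalarSymbol (expSymbol (-c))) k) ξ‖ₑ ≤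
      ENNReal.ofReal (matConst M) * (ENNReal.ofReal (expSymbol (-c) ((2 * Real.pi) • ξ)) *
        (ENNReal.ofReal (b ((2 * Real.pi) • ξ)) *
          ∫⁻ η, absKernel a (fun x => ‖h x‖ₑ) (fun x => ‖k x‖ₑ) ξ η)) := by
  have hE := isBddSymbol_exp_neg hc
  filter_upwards [coeFn_interOp (M := M) hw (mulOp (scalarSymbol (expSymbol (-c))) h)
      (mulOp (scalarSymbol (expSymbol (-c))) k), ae_ne_zero] with ξ e4 e5
  rw [e4, interFun_congr (coeFn_mulOp_scalar hE h) (coeFn_mulOp_scalar hE k)]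
  refine (hw.enorm_interFun_le _ _ e5).trans ?_
  refine mul_le_mul' le_rfl ?_
  calc _ ≤ ENNReal.ofReal (b ((2 * Real.pi) • ξ)) *
        ∫⁻ η, ENNReal.ofReal (expSymbol (-c) ((2 * Real.pi) • ξ)) *
          absKernel a (fun x => ‖h x‖ₑ) (fun x => ‖k x‖ₑ) ξ η :=
        mul_le_mul' le_rfl (lintegral_mono fun η => absKernel_exp_le hc _ _ ξ η)
    _ = _ := by
        rw [lintegral_const_mul' _ _ ENNReal.ofReal_ne_top, mul_left_comm]

/-- The exponential weights contribute `e^{(t-s)(μ|p| - |p|²)}` altogether, since `|p|` is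
subadditive. -/
lemma norm_kerOp_le (hw : IsWeightPair a b C) (hd : IsTarget d b γ) (hP : IsBddSymbol P 1)
    (hμ : 0 ≤ μ) {t s : ℝ} (hs : 0 ≤ s) (hst : s < t) (h1 : t - s ≤ 1) (h k : L2) :
    ‖kerOp M P hw d μ t s h k‖ ≤
      (4 * bracket (μ * Real.sqrt (t - s)) ^ γ * Real.exp (μ ^ 2 * (t - s) / 4) *
        (t - s) ^ (-(γ / 2))) * (matConst M * C) * (‖h‖ * ‖k‖) := by
  set A := 4 * bracket (μ * Real.sqrt (t - s)) ^ γ * Real.exp (μ ^ 2 * (t - s) / 4) *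
        (t - s) ^ (-(γ / 2)) with hAdef
  have hA : 0 ≤ A := by
    have := bracket_pos (μ * Real.sqrt (t - s))
    have : 0 < t - s := sub_pos.2 hst
    positivity
  have hM := matConst_nonneg M
  have hC := hw.nonneg
  obtain ⟨K, hK⟩ := isBddSymbol_kerSymbol hw hd hμ (T' := t) (δ := t - s) (by linarith)
    (sub_pos.2 hst)
  have hK := hK t s le_rfl le_rfl
  have hbd := enorm_interOp_exp_le (M := M) hw (mul_nonneg hμ hs) h k
  rw [kerOp]
  generalize interOp M hw (mulOp (scalarSymbol (expSymbol (-(μ * s)))) h)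
    (mulOp (scalarSymbol (expSymbol (-(μ * s)))) k) = N at hbd ⊢
  have hmain := hw.eLpNorm_le h k (A := ENNReal.ofReal (A * matConst M))
    (u := mulOp (scalarSymbol (kerSymbol d b μ t s)) (mulOp P N)) ?_
  · rw [Lp.norm_def]
    refine ENNReal.toReal_le_of_le_ofReal (by positivity) (hmain.trans (le_of_eq ?_))
    rw [← ofReal_norm, ← ofReal_norm, ← ENNReal.ofReal_mul (by positivity),
      ← ENNReal.ofReal_mul hC, ← ENNReal.ofReal_mul (by positivity)]
    congr 1; ring
  filter_upwards [coeFn_mulOp_scalar hK (mulOp P N), coeFn_mulOp hP N, hP.2, hbd, ae_ne_zero]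
    with ξ e1 e2 e3 e4 e5
  rw [e1, e2, enorm_smul]
  obtain ⟨d0, d1⟩ := hd.div_le hw (two_pi_smul_ne_zero e5)
  have f1 : ‖P ((2 * Real.pi) • ξ) (N ξ)‖ₑ ≤ ‖N ξ‖ₑ := by
    rw [← ofReal_norm, ← ofReal_norm]
    refine ENNReal.ofReal_le_ofReal ((ContinuousLinearMap.le_opNorm _ _).trans ?_)
    exact mul_le_of_le_one_left (norm_nonneg _) e3
  have f3 : ‖((kerSymbol d b μ t s ((2 * Real.pi) • ξ) : ℝ) : ℂ)‖ₑ *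
      ENNReal.ofReal (expSymbol (-(μ * s)) ((2 * Real.pi) • ξ)) ≤ ENNReal.ofReal A := by
    rw [← ofReal_norm, Complex.norm_real, ← ENNReal.ofReal_mul (norm_nonneg _)]
    refine ENNReal.ofReal_le_ofReal (le_trans (le_of_eq ?_)
      ((mul_le_mul_of_nonneg_right d1 (Real.exp_pos _).le).trans
        (rpow_bracket_mul_exp_le (μ := μ) (sub_pos.2 hst) h1 hμ hd.nonneg hd.lt_two.le)))
    rw [kerSymbol, Real.norm_of_nonneg (by positivity), expSymbol, mul_assoc, ← Real.exp_add]
    congr 2; ring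
  refine (mul_le_mul' le_rfl (f1.trans e4)).trans ?_
  rw [ENNReal.ofReal_mul hA]
  generalize ‖((kerSymbol d b μ t s ((2 * Real.pi) • ξ) : ℝ) : ℂ)‖ₑ = x at f3 ⊢
  generalize ENNReal.ofReal (expSymbol (-(μ * s)) ((2 * Real.pi) • ξ)) = E at f3 ⊢
  generalize ENNReal.ofReal (b ((2 * Real.pi) • ξ)) * _ = S
  calc x * (ENNReal.ofReal (matConst M) * (E * S)) = (x * E) * ENNReal.ofReal (matConst M) * S := by
        ring
    _ ≤ _ := by gcongr

lemma tendsto_mulOp_expSymbol {ι : Type*} {l : Filter ι} [l.IsCountablyGenerated] {c : ι → ℝ}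
    {c₀ : ℝ} (hc : ∀ᶠ i in l, 0 ≤ c i) (hc₀ : 0 ≤ c₀) (hlim : Tendsto c l (𝓝 c₀)) {h : ι → L2}
        {h₀ : L2}
    (hh : Tendsto h l (𝓝 h₀)) :
    Tendsto (fun i => mulOp (scalarSymbol (expSymbol (-(c i)))) (h i)) l
      (𝓝 (mulOp (scalarSymbol (expSymbol (-c₀))) h₀)) := by
  refine tendsto_mulOp (C := 1) (hc.mono fun i hi => isBddSymbol_exp_neg hi)
    (isBddSymbol_exp_neg hc₀) (.of_forall fun ξ => ?_) hh
  have : Continuous fun x : ℝ => scalarSymbol (expSymbol (-x)) ((2 * Real.pi) • ξ) := by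
    unfold scalarSymbol expSymbol; fun_prop
  exact (this.tendsto c₀).comp hlim

lemma tendsto_mulOp_interOp (hw : IsWeightPair a b C) {ι : Type*} {l : Filter ι}
    {h k : ι → L2} {h₀ k₀ : L2} (hh : Tendsto h l (𝓝 h₀)) (hk : Tendsto k l (𝓝 k₀)) :
    Tendsto (fun i => mulOp P (interOp M hw (h i) (k i))) l (𝓝 (mulOp P (interOp M hw h₀ k₀))) :=
  have h1 := ((interOp M hw).continuous₂.tendsto (h₀, k₀)).comp (hh.prodMk_nhds hk)
  ((mulOp P).continuous.tendsto _).comp h1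

lemma tendsto_mulOp_kerSymbol (hw : IsWeightPair a b C) (hd : IsTarget d b γ) (hμ : 0 ≤ μ)
    {ι : Type*} {l : Filter ι} [l.IsCountablyGenerated] {t s : ι → ℝ} {t₀ s₀ : ℝ} {h : ι → L2}
    {h₀ : L2} (hs₀ : 0 ≤ s₀) (hst : s₀ < t₀) (ht : Tendsto t l (𝓝 t₀))
    (hs' : Tendsto s l (𝓝 s₀)) (hh : Tendsto h l (𝓝 h₀)) :
    Tendsto (fun i => mulOp (scalarSymbol (kerSymbol d b μ (t i) (s i))) (h i)) l
      (𝓝 (mulOp (scalarSymbol (kerSymbol d b μ t₀ s₀)) h₀)) := by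
  obtain ⟨K, hK⟩ := isBddSymbol_kerSymbol hw hd hμ (T' := t₀ + 1) (δ := (t₀ - s₀) / 2)
    (by linarith) (by linarith)
  refine tendsto_mulOp (m := fun i => scalarSymbol (kerSymbol d b μ (t i) (s i))) (C := K) ?_
    (hK t₀ s₀ (by linarith) (by linarith)) (.of_forall fun ξ => ?_) hh
  · filter_upwards [ht.eventually (gt_mem_nhds (show t₀ < t₀ + 1 by linarith)),
      (ht.sub hs').eventually (lt_mem_nhds (show (t₀ - s₀) / 2 < t₀ - s₀ by linarith))] with i h1 h2
    exact hK _ _ h1.le h2.le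
  · have h1 : Tendsto (fun i => kerSymbol d b μ (t i) (s i) ((2 * Real.pi) • ξ)) l
        (𝓝 (kerSymbol d b μ t₀ s₀ ((2 * Real.pi) • ξ))) := by
      unfold kerSymbol
      refine Tendsto.const_mul _ ((Real.continuous_exp.tendsto _).comp ?_)
      exact ((ht.const_mul μ).mul_const _).sub ((ht.sub hs').mul_const _)
    exact ((Complex.continuous_ofReal.tendsto _).comp h1).smul_const _

lemma tendsto_kerOp (hw : IsWeightPair a b C) (hd : IsTarget d b γ) (hμ : 0 ≤ μ) {ι : Type*}
    {l : Filter ι} [l.IsCountablyGenerated] {t s : ι → ℝ} {t₀ s₀ : ℝ} {h k : ι → L2} {h₀ k₀ : L2}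
    (hs : ∀ᶠ i in l, 0 ≤ s i) (hs₀ : 0 ≤ s₀) (hst : s₀ < t₀) (ht : Tendsto t l (𝓝 t₀))
    (hs' : Tendsto s l (𝓝 s₀)) (hh : Tendsto h l (𝓝 h₀)) (hk : Tendsto k l (𝓝 k₀)) :
    Tendsto (fun i => kerOp M P hw d μ (t i) (s i) (h i) (k i)) l
      (𝓝 (kerOp M P hw d μ t₀ s₀ h₀ k₀)) := by
  have e1 := tendsto_mulOp_expSymbol (hs.mono fun i hi => mul_nonneg hμ hi) (mul_nonneg hμ hs₀)
    (hs'.const_mul μ) hh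
  have e2 := tendsto_mulOp_expSymbol (hs.mono fun i hi => mul_nonneg hμ hi) (mul_nonneg hμ hs₀)
    (hs'.const_mul μ) hk
  exact tendsto_mulOp_kerSymbol hw hd hμ hs₀ hst ht hs' (tendsto_mulOp_interOp hw e1 e2)

end

end

end NSE
namespace NSE

noncomputable section

/-! ### The Duhamel integral -/

/-- The constant in the bound of `∫₀ᵗ (t-s)^(-κ) s^(-q) ds`. -/
def singConst (κ q : ℝ) : ℝ := 2 / (1 - q) + 2 / (1 - κ)

lemma singConst_nonneg {κ q : ℝ} (hκ : κ < 1) (hq : q < 1) : 0 ≤ singConst κ q := by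
  unfold singConst
  have : 0 < 1 - κ := by linarith
  have : 0 < 1 - q := by linarith
  positivity

lemma rpow_mul_rpow_le {κ q t s : ℝ} (hκ : 0 ≤ κ) (hq : 0 ≤ q) (hs : 0 < s) (hst : s < t) :
    (t - s) ^ (-κ) * s ^ (-q) ≤ (t / 2) ^ (-κ) * s ^ (-q) + (t / 2) ^ (-q) * (t - s) ^ (-κ) := by
  have h1 : 0 < t - s := by linarith
  have ht : 0 < t / 2 := by linarith
  rcases le_total s (t / 2) with h | h
  · refine le_add_of_le_of_nonneg ?_ (by positivity)
    refine mul_le_mul_of_nonneg_right ?_ (by positivity)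
    exact Real.rpow_le_rpow_of_nonpos ht (by linarith) (by linarith)
  · refine le_add_of_nonneg_of_le (by positivity) ?_
    rw [mul_comm]
    refine mul_le_mul_of_nonneg_right ?_ (by positivity)
    exact Real.rpow_le_rpow_of_nonpos ht h (by linarith)

lemma intervalIntegrable_singular {κ q t : ℝ} (hκ0 : 0 ≤ κ) (hq0 : 0 ≤ q) (hκ : κ < 1)
    (hq : q < 1) (ht : 0 < t) :
    IntervalIntegrable (fun s => (t - s) ^ (-κ) * s ^ (-q)) volume 0 t ∧
      ∫ s in (0 : ℝ)..t, (t - s) ^ (-κ) * s ^ (-q) ≤ t ^ (1 - κ - q) * singConst κ q := by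
  have i1 : IntervalIntegrable (fun s : ℝ => s ^ (-q)) volume 0 t :=
    intervalIntegral.intervalIntegrable_rpow' (by linarith)
  have i2 : IntervalIntegrable (fun s : ℝ => (t - s) ^ (-κ)) volume 0 t := by
    have := (intervalIntegral.intervalIntegrable_rpow' (a := t) (b := 0) (r := -κ)
      (by linarith)).comp_sub_left t
    simpa using this
  have i3 := (i1.const_mul ((t / 2) ^ (-κ))).add (i2.const_mul ((t / 2) ^ (-q)))
  have hae : ∀ᵐ s ∂volume.restrict (uIoc 0 t),
      (t - s) ^ (-κ) * s ^ (-q) ≤ (t / 2) ^ (-κ) * s ^ (-q) + (t / 2) ^ (-q) * (t - s) ^ (-κ) := by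
    rw [uIoc_of_le ht.le, ← restrict_Ioo_eq_restrict_Ioc]
    filter_upwards [ae_restrict_mem measurableSet_Ioo] with s hs
    exact rpow_mul_rpow_le hκ0 hq0 hs.1 hs.2
  have hnn : ∀ᵐ s ∂volume.restrict (uIoc 0 t), 0 ≤ (t - s) ^ (-κ) * s ^ (-q) := by
    rw [uIoc_of_le ht.le]
    filter_upwards [ae_restrict_mem measurableSet_Ioc] with s hs
    have : 0 ≤ t - s := by linarith [hs.2]
    have := hs.1
    positivity
  have hint : IntervalIntegrable (fun s => (t - s) ^ (-κ) * s ^ (-q)) volume 0 t := by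
    refine i3.mono_fun (Measurable.aestronglyMeasurable (by fun_prop)) ?_
    filter_upwards [hae, hnn] with s h1 h2
    rw [Real.norm_of_nonneg h2]
    exact h1.trans (le_abs_self _)
  refine ⟨hint, ?_⟩
  have hle : ∫ s in (0 : ℝ)..t, (t - s) ^ (-κ) * s ^ (-q) ≤
      ∫ s in (0 : ℝ)..t, ((t / 2) ^ (-κ) * s ^ (-q) + (t / 2) ^ (-q) * (t - s) ^ (-κ)) := by
    refine intervalIntegral.integral_mono_ae_restrict ht.le hint i3 ?_
    rw [uIoc_of_le ht.le] at hae
    rw [← restrict_Ioc_eq_restrict_Icc]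
    exact hae
  refine hle.trans ?_
  rw [intervalIntegral.integral_add (i1.const_mul _) (i2.const_mul _),
    intervalIntegral.integral_const_mul, intervalIntegral.integral_const_mul,
    intervalIntegral.integral_comp_sub_left (fun x => x ^ (-κ)) t, sub_self, sub_zero,
    integral_rpow (Or.inl (by linarith)), integral_rpow (Or.inl (by linarith)),
    Real.zero_rpow (by linarith), Real.zero_rpow (by linarith), Real.div_rpow ht.le (by norm_num),
    Real.div_rpow ht.le (by norm_num), Real.rpow_neg (by norm_num : (0:ℝ) ≤ 2),
    Real.rpow_neg (by norm_num : (0:ℝ) ≤ 2), div_inv_eq_mul, div_inv_eq_mul, singConst]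
  have e1 : t ^ (1 - κ - q) = t ^ (-κ) * t ^ (-q + 1) := by rw [← Real.rpow_add ht]; congr 1; ring
  have e2 : t ^ (1 - κ - q) = t ^ (-q) * t ^ (-κ + 1) := by rw [← Real.rpow_add ht]; congr 1; ring
  have b1 : (2 : ℝ) ^ κ ≤ 2 := by
    calc (2 : ℝ) ^ κ ≤ 2 ^ (1 : ℝ) := Real.rpow_le_rpow_of_exponent_le (by norm_num) hκ.le
      _ = 2 := Real.rpow_one 2
  have b2 : (2 : ℝ) ^ q ≤ 2 := by
    calc (2 : ℝ) ^ q ≤ 2 ^ (1 : ℝ) := Real.rpow_le_rpow_of_exponent_le (by norm_num) hq.le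
      _ = 2 := Real.rpow_one 2
  have c1 : 0 < 1 - κ := by linarith
  have c2 : 0 < 1 - q := by linarith
  have f1 : t ^ (-κ) * 2 ^ κ * ((t ^ (-q + 1) - 0) / (-q + 1)) ≤
      t ^ (1 - κ - q) * (2 / (1 - q)) := by
    rw [e1, sub_zero, show -q + 1 = 1 - q by ring]
    calc _ = t ^ (-κ) * t ^ (1 - q) * (2 ^ κ / (1 - q)) := by ring
      _ ≤ _ := by gcongr
  have f2 : t ^ (-q) * 2 ^ q * ((t ^ (-κ + 1) - 0) / (-κ + 1)) ≤
      t ^ (1 - κ - q) * (2 / (1 - κ)) := by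
    rw [e2, sub_zero, show -κ + 1 = 1 - κ by ring]
    calc _ = t ^ (-q) * t ^ (1 - κ) * (2 ^ q / (1 - κ)) := by ring
      _ ≤ _ := by gcongr
  rw [mul_add]
  exact add_le_add f1 f2

section

variable {M : Matrix (Fin 3) (Fin 3) ℝ} {P : Space → Vec →L[ℂ] Vec} {a b d : Space → ℝ}
  {C γ μ T q W : ℝ} {h k : ℝ → L2}

variable (M P) in
/-- The Duhamel integral `∫₀ᵗ e^{μtA} d(A) e^{-(t-s)A²} P (M u(s) · ∇) v(s) ds` on the frequency
side, where `h(s) = e^{μsA} a(A) u(s)` and `k(s) = e^{μsA} a(A) v(s)`. -/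
def duhamel (hw : IsWeightPair a b C) (d : Space → ℝ) (μ : ℝ) (h k : ℝ → L2) (t : ℝ) : L2 :=
  ∫ s in (0 : ℝ)..t, kerOp M P hw d μ t s (h s) (k s)

/-- The growth condition on the two inputs under which the Duhamel integral converges. -/
structure IsInput (μ T q W : ℝ) (h k : ℝ → L2) : Prop where
  cont_left : ContinuousOn h (Ioc 0 T)
  cont_right : ContinuousOn k (Ioc 0 T)
  le : ∀ s ∈ Ioc 0 T, ‖h s‖ * ‖k s‖ ≤ W * Real.exp (μ ^ 2 * s / 2) * s ^ (-q)
  nonneg : 0 ≤ q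
  lt_one : q < 1
  nonneg_W : 0 ≤ W

/-- The constant in the bound of the Duhamel integrand. -/
def duhamelConst (M : Matrix (Fin 3) (Fin 3) ℝ) (C γ μ T : ℝ) : ℝ :=
  4 * bracket (μ * Real.sqrt T) ^ γ * (matConst M * C)

lemma duhamelConst_nonneg (hw : IsWeightPair a b C) : 0 ≤ duhamelConst M C γ μ T := by
  have := bracket_pos (μ * Real.sqrt T)
  have := matConst_nonneg M
  have := hw.nonneg
  unfold duhamelConst
  positivity

lemma norm_integrand_le (hw : IsWeightPair a b C) (hd : IsTarget d b γ) (hP : IsBddSymbol P 1)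
    (hμ : 0 ≤ μ) (hT : T ≤ 1) (hi : IsInput μ T q W h k) {t s : ℝ} (hs : 0 < s) (hst : s < t)
    (ht : t ≤ T) : ‖kerOp M P hw d μ t s (h s) (k s)‖ ≤
      duhamelConst M C γ μ T * W * Real.exp (μ ^ 2 * t / 4 + μ ^ 2 * T / 4) *
        ((t - s) ^ (-(γ / 2)) * s ^ (-q)) := by
  have h0 : 0 < t - s := by linarith
  have hM := matConst_nonneg M
  have hC := hw.nonneg
  have hW := hi.nonneg_W
  have p0 := bracket_pos (μ * Real.sqrt (t - s))
  have p1 := bracket_pos (μ * Real.sqrt T)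
  have b1 : bracket (μ * Real.sqrt (t - s)) ^ γ ≤ bracket (μ * Real.sqrt T) ^ γ := by
    refine Real.rpow_le_rpow p0.le (bracket_mono (by positivity) ?_) hd.nonneg
    gcongr; linarith
  calc _ ≤ _ := norm_kerOp_le hw hd hP hμ hs.le hst (by linarith) (h s) (k s)
    _ ≤ (4 * bracket (μ * Real.sqrt T) ^ γ * Real.exp (μ ^ 2 * (t - s) / 4) *
        (t - s) ^ (-(γ / 2))) * (matConst M * C) * (W * Real.exp (μ ^ 2 * s / 2) * s ^ (-q)) := by
        refine mul_le_mul ?_ (hi.le s ⟨hs, by linarith⟩) (by positivity) (by positivity)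
        refine mul_le_mul_of_nonneg_right ?_ (by positivity)
        refine mul_le_mul_of_nonneg_right ?_ (by positivity)
        refine mul_le_mul_of_nonneg_right ?_ (by positivity)
        linarith
    _ = duhamelConst M C γ μ T * W * (Real.exp (μ ^ 2 * (t - s) / 4) * Real.exp (μ ^ 2 * s / 2)) *
        ((t - s) ^ (-(γ / 2)) * s ^ (-q)) := by unfold duhamelConst; ring
    _ ≤ _ := by
        rw [← Real.exp_add]
        refine mul_le_mul_of_nonneg_right ?_ (by positivity)
        refine mul_le_mul_of_nonneg_left ?_ (by unfold duhamelConst; positivity)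
        rw [Real.exp_le_exp]
        nlinarith [sq_nonneg μ]

lemma continuousOn_integrand (hw : IsWeightPair a b C) (hd : IsTarget d b γ)
    (hμ : 0 ≤ μ) (hi : IsInput μ T q W h k) {t : ℝ} (ht : t ≤ T) :
    ContinuousOn (fun s => kerOp M P hw d μ t s (h s) (k s)) (Ioo 0 t) := by
  intro s hs
  have hsub : Ioo 0 t ⊆ Ioc 0 T := fun x hx => ⟨hx.1, hx.2.le.trans ht⟩
  refine tendsto_kerOp hw hd hμ (t := fun _ => t) (s := fun s => s) ?_ hs.1.le hs.2
      tendsto_const_nhds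
    (tendsto_id.mono_left nhdsWithin_le_nhds) ((hi.cont_left s (hsub hs)).mono hsub)
    ((hi.cont_right s (hsub hs)).mono hsub)
  filter_upwards [self_mem_nhdsWithin] with x hx using hx.1.le

lemma intervalIntegrable_integrand (hw : IsWeightPair a b C) (hd : IsTarget d b γ)
    (hP : IsBddSymbol P 1) (hμ : 0 ≤ μ) (hT : T ≤ 1) (hi : IsInput μ T q W h k) {t : ℝ}
    (h0 : 0 < t) (ht : t ≤ T) :
    IntervalIntegrable (fun s => kerOp M P hw d μ t s (h s) (k s)) volume 0 t := by
  have h2 := hd.lt_two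
  have h3 := hd.nonneg
  have i1 := (intervalIntegrable_singular (κ := γ / 2) (by linarith) hi.nonneg (by linarith)
    hi.lt_one h0).1.const_mul
    (duhamelConst M C γ μ T * W * Real.exp (μ ^ 2 * t / 4 + μ ^ 2 * T / 4))
  refine i1.mono_fun ?_ ?_
  · rw [uIoc_of_le h0.le, ← restrict_Ioo_eq_restrict_Ioc]
    exact (continuousOn_integrand hw hd hμ hi ht).aestronglyMeasurable measurableSet_Ioo
  · rw [uIoc_of_le h0.le, ← restrict_Ioo_eq_restrict_Ioc]
    filter_upwards [ae_restrict_mem measurableSet_Ioo] with s hs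
    exact (norm_integrand_le hw hd hP hμ hT hi hs.1 hs.2 ht).trans (le_abs_self _)

lemma norm_duhamel_le (hw : IsWeightPair a b C) (hd : IsTarget d b γ) (hP : IsBddSymbol P 1)
    (hμ : 0 ≤ μ) (hT : T ≤ 1) (hi : IsInput μ T q W h k) {t : ℝ} (h0 : 0 < t) (ht : t ≤ T) :
    ‖duhamel M P hw d μ h k t‖ ≤ duhamelConst M C γ μ T * W *
      Real.exp (μ ^ 2 * t / 4 + μ ^ 2 * T / 4) * (t ^ (1 - γ / 2 - q) * singConst (γ / 2) q) := by
  have h2 := hd.lt_two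
  have h3 := hd.nonneg
  obtain ⟨i1, i2⟩ := intervalIntegrable_singular (κ := γ / 2) (by linarith) hi.nonneg (by linarith)
    hi.lt_one h0
  have hW := hi.nonneg_W
  have hA := duhamelConst_nonneg (M := M) (γ := γ) (μ := μ) (T := T) hw
  refine (intervalIntegral.norm_integral_le_of_norm_le h0.le ?_ (i1.const_mul
    (duhamelConst M C γ μ T * W * Real.exp (μ ^ 2 * t / 4 + μ ^ 2 * T / 4)))).trans ?_
  · have : ∀ᵐ s : ℝ, s ≠ t := by simp [ae_iff]
    filter_upwards [this] with s hs hs'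
    exact norm_integrand_le hw hd hP hμ hT hi hs'.1 (lt_of_le_of_ne hs'.2 hs) ht
  · rw [intervalIntegral.integral_const_mul]
    gcongr

lemma duhamel_eq_smul (hw : IsWeightPair a b C) (t : ℝ) :
    duhamel M P hw d μ h k t =
      t • ∫ σ in (0 : ℝ)..1, kerOp M P hw d μ t (t * σ) (h (t * σ)) (k (t * σ)) := by
  have := intervalIntegral.smul_integral_comp_mul_left (a := 0) (b := 1)
    (fun s => kerOp M P hw d μ t s (h s) (k s)) t
  rw [this, duhamel, mul_zero, mul_one]

lemma continuousOn_duhamel (hw : IsWeightPair a b C) (hd : IsTarget d b γ) (hP : IsBddSymbol P 1)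
    (hμ : 0 ≤ μ) (hT : T ≤ 1) (hi : IsInput μ T q W h k) :
    ContinuousOn (duhamel M P hw d μ h k) (Ioc 0 T) := by
  have hγ2 := hd.lt_two
  have hγ0 := hd.nonneg
  have hW := hi.nonneg_W
  have hA := duhamelConst_nonneg (M := M) (γ := γ) (μ := μ) (T := T) hw
  simp_rw [continuousOn_congr (fun t _ => duhamel_eq_smul (M := M) (P := P) (d := d) (μ := μ)
    (h := h) (k := k) hw t)]
  refine continuousOn_id.smul fun t₀ ht₀ => ?_
  set D := duhamelConst M C γ μ T * W * Real.exp (μ ^ 2 * T / 4 + μ ^ 2 * T / 4)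
  set E := (t₀ / 2) ^ (-(γ / 2)) * (t₀ / 2) ^ (-q)
  have hpos : 0 < t₀ / 2 := by linarith [ht₀.1]
  have ev : ∀ᶠ t in 𝓝[Ioc 0 T] t₀, t₀ / 2 < t ∧ t ∈ Ioc 0 T :=
    Filter.Eventually.and (nhdsWithin_le_nhds (lt_mem_nhds (show t₀ / 2 < t₀ by linarith [ht₀.1])))
      self_mem_nhdsWithin
  have mem : ∀ {t σ : ℝ}, t ∈ Ioc 0 T → σ ∈ Ioo (0 : ℝ) 1 → t * σ ∈ Ioo 0 t := fun ht hσ =>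
    ⟨mul_pos ht.1 hσ.1, by nlinarith [ht.1, hσ.2]⟩
  refine intervalIntegral.continuousWithinAt_of_dominated_interval
    (bound := fun σ => D * E * ((1 - σ) ^ (-(γ / 2)) * σ ^ (-q))) ?_ ?_ ?_ ?_
  · filter_upwards [ev] with t ht
    rw [uIoc_of_le zero_le_one, ← restrict_Ioo_eq_restrict_Ioc]
    refine ContinuousOn.aestronglyMeasurable ?_ measurableSet_Ioo
    exact (continuousOn_integrand hw hd hμ hi ht.2.2).comp (by fun_prop) fun σ hσ => mem ht.2 hσ
  · filter_upwards [ev] with t ht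
    have h1 : ∀ᵐ s : ℝ, s ≠ 1 := by simp [ae_iff]
    filter_upwards [h1] with σ hσ1 hσ
    rw [uIoc_of_le zero_le_one] at hσ
    have hσ' : σ ∈ Ioo (0 : ℝ) 1 := ⟨hσ.1, lt_of_le_of_ne hσ.2 hσ1⟩
    have hm := mem ht.2 hσ'
    have h1σ : 0 < 1 - σ := by linarith [hσ'.2]
    refine (norm_integrand_le hw hd hP hμ hT hi hm.1 hm.2 ht.2.2).trans ?_
    have e1 : (t - t * σ) ^ (-(γ / 2)) ≤ (t₀ / 2) ^ (-(γ / 2)) * (1 - σ) ^ (-(γ / 2)) := by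
      rw [show t - t * σ = t * (1 - σ) by ring, Real.mul_rpow ht.2.1.le h1σ.le]
      exact mul_le_mul_of_nonneg_right
        (Real.rpow_le_rpow_of_nonpos hpos ht.1.le (by linarith)) (by positivity)
    have e2 : (t * σ) ^ (-q) ≤ (t₀ / 2) ^ (-q) * σ ^ (-q) := by
      rw [Real.mul_rpow ht.2.1.le hσ'.1.le]
      have := hσ'.1
      exact mul_le_mul_of_nonneg_right
        (Real.rpow_le_rpow_of_nonpos hpos ht.1.le (by linarith [hi.nonneg])) (by positivity)
    have e3 : Real.exp (μ ^ 2 * t / 4 + μ ^ 2 * T / 4) ≤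
        Real.exp (μ ^ 2 * T / 4 + μ ^ 2 * T / 4) := by
      rw [Real.exp_le_exp]; nlinarith [sq_nonneg μ, ht.2.2]
    have p1 := hσ'.1
    have p2 := hm.1
    calc _ ≤ D * (((t₀ / 2) ^ (-(γ / 2)) * (1 - σ) ^ (-(γ / 2))) *
          ((t₀ / 2) ^ (-q) * σ ^ (-q))) := by
          refine mul_le_mul ?_ (mul_le_mul e1 e2 (by positivity) (by positivity)) ?_ (by positivity)
          · exact mul_le_mul_of_nonneg_left e3 (by positivity)
          · have : 0 < t - t * σ := by linarith [hm.2]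
            positivity
      _ = _ := by simp only [E]; ring
  · exact (intervalIntegrable_singular (κ := γ / 2) (by linarith) hi.nonneg (by linarith)
      hi.lt_one one_pos).1.const_mul _
  · have h1 : ∀ᵐ s : ℝ, s ≠ 1 := by simp [ae_iff]
    filter_upwards [h1] with σ hσ1 hσ
    rw [uIoc_of_le zero_le_one] at hσ
    have hσ' : σ ∈ Ioo (0 : ℝ) 1 := ⟨hσ.1, lt_of_le_of_ne hσ.2 hσ1⟩
    have hm := mem ht₀ hσ'
    have hmaps : MapsTo (fun t => t * σ) (Ioc 0 T) (Ioc 0 T) := fun t ht =>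
      ⟨(mem ht hσ').1, (mem ht hσ').2.le.trans ht.2⟩
    have hc : ContinuousWithinAt (fun t : ℝ => t * σ) (Ioc 0 T) t₀ := by fun_prop
    refine tendsto_kerOp hw hd hμ ?_ hm.1.le hm.2
      (tendsto_id.mono_left nhdsWithin_le_nhds) hc
      (ContinuousWithinAt.comp (f := fun t => t * σ) (hi.cont_left _ (hmaps ht₀)) hc hmaps)
      (ContinuousWithinAt.comp (f := fun t => t * σ) (hi.cont_right _ (hmaps ht₀)) hc hmaps)
    filter_upwards [self_mem_nhdsWithin] with t ht using (mem ht hσ').1.le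

lemma duhamel_sub (hw : IsWeightPair a b C) (hd : IsTarget d b γ) (hP : IsBddSymbol P 1)
    (hμ : 0 ≤ μ) (hT : T ≤ 1) {q₁ q₂ q₃ q₄ W₁ W₂ W₃ W₄ : ℝ}
    (h1 : IsInput μ T q₁ W₁ h h) (h2 : IsInput μ T q₂ W₂ k k)
    (h3 : IsInput μ T q₃ W₃ (fun s => h s - k s) h) (h4 : IsInput μ T q₄ W₄ k (fun s => h s - k s))
    {t : ℝ} (h0 : 0 < t) (ht : t ≤ T) :
    duhamel M P hw d μ h h t - duhamel M P hw d μ k k t =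
      duhamel M P hw d μ (fun s => h s - k s) h t +
        duhamel M P hw d μ k (fun s => h s - k s) t := by
  unfold duhamel
  rw [← intervalIntegral.integral_sub (intervalIntegrable_integrand hw hd hP hμ hT h1 h0 ht)
    (intervalIntegrable_integrand hw hd hP hμ hT h2 h0 ht),
    ← intervalIntegral.integral_add (intervalIntegrable_integrand hw hd hP hμ hT h3 h0 ht)
    (intervalIntegrable_integrand hw hd hP hμ hT h4 h0 ht)]
  simp only [kerOp_sub]

end

end

end NSE
namespace NSE

noncomputable section

/-! ### The contraction argument -/

/-- A bounded continuous function on `I`. -/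
structure BddContOn {H : Type*} [NormedAddCommGroup H] (I : Set ℝ) (f : ℝ → H) (F : ℝ) : Prop where
  cont : ContinuousOn f I
  le : ∀ t ∈ I, ‖f t‖ ≤ F
  nonneg : 0 ≤ F

/-- A bounded bilinear operation on the bounded continuous functions on `I`; bilinearity is used
only through the polarisation of differences. -/
structure IsBddBilin {H : Type*} [NormedAddCommGroup H] (I : Set ℝ)
    (B : (ℝ → H) → (ℝ → H) → ℝ → H) (Γ : ℝ) : Prop where
  bdd : ∀ f g F G, BddContOn I f F → BddContOn I g G → BddContOn I (B f g) (Γ * (F * G))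
  sub : ∀ f g F G, BddContOn I f F → BddContOn I g G → ∀ t ∈ I,
    B f f t - B g g t = B (fun s => f s - g s) f t + B g (fun s => f s - g s) t

section

variable {H : Type*} [NormedAddCommGroup H] {I : Set ℝ} {B : (ℝ → H) → (ℝ → H) → ℝ → H} {Γ N : ℝ}
  {y : ℝ → H}

lemma BddContOn.sub {f g : ℝ → H} {F G : ℝ} (hf : BddContOn I f F) (hg : BddContOn I g G) :
    BddContOn I (fun s => f s - g s) (F + G) :=
  ⟨hf.cont.sub hg.cont, fun t ht => (norm_sub_le _ _).trans (add_le_add (hf.le t ht) (hg.le t ht)),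
    add_nonneg hf.nonneg hg.nonneg⟩

lemma IsBddBilin.norm_apply_sub_le (hB : IsBddBilin I B Γ) (hsmall : 8 * Γ * N ≤ 1) {f g : ℝ → H}
    {D : ℝ}
    (hf : BddContOn I f (2 * N)) (hg : BddContOn I g (2 * N)) (hD : 0 ≤ D)
    (hfg : ∀ t ∈ I, ‖f t - g t‖ ≤ D) {t : ℝ} (ht : t ∈ I) :
    ‖B f f t - B g g t‖ ≤ D / 2 := by
  have hd : BddContOn I (fun s => f s - g s) D := ⟨(hf.sub hg).cont, hfg, hD⟩
  rw [hB.sub f g _ _ hf hg t ht]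
  refine (norm_add_le _ _).trans ?_
  have h1 := (hB.bdd _ _ _ _ hd hf).le t ht
  have h2 := (hB.bdd _ _ _ _ hg hd).le t ht
  nlinarith

lemma IsBddBilin.fixedPoint_unique (hB : IsBddBilin I B Γ) (hsmall : 8 * Γ * N ≤ 1)
    {f g : ℝ → H} (hf : BddContOn I f (2 * N)) (hg : BddContOn I g (2 * N))
    (hfe : ∀ t ∈ I, f t = y t - B f f t) (hge : ∀ t ∈ I, g t = y t - B g g t) {t : ℝ}
    (ht : t ∈ I) : f t = g t := by
  have key : ∀ n : ℕ, ∀ t ∈ I, ‖f t - g t‖ ≤ (2 * N + 2 * N) / 2 ^ n := by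
    intro n
    induction n with
    | zero => intro t ht; simpa using (hf.sub hg).le t ht
    | succ n ih =>
      intro t ht
      have h0 : 0 ≤ (2 * N + 2 * N) / 2 ^ n := by have := hf.nonneg; positivity
      have h1 := hB.norm_apply_sub_le hsmall hf hg h0 ih ht
      rw [hfe t ht, hge t ht, sub_sub_sub_cancel_left, norm_sub_rev]
      rw [pow_succ, ← div_div]
      exact h1
  have hlim : Tendsto (fun n : ℕ => (2 * N + 2 * N) / 2 ^ n) atTop (𝓝 0) :=
    tendsto_const_nhds.div_atTop (tendsto_pow_atTop_atTop_of_one_lt (by norm_num))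
  have := ge_of_tendsto' hlim fun n => key n t ht
  exact sub_eq_zero.1 (norm_le_zero_iff.1 this)

lemma IsBddBilin.exists_fixedPoint [CompleteSpace H] (hB : IsBddBilin I B Γ)
    (hsmall : 8 * Γ * N ≤ 1) (hy : BddContOn I y N) :
    ∃ f, BddContOn I f (2 * N) ∧ ∀ t ∈ I, f t = y t - B f f t := by
  have hN := hy.nonneg
  set u : ℕ → ℝ → H := fun n => Nat.rec (fun _ => 0) (fun _ f t => y t - B f f t) n
  have hu1 : ∀ n, u (n + 1) = fun t => y t - B (u n) (u n) t := fun n => rfl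
  have hu : ∀ n, BddContOn I (u n) (2 * N) := by
    intro n
    induction n with
    | zero => exact ⟨continuousOn_const, fun t _ => by simp [u, hN], by positivity⟩
    | succ n ih =>
      have h1 := hB.bdd _ _ _ _ ih ih
      rw [hu1]
      refine ⟨hy.cont.sub h1.cont, fun t ht => (norm_sub_le _ _).trans ?_, by positivity⟩
      have := hy.le t ht
      have := h1.le t ht
      nlinarith
  have hstep : ∀ n, ∀ t ∈ I, ‖u (n + 1) t - u n t‖ ≤ (4 * N) / 2 ^ n := by
    intro n
    induction n with
    | zero =>
      intro t ht
      have := ((hu 1).sub (hu 0)).le t ht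
      simp only [zero_add, pow_zero, div_one]
      linarith
    | succ n ih =>
      intro t ht
      have h1 := hB.norm_apply_sub_le hsmall (hu (n + 1)) (hu n) (by positivity) ih ht
      rw [hu1 (n + 1), hu1 n]
      simp only [sub_sub_sub_cancel_left]
      rw [norm_sub_rev, pow_succ, ← div_div]
      exact h1
  have hdist : ∀ t ∈ I, ∀ n, dist (u n t) (u (n + 1) t) ≤ (8 * N) / 2 / 2 ^ n := by
    intro t ht n
    rw [dist_eq_norm, norm_sub_rev]
    refine (hstep n t ht).trans_eq ?_
    ring
  have hlim : ∀ t, ∃ x, t ∈ I → Tendsto (fun n => u n t) atTop (𝓝 x) := by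
    intro t
    by_cases ht : t ∈ I
    · obtain ⟨x, hx⟩ := cauchySeq_tendsto_of_complete (cauchySeq_of_le_geometric_two (hdist t ht))
      exact ⟨x, fun _ => hx⟩
    · exact ⟨0, fun h => absurd h ht⟩
  choose f hf using hlim
  have hfu : ∀ n, ∀ t ∈ I, ‖f t - u n t‖ ≤ 8 * N / 2 ^ n := by
    intro n t ht
    rw [norm_sub_rev, ← dist_eq_norm]
    exact dist_le_of_le_geometric_two_of_tendsto (hdist t ht) (hf t ht) n
  have h8 : Tendsto (fun n : ℕ => 8 * N / 2 ^ n) atTop (𝓝 0) :=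
    tendsto_const_nhds.div_atTop (tendsto_pow_atTop_atTop_of_one_lt (by norm_num))
  have hunif : TendstoUniformlyOn u f atTop I := by
    rw [Metric.tendstoUniformlyOn_iff]
    intro ε hε
    filter_upwards [h8.eventually (gt_mem_nhds hε)] with n hn t ht
    rw [dist_eq_norm]
    exact (hfu n t ht).trans_lt hn
  have hfb : BddContOn I f (2 * N) := by
    refine ⟨hunif.continuousOn (Frequently.of_forall fun n => (hu n).cont), fun t ht => ?_,
      by positivity⟩
    exact le_of_tendsto' (hf t ht).norm fun n => (hu n).le t ht
  refine ⟨f, hfb, fun t ht => ?_⟩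
  have h1 : Tendsto (fun n => u (n + 1) t) atTop (𝓝 (f t)) :=
    (tendsto_add_atTop_iff_nat 1).2 (hf t ht)
  have h2 : Tendsto (fun n => B (u n) (u n) t) atTop (𝓝 (B f f t)) := by
    rw [tendsto_iff_norm_sub_tendsto_zero]
    refine squeeze_zero (fun _ => norm_nonneg _) (fun n => ?_) (by simpa using h8.div_const 2)
    refine hB.norm_apply_sub_le hsmall (hu n) hfb (by positivity) (fun s hs => ?_) ht
    rw [norm_sub_rev]
    exact hfu n s hs
  exact tendsto_nhds_unique h1 (h2.const_sub (y t))

end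

/-! ### The weighted Duhamel operator -/

/-- The weight `e^{-ζ(t)} t^{s₁}` with `ζ(t) = λ(t)²/4 + c ln⟨λ(t)⟩` and `λ(t) = μ√t`. -/
def omega (μ c s₁ t : ℝ) : ℝ :=
  Real.exp (-(μ ^ 2 * t / 4)) * bracket (μ * Real.sqrt t) ^ (-c) * t ^ s₁

lemma omega_pos {μ c s₁ t : ℝ} (ht : 0 < t) : 0 < omega μ c s₁ t := by
  have := bracket_pos (μ * Real.sqrt t)
  unfold omega
  positivity

lemma continuousOn_omega {μ c s₁ : ℝ} : ContinuousOn (omega μ c s₁) (Ioi 0) := by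
  unfold omega
  have h1 : Continuous fun t : ℝ => bracket (μ * Real.sqrt t) :=
    continuous_bracket.comp (by fun_prop)
  refine ContinuousOn.mul (ContinuousOn.mul (by fun_prop) ?_) ?_
  · exact (h1.continuousOn).rpow_const fun t _ => Or.inl (bracket_pos _).ne'
  · exact continuousOn_id.rpow_const fun t ht => Or.inl (ne_of_gt ht)

/-- Passage from the normalised function `f = e^{-ζ} t^{s₁} e^{θA} a(A) v` to `e^{θA} a(A) v`. -/
def unweight (μ c s₁ : ℝ) (f : ℝ → L2) (t : ℝ) : L2 := (((omega μ c s₁ t)⁻¹ : ℝ) : ℂ) • f t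

section

variable {M : Matrix (Fin 3) (Fin 3) ℝ} {P : Space → Vec →L[ℂ] Vec} {a b d : Space → ℝ}
  {C γ μ T c s₁ : ℝ}

lemma continuousOn_unweight {f : ℝ → L2} (hf : ContinuousOn f (Ioc 0 T)) :
    ContinuousOn (unweight μ c s₁ f) (Ioc 0 T) := by
  have h : ContinuousOn (fun t => (((omega μ c s₁ t)⁻¹ : ℝ) : ℂ)) (Ioc 0 T) :=
    Complex.continuous_ofReal.comp_continuousOn
      ((continuousOn_omega.mono fun t ht => ht.1).inv₀ fun t ht => (omega_pos ht.1).ne')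
  exact h.smul hf

lemma norm_unweight {f : ℝ → L2} {t : ℝ} (ht : 0 < t) :
    ‖unweight μ c s₁ f t‖ = Real.exp (μ ^ 2 * t / 4) * bracket (μ * Real.sqrt t) ^ c *
      t ^ (-s₁) * ‖f t‖ := by
  have hp := omega_pos (μ := μ) (c := c) (s₁ := s₁) ht
  rw [unweight, norm_smul, Complex.norm_real, Real.norm_of_nonneg (by positivity), omega,
    mul_inv, mul_inv, ← Real.exp_neg, neg_neg, Real.rpow_neg (bracket_pos _).le, inv_inv,
    Real.rpow_neg ht.le]

lemma norm_unweight_le (hμ : 0 ≤ μ) (hc : 0 ≤ c) {f : ℝ → L2} {t F α : ℝ} (ht : t ∈ Ioc 0 T)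
    (hf : ‖f t‖ ≤ F * t ^ α) :
    ‖unweight μ c s₁ f t‖ ≤ bracket (μ * Real.sqrt T) ^ c * F * Real.exp (μ ^ 2 * t / 4) *
      t ^ (-(s₁ - α)) := by
  have h0 := ht.1
  have p1 := bracket_pos (μ * Real.sqrt T)
  have b1 : bracket (μ * Real.sqrt t) ^ c ≤ bracket (μ * Real.sqrt T) ^ c := by
    refine Real.rpow_le_rpow (bracket_pos _).le (bracket_mono (by positivity) ?_) hc
    gcongr; exact ht.2
  have p2 := bracket_pos (μ * Real.sqrt t)
  rw [norm_unweight h0]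
  calc _ ≤ Real.exp (μ ^ 2 * t / 4) * bracket (μ * Real.sqrt T) ^ c * t ^ (-s₁) * (F * t ^ α) := by
        refine mul_le_mul ?_ hf (norm_nonneg _) (by positivity)
        refine mul_le_mul_of_nonneg_right ?_ (by positivity)
        exact mul_le_mul_of_nonneg_left b1 (Real.exp_pos _).le
    _ = bracket (μ * Real.sqrt T) ^ c * F * Real.exp (μ ^ 2 * t / 4) *
        (t ^ (-s₁) * t ^ α) := by ring
    _ = _ := by rw [← Real.rpow_add h0]; congr 2; ring

/-- Bounded functions decaying like `t^α` are admissible inputs, with the singularity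
`q = 2 (s₁ - α)`. -/
lemma isInput_unweight (hμ : 0 ≤ μ) (hc : 0 ≤ c) {f g : ℝ → L2} {F G α : ℝ}
    (hf : ContinuousOn f (Ioc 0 T)) (hg : ContinuousOn g (Ioc 0 T)) (hF : 0 ≤ F) (hG : 0 ≤ G)
    (hf' : ∀ t ∈ Ioc 0 T, ‖f t‖ ≤ F * t ^ α) (hg' : ∀ t ∈ Ioc 0 T, ‖g t‖ ≤ G * t ^ α)
    (h0 : 0 ≤ s₁ - α) (h1 : 2 * (s₁ - α) < 1) :
    IsInput μ T (2 * (s₁ - α)) (bracket (μ * Real.sqrt T) ^ (2 * c) * (F * G))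
      (unweight μ c s₁ f) (unweight μ c s₁ g) := by
  have p1 := bracket_pos (μ * Real.sqrt T)
  refine ⟨continuousOn_unweight hf, continuousOn_unweight hg, fun t ht => ?_, by linarith, h1,
    by positivity⟩
  have ht0 := ht.1
  refine (mul_le_mul (norm_unweight_le hμ hc ht (hf' t ht)) (norm_unweight_le hμ hc ht (hg' t ht))
    (norm_nonneg _) (by positivity)).trans (le_of_eq ?_)
  rw [show 2 * c = c + c by ring, show -(2 * (s₁ - α)) = -(s₁ - α) + -(s₁ - α) by ring,
    Real.rpow_add p1, Real.rpow_add ht0,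
    show μ ^ 2 * t / 2 = μ ^ 2 * t / 4 + μ ^ 2 * t / 4 by ring, Real.exp_add]
  ring

variable (M P) in
/-- The bilinear operator of the integral equation (up to sign), in the normalisation of the
space of bounded continuous functions. -/
def bilinOp (hw : IsWeightPair a b C) (μ c s₁ : ℝ) (f g : ℝ → L2) (t : ℝ) : L2 :=
  (omega μ c s₁ t : ℂ) • duhamel M P hw a μ (unweight μ c s₁ f) (unweight μ c s₁ g) t

/-- The constant `⟨λ₀⟩^{γ+2c} e^{λ₀²/4}` times one depending on the exponents only. -/
def bilinConst (M : Matrix (Fin 3) (Fin 3) ℝ) (C γ c q μ T : ℝ) : ℝ :=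
  duhamelConst M C γ μ T * bracket (μ * Real.sqrt T) ^ (2 * c) * Real.exp (μ ^ 2 * T / 4) *
    singConst (γ / 2) q

lemma bilinConst_nonneg (hw : IsWeightPair a b C) {q : ℝ} (hγ : γ < 2) (hq : q < 1) :
    0 ≤ bilinConst M C γ c q μ T := by
  have h1 := duhamelConst_nonneg (M := M) (γ := γ) (μ := μ) (T := T) hw
  have h2 := singConst_nonneg (κ := γ / 2) (q := q) (by linarith) hq
  have h3 := bracket_pos (μ * Real.sqrt T)
  unfold bilinConst
  positivity

lemma norm_duhamel_unweight_le (hw : IsWeightPair a b C) (hd : IsTarget d b γ)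
    (hP : IsBddSymbol P 1) (hμ : 0 ≤ μ) (hT : T ≤ 1) (hc : 0 ≤ c) {f g : ℝ → L2} {F G α : ℝ}
    (hf : ContinuousOn f (Ioc 0 T)) (hg : ContinuousOn g (Ioc 0 T)) (hF : 0 ≤ F) (hG : 0 ≤ G)
    (hf' : ∀ t ∈ Ioc 0 T, ‖f t‖ ≤ F * t ^ α) (hg' : ∀ t ∈ Ioc 0 T, ‖g t‖ ≤ G * t ^ α)
    (h0 : 0 ≤ s₁ - α) (h1 : 2 * (s₁ - α) < 1) {t : ℝ} (ht : t ∈ Ioc 0 T) :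
    ‖duhamel M P hw d μ (unweight μ c s₁ f) (unweight μ c s₁ g) t‖ ≤
      bilinConst M C γ c (2 * (s₁ - α)) μ T * (F * G) * Real.exp (μ ^ 2 * t / 4) *
        t ^ (1 - γ / 2 - 2 * (s₁ - α)) := by
  refine (norm_duhamel_le hw hd hP hμ hT (isInput_unweight hμ hc hf hg hF hG hf' hg' h0 h1)
    ht.1 ht.2).trans (le_of_eq ?_)
  rw [Real.exp_add, bilinConst]
  ring

lemma omega_mul_exp_le (hc : 0 ≤ c) {t : ℝ} (ht : 0 < t) :
    omega μ c s₁ t * Real.exp (μ ^ 2 * t / 4) ≤ t ^ s₁ := by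
  have e : omega μ c s₁ t * Real.exp (μ ^ 2 * t / 4) =
      bracket (μ * Real.sqrt t) ^ (-c) * t ^ s₁ := by
    rw [omega, Real.exp_neg]
    field_simp
  rw [e]
  refine mul_le_of_le_one_left (by positivity) ?_
  exact Real.rpow_le_one_of_one_le_of_nonpos (one_le_bracket _) (by linarith)

lemma norm_bilinOp_le (hw : IsWeightPair a b C) (hd : IsTarget a b γ)
    (hP : IsBddSymbol P 1) (hμ : 0 ≤ μ) (hT : T ≤ 1) (hc : 0 ≤ c) {f g : ℝ → L2} {F G : ℝ}
    (hf : BddContOn (Ioc 0 T) f F) (hg : BddContOn (Ioc 0 T) g G)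
    (h0 : 0 ≤ s₁) (h1 : 2 * s₁ < 1) {t : ℝ} (ht : t ∈ Ioc 0 T) :
    ‖bilinOp M P hw μ c s₁ f g t‖ ≤
      bilinConst M C γ c (2 * s₁) μ T * (F * G) * t ^ (1 - γ / 2 - s₁) := by
  have h := norm_duhamel_unweight_le (M := M) (s₁ := s₁) (α := 0) hw hd hP hμ hT hc hf.cont hg.cont
      hf.nonneg
    hg.nonneg (fun t ht => by simpa using hf.le t ht) (fun t ht => by simpa using hg.le t ht)
    (by simpa using h0) (by simpa using h1) ht
  rw [sub_zero] at h
  have hpos := omega_pos (μ := μ) (c := c) (s₁ := s₁) ht.1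
  have hB := bilinConst_nonneg (M := M) (γ := γ) (c := c) (μ := μ) (T := T) hw hd.lt_two h1
  have ht0 := ht.1
  have hF := hf.nonneg
  have hG := hg.nonneg
  rw [bilinOp, norm_smul, Complex.norm_real, Real.norm_of_nonneg hpos.le]
  calc _ ≤ omega μ c s₁ t * (bilinConst M C γ c (2 * s₁) μ T * (F * G) * Real.exp (μ ^ 2 * t / 4) *
        t ^ (1 - γ / 2 - 2 * s₁)) := by gcongr
    _ = bilinConst M C γ c (2 * s₁) μ T * (F * G) * ((omega μ c s₁ t * Real.exp (μ ^ 2 * t / 4)) *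
        t ^ (1 - γ / 2 - 2 * s₁)) := by ring
    _ ≤ bilinConst M C γ c (2 * s₁) μ T * (F * G) * (t ^ s₁ * t ^ (1 - γ / 2 - 2 * s₁)) := by
        gcongr; exact omega_mul_exp_le hc ht0
    _ = _ := by rw [← Real.rpow_add ht0]; congr 2; ring

lemma isBddBilin_bilinOp (hw : IsWeightPair a b C) (hd : IsTarget a b γ)
    (hP : IsBddSymbol P 1) (hμ : 0 ≤ μ) (hT0 : 0 < T) (hT : T ≤ 1) (hc : 0 ≤ c)
    (h0 : 0 ≤ s₁) (h1 : 2 * s₁ < 1) (hδ : 0 ≤ 1 - γ / 2 - s₁) :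
    IsBddBilin (Ioc 0 T) (bilinOp M P hw μ c s₁)
      (bilinConst M C γ c (2 * s₁) μ T * T ^ (1 - γ / 2 - s₁)) := by
  have hB := bilinConst_nonneg (M := M) (γ := γ) (c := c) (μ := μ) (T := T) hw hd.lt_two h1
  have hin : ∀ f g F G, BddContOn (Ioc 0 T) f F → BddContOn (Ioc 0 T) g G →
      ∃ q W, IsInput μ T q W (unweight μ c s₁ f) (unweight μ c s₁ g) := fun f g F G hf hg =>
    ⟨_, _, isInput_unweight (α := 0) hμ hc hf.cont hg.cont hf.nonneg hg.nonneg
      (fun t ht => by simpa using hf.le t ht) (fun t ht => by simpa using hg.le t ht)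
      (by simpa using h0) (by simpa using h1)⟩
  refine ⟨fun f g F G hf hg => ?_, fun f g F G hf hg t ht => ?_⟩
  · have hF := hf.nonneg
    have hG := hg.nonneg
    refine ⟨?_, fun t ht => (norm_bilinOp_le hw hd hP hμ hT hc hf hg h0 h1 ht).trans ?_,
      by positivity⟩
    · obtain ⟨q, W, hi⟩ := hin f g F G hf hg
      have h : ContinuousOn (fun t => (omega μ c s₁ t : ℂ)) (Ioc 0 T) :=
        Complex.continuous_ofReal.comp_continuousOn (continuousOn_omega.mono fun t ht => ht.1)
      exact h.smul (continuousOn_duhamel hw hd hP hμ hT hi)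
    · have := ht.1
      calc _ ≤ bilinConst M C γ c (2 * s₁) μ T * (F * G) * T ^ (1 - γ / 2 - s₁) := by
            gcongr; exact ht.2
        _ = _ := by ring
  · obtain ⟨_, _, i1⟩ := hin f f F F hf hf
    obtain ⟨_, _, i2⟩ := hin g g G G hg hg
    obtain ⟨_, _, i3⟩ := hin _ _ _ _ (hf.sub hg) hf
    obtain ⟨_, _, i4⟩ := hin _ _ _ _ hg (hf.sub hg)
    have e : unweight μ c s₁ (fun s => f s - g s) =
        fun s => unweight μ c s₁ f s - unweight μ c s₁ g s := by
      ext1 s; simp only [unweight, smul_sub]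
    rw [e] at i3 i4
    simp only [bilinOp, e]
    rw [← smul_sub, ← smul_add, duhamel_sub hw hd hP hμ hT i1 i2 i3 i4 ht.1 ht.2]

end

end

end NSE
namespace NSE

noncomputable section

/-! ### Distributions given by functions -/

lemma isGivenBy_Lp {p : ℝ≥0∞} [hp : Fact (1 ≤ p)] (f : Lp Vec p (volume : Measure Space)) :
    IsGivenBy (f : VDist) f := by
  intro φ
  refine ⟨?_, Lp.toTemperedDistribution_apply f φ⟩
  have : ENNReal.HolderConjugate p (1 - p⁻¹)⁻¹ :=
    ENNReal.HolderConjugate.inv_one_sub_inv' hp.out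
  have : ENNReal.HolderConjugate (1 - p⁻¹)⁻¹ p := this.symm
  exact memLp_one_iff_integrable.1 ((Lp.memLp f).smul (φ.memLp (1 - p⁻¹)⁻¹ volume))

lemma IsGivenBy.congr {u : VDist} {f g : Space → Vec} (h : IsGivenBy u f)
    (hfg : f =ᵐ[volume] g) : IsGivenBy u g := by
  intro φ
  have e : (fun x => φ x • f x) =ᵐ[volume] fun x => φ x • g x := by
    filter_upwards [hfg] with x hx
    rw [hx]
  exact ⟨(h φ).1.congr e, (h φ).2.trans (integral_congr_ae e)⟩

lemma IsGivenBy.add {u v : VDist} {f g : Space → Vec} (hf : IsGivenBy u f)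
    (hg : IsGivenBy v g) : IsGivenBy (u + v) (fun x => f x + g x) := by
  intro φ
  simp only [smul_add]
  refine ⟨(hf φ).1.add (hg φ).1, ?_⟩
  rw [integral_add (hf φ).1 (hg φ).1, ← (hf φ).2, ← (hg φ).2]
  rfl

lemma IsGivenBy.dist_eq {u v : VDist} {f : Space → Vec} (hu : IsGivenBy u f)
    (hv : IsGivenBy v f) : u = v := by
  ext1 φ
  rw [(hu φ).2, (hv φ).2]

lemma IsGivenBy.locallyIntegrable {u : VDist} {f : Space → Vec} (hf : IsGivenBy u f) :
    LocallyIntegrable f volume := by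
  intro x
  let b : ContDiffBump x := ⟨1, 2, one_pos, one_lt_two⟩
  have hc : HasCompactSupport (Complex.ofRealCLM ∘ b) := b.hasCompactSupport.comp_left rfl
  have hs : ContDiff ℝ ((⊤ : ℕ∞) : WithTop ℕ∞) (Complex.ofRealCLM ∘ b) :=
    Complex.ofRealCLM.contDiff.comp b.contDiff
  have h1 := (hf (hc.toSchwartzMap hs)).1
  refine ⟨Metric.ball x 1, Metric.ball_mem_nhds x one_pos, ?_⟩
  refine (h1.integrableOn (s := Metric.ball x 1)).congr_fun ?_ measurableSet_ball
  intro y hy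
  have : b y = 1 := b.one_of_mem_closedBall (Metric.ball_subset_closedBall hy)
  simp [this]

lemma IsGivenBy.ae_eq {u : VDist} {f g : Space → Vec} (hf : IsGivenBy u f)
    (hg : IsGivenBy u g) : f =ᵐ[volume] g := by
  refine ae_eq_of_integral_contDiff_smul_eq hf.locallyIntegrable hg.locallyIntegrable ?_
  intro φ hφ hc
  have hc' : HasCompactSupport (Complex.ofRealCLM ∘ φ) := hc.comp_left rfl
  have hφ' : ContDiff ℝ ((⊤ : ℕ∞) : WithTop ℕ∞) (Complex.ofRealCLM ∘ φ) := by fun_prop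
  have h1 := (hf (hc'.toSchwartzMap hφ')).2
  rw [(hg (hc'.toSchwartzMap hφ')).2] at h1
  simpa using h1.symm

/-- `g` is a sum of an `L¹` function (its part on a set `S`) and an `L²` function, and `G` is the
inverse Fourier transform of `g`, computed separately for the two parts. -/
def IsInverseFourier (g G : Space → Vec) : Prop :=
  ∃ (S : Set Space) (_ : MeasurableSet S) (_ : IntegrableOn g S volume)
    (h₂ : MemLp (Sᶜ.indicator g) 2 (volume : Measure Space)),
    G = fun x => 𝓕⁻ (S.indicator g) x + (𝓕⁻ (h₂.toLp) : L2) x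

lemma integral_fourierInv_bilin_eq_flip {f G : Space → Vec} (B : Vec →L[ℂ] Vec →L[ℂ] Vec)
    (hf : Integrable f) (hG : Integrable G) :
    ∫ x, B (𝓕⁻ f x) (G x) = ∫ η, B (f η) (𝓕⁻ G η) := by
  have h := VectorFourier.integral_bilin_fourierIntegral_eq_flip (μ := (volume : Measure Space))
    (ν := (volume : Measure Space)) (L := -innerₗ Space) B Real.continuous_fourierChar
    (by simpa using! continuous_inner.neg) hf hG
  have e : ∀ (k : Space → Vec) x, VectorFourier.fourierIntegral Real.fourierChar volume
      (-innerₗ Space) k x = 𝓕⁻ k x := by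
    intro k x
    simp [VectorFourier.fourierIntegral, Real.fourierInv_eq]
  have e' : (-innerₗ Space).flip = -innerₗ Space := by
    ext x y
    simp [real_inner_comm]
  simpa only [e', e] using h

lemma norm_fourierInv_le (f : Space → Vec) (x : Space) : ‖𝓕⁻ f x‖ ≤ ∫ ξ, ‖f ξ‖ := by
  rw [Real.fourierInv_eq]
  refine (norm_integral_le_integral_norm _).trans_eq ?_
  simp

lemma continuous_fourierInv {f : Space → Vec} (hf : Integrable f) : Continuous (𝓕⁻ f) := by
  have h := VectorFourier.fourierIntegral_continuous (μ := (volume : Measure Space))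
   (L := -innerₗ Space) Real.continuous_fourierChar
    (by simpa using! continuous_inner.neg) hf
  have e : 𝓕⁻ f = VectorFourier.fourierIntegral Real.fourierChar volume (-innerₗ Space) f := by
    ext1 x
    simp [VectorFourier.fourierIntegral, Real.fourierInv_eq]
  rwa [e]

lemma isGivenBy_fourierInv_of_integrable {w : VDist} {f : Space → Vec} (hf : Integrable f)
    (hw : IsGivenBy w f) : IsGivenBy (𝓕⁻ w) (𝓕⁻ f) := by
  intro φ
  have h := VectorFourier.integral_fourierIntegral_smul_eq_flip (μ := (volume : Measure Space))
    (ν := (volume : Measure Space)) (L := -innerₗ Space) Real.continuous_fourierChar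
    (by simpa using! continuous_inner.neg) φ.integrable hf
  have e : ∀ {E : Type} [NormedAddCommGroup E] [NormedSpace ℂ E] (k : Space → E) x,
      VectorFourier.fourierIntegral Real.fourierChar volume
      (-innerₗ Space) k x = 𝓕⁻ k x := by
    intro E _ _ k x
    simp [VectorFourier.fourierIntegral, Real.fourierInv_eq]
  have e' : (-innerₗ Space).flip = -innerₗ Space := by
    ext x y
    simp [real_inner_comm]
  simp only [e', e] at h
  constructor
  · refine (φ.integrable.norm.mul_const (∫ ξ, ‖f ξ‖)).mono'
      (φ.continuous.smul (continuous_fourierInv hf)).aestronglyMeasurable (.of_forall fun x => ?_)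
    rw [norm_smul]
    exact mul_le_mul_of_nonneg_left (norm_fourierInv_le f x) (norm_nonneg _)
  · rw [TemperedDistribution.fourierInv_apply, (hw _).2, ← h]
    simp [SchwartzMap.fourierInv_coe]

lemma fourierInv_add_apply {f g : Space → Vec} (hf : Integrable f) (hg : Integrable g) (x : Space) :
    𝓕⁻ (fun ξ => f ξ + g ξ) x = 𝓕⁻ f x + 𝓕⁻ g x := by
  have h := VectorFourier.fourierIntegral_add (μ := (volume : Measure Space))
    (L := -innerₗ Space) Real.continuous_fourierChar
    (by simpa using! continuous_inner.neg) hf hg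
  have e : ∀ (k : Space → Vec) x, VectorFourier.fourierIntegral Real.fourierChar volume
      (-innerₗ Space) k x = 𝓕⁻ k x := by
    intro k x
    simp [VectorFourier.fourierIntegral, Real.fourierInv_eq]
  have h' := congr_fun h x
  rw [Pi.add_apply, e, e, e] at h'
  have e' : (fun ξ => f ξ + g ξ) = f + g := rfl
  rw [e', ← h']

lemma exists_isGivenBy_of_integrable {f : Space → Vec} (hf : Integrable f) :
    ∃ u : VDist, IsGivenBy u f :=
  ⟨((memLp_one_iff_integrable.2 hf).toLp : Lp Vec 1 (volume : Measure Space)),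
    (isGivenBy_Lp _).congr (MemLp.coeFn_toLp _)⟩

/-- The inverse Fourier transform of a function in `L¹ + L²`, as a tempered distribution. -/
lemma IsInverseFourier.exists_dist {g G : Space → Vec} (h : IsInverseFourier g G) :
    ∃ u : VDist, IsGivenBy u G ∧ IsGivenBy (𝓕 u) g := by
  obtain ⟨S, hS, h1, h2, rfl⟩ := h
  have h1' : Integrable (S.indicator g) := (integrable_indicator_iff hS).2 h1
  obtain ⟨w, hw⟩ := exists_isGivenBy_of_integrable h1'
  refine ⟨𝓕⁻ (w + (h2.toLp : L2)), ?_, ?_⟩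
  · have e : 𝓕⁻ (w + ((h2.toLp : L2) : VDist)) = 𝓕⁻ w + ((𝓕⁻ h2.toLp : L2) : VDist) := by
      rw [FourierTransform.fourierInv_add, Lp.fourierInv_toTemperedDistribution_eq]
    rw [e]
    exact (isGivenBy_fourierInv_of_integrable h1' hw).add (isGivenBy_Lp _)
  · rw [FourierTransform.fourier_fourierInv_eq]
    refine (hw.add (isGivenBy_Lp _)).congr ?_
    filter_upwards [h2.coeFn_toLp] with x hx
    rw [hx]
    exact congr_fun (Set.indicator_self_add_compl S g) x

lemma IsInverseFourier.isGivenBy {g G : Space → Vec} (h : IsInverseFourier g G) {u : VDist}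
    (hu : IsGivenBy (𝓕 u) g) : IsGivenBy u G := by
  obtain ⟨v, h1, h2⟩ := h.exists_dist
  have : u = v := by
    have := congr_arg (fun w : VDist => 𝓕⁻ w) (hu.dist_eq h2)
    simpa using this
  rwa [this]

lemma fourierInv_ae_eq {f : Space → Vec} (hf : Integrable f)
    (h2 : MemLp f 2 (volume : Measure Space)) : 𝓕⁻ f =ᵐ[volume] (𝓕⁻ h2.toLp : L2) := by
  obtain ⟨w, hw⟩ := exists_isGivenBy_of_integrable hf
  have e : w = (h2.toLp : L2) := hw.dist_eq ((isGivenBy_Lp _).congr h2.coeFn_toLp)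
  refine (isGivenBy_fourierInv_of_integrable hf hw).ae_eq ?_
  rw [e, Lp.fourierInv_toTemperedDistribution_eq]
  exact isGivenBy_Lp _

/-! ### Products of inverse Fourier transforms -/

lemma fourier_compSubConst_neg (ψ : 𝓢(Space, ℂ)) (η x : Space) :
    𝓕 (SchwartzMap.compSubConstCLM ℂ (-η) ψ) x =
      (Real.fourierChar (inner ℝ η x) : ℂ) * 𝓕 ψ x := by
  have h := congr_fun (VectorFourier.fourierIntegral_comp_add_right Real.fourierChar
    (volume : Measure Space) (innerₗ Space) ψ η) x
  simp only [SchwartzMap.fourier_coe]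
  have e : ⇑(SchwartzMap.compSubConstCLM ℂ (-η) ψ) = ψ ∘ fun v => v + η := by
    ext v
    simp
  rw [e]
  exact h

lemma IsInverseFourier.integral_smul_eq {g G : Space → Vec} (h : IsInverseFourier g G)
    (φ : 𝓢(Space, ℂ)) : Integrable (fun x => φ x • G x) ∧
      Integrable (fun ξ => 𝓕⁻ φ ξ • g ξ) ∧ ∫ x, φ x • G x = ∫ ξ, 𝓕⁻ φ ξ • g ξ := by
  obtain ⟨u, h1, h2⟩ := h.exists_dist
  refine ⟨(h1 φ).1, (h2 (𝓕⁻ φ)).1, ?_⟩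
  rw [← (h1 φ).2, ← (h2 (𝓕⁻ φ)).2, TemperedDistribution.fourier_apply,
    FourierTransform.fourier_fourierInv_eq]

/-- The pairing of a product of two inverse Fourier transforms with a test function, when the first
factor is the transform of an integrable function: no integrability of the convolution is needed. -/
lemma integral_mul_fourierInv_of_integrable {f g G : Space → Vec} (ℓ : Vec →L[ℂ] ℂ)
    (hf : Integrable f) (hg : IsInverseFourier g G) (φ : 𝓢(Space, ℂ)) :
    ∫ x, ℓ (𝓕⁻ f x) • (φ x • G x) = ∫ η, ℓ (f η) • ∫ ξ, 𝓕⁻ φ (ξ + η) • g ξ := by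
  let B : Vec →L[ℂ] Vec →L[ℂ] Vec := (ContinuousLinearMap.lsmul ℂ ℂ).comp ℓ
  have h := integral_fourierInv_bilin_eq_flip B hf (hg.integral_smul_eq φ).1
  have e : ∀ η, 𝓕⁻ (fun x => φ x • G x) η = ∫ ξ, 𝓕⁻ φ (ξ + η) • g ξ := by
    intro η
    have h1 := (hg.integral_smul_eq (𝓕 (SchwartzMap.compSubConstCLM ℂ (-η) (𝓕⁻ φ)))).2.2
    rw [FourierTransform.fourierInv_fourier_eq] at h1
    simp only [fourier_compSubConst_neg, FourierTransform.fourier_fourierInv_eq,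
      SchwartzMap.compSubConstCLM_apply, sub_neg_eq_add] at h1
    rw [← h1, Real.fourierInv_eq]
    refine integral_congr_ae (.of_forall fun x => ?_)
    simp [mul_smul, real_inner_comm, Circle.smul_def]
  simpa only [B, e] using! h

lemma IsInverseFourier.aestronglyMeasurable {g G : Space → Vec} (h : IsInverseFourier g G) :
    AEStronglyMeasurable g volume := by
  obtain ⟨S, hS, h1, h2, -⟩ := h
  rw [← Set.indicator_self_add_compl S g]
  exact ((integrable_indicator_iff hS).2 h1).1.add h2.1

lemma IsInverseFourier.memLp_smul {g G : Space → Vec} (h : IsInverseFourier g G)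
    (φ : 𝓢(Space, ℂ)) : MemLp (fun x => φ x • G x) 2 (volume : Measure Space) := by
  obtain ⟨S, hS, h1, h2, rfl⟩ := h
  have h1' : Integrable (S.indicator g) := (integrable_indicator_iff hS).2 h1
  simp only [smul_add]
  refine MemLp.add ?_ ?_
  · have m1 : MemLp (𝓕⁻ (S.indicator g)) ∞ (volume : Measure Space) :=
      memLp_top_of_bound (continuous_fourierInv h1').aestronglyMeasurable _
        (.of_forall (norm_fourierInv_le _))
    exact m1.smul (φ.memLp 2 volume)
  · exact (Lp.memLp (𝓕⁻ h2.toLp : L2)).smul (φ.memLp ∞ volume)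

/-- The product formula: the function `ℓ(F) G` is the inverse Fourier transform of the convolution
of `ℓ(f)` and `g`, whenever the latter converges absolutely in the weak sense. -/
lemma integral_mul_fourierInv {f F g G : Space → Vec} (ℓ : Vec →L[ℂ] ℂ)
    (hf : IsInverseFourier f F) (hg : IsInverseFourier g G) (φ : 𝓢(Space, ℂ))
    (habs : Integrable (fun x : Space × Space => ℓ (f x.1) • (𝓕⁻ φ (x.2 + x.1) • g x.2))
      (volume.prod volume)) :
    Integrable (fun x => ℓ (F x) • (φ x • G x)) ∧
    ∫ x, ℓ (F x) • (φ x • G x) = ∫ η, ∫ ξ, ℓ (f η) • (𝓕⁻ φ (ξ + η) • g ξ) := by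
  have mK : MemLp (fun x => φ x • G x) 2 (volume : Measure Space) := hg.memLp_smul φ
  have hφG : Integrable fun x => φ x • G x := (hg.integral_smul_eq φ).1
  obtain ⟨S, hS, hf1, hf2, rfl⟩ := hf
  have hf1' : Integrable (S.indicator f) := (integrable_indicator_iff hS).2 hf1
  let B : Vec →L[ℂ] Vec →L[ℂ] Vec := (ContinuousLinearMap.lsmul ℂ ℂ).comp ℓ
  have hB : ∀ v w, B v w = ℓ v • w := fun _ _ => rfl
  have i1 : Integrable fun x => ℓ (𝓕⁻ (S.indicator f) x) • (φ x • G x) := by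
    refine (hφG.norm.const_mul (‖ℓ‖ * ∫ ξ, ‖S.indicator f ξ‖)).mono'
      ((ℓ.continuous.comp (continuous_fourierInv hf1')).aestronglyMeasurable.smul hφG.1)
      (.of_forall fun x => ?_)
    rw [norm_smul]
    refine mul_le_mul_of_nonneg_right ((ℓ.le_opNorm _).trans ?_) (norm_nonneg _)
    exact mul_le_mul_of_nonneg_left (norm_fourierInv_le _ x) (norm_nonneg _)
  have i2 : ∀ h : L2, Integrable (fun x => ℓ (h x) • (φ x • G x)) ∧
      ∫ x, ℓ (h x) • (φ x • G x) = B.lpPairing volume 2 2 h mK.toLp := by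
    intro h
    have e : (fun x => B (h x) ((mK.toLp : L2) x)) =ᵐ[volume] fun x => ℓ (h x) • (φ x • G x) := by
      filter_upwards [mK.coeFn_toLp] with x hx
      rw [hx, hB]
    refine ⟨?_, ?_⟩
    · have m1 : MemLp (fun x => ℓ (h x)) 2 (volume : Measure Space) := ℓ.comp_memLp h
      exact memLp_one_iff_integrable.1 (mK.smul m1)
    · rw [ContinuousLinearMap.lpPairing_eq_integral]
      exact (integral_congr_ae e).symm
  constructor
  · simp only [map_add, add_smul]
    exact i1.add (i2 _).1
  -- The square integrable part of `f` is truncated to balls, where it is integrable.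
  let c : ℕ → Space → ℝ := fun n => (Metric.ball (0 : Space) n).indicator 1
  have hc : ∀ n, IsBddSymbol (scalarSymbol (c n)) 1 := fun n => by
    refine isBddSymbol_scalar (measurable_one.indicator measurableSet_ball) fun p _ => ?_
    by_cases h : p ∈ Metric.ball (0 : Space) n <;> simp [c, h]
  have hc1 : ∀ p, ∀ᶠ n in atTop, c n p = 1 := by
    intro p
    obtain ⟨N, hN⟩ := exists_nat_gt ‖p‖
    filter_upwards [eventually_ge_atTop N] with n hn
    have : p ∈ Metric.ball (0 : Space) n := by
      have : (N : ℝ) ≤ n := by exact_mod_cast hn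
      simpa using hN.trans_le this
    simp [c, this]
  have hone : IsBddSymbol (scalarSymbol fun _ => 1) 1 :=
    isBddSymbol_scalar measurable_const (by simp)
  have etrunc : ∀ n, mulOp (scalarSymbol (c n)) hf2.toLp =ᵐ[volume]
      fun ξ => (c n ((2 * Real.pi) • ξ) : ℂ) • Sᶜ.indicator f ξ := by
    intro n
    filter_upwards [coeFn_mulOp_scalar (hc n) hf2.toLp, hf2.coeFn_toLp] with ξ h1 h2
    rw [h1, h2]
  have hint : ∀ n, Integrable fun ξ => (c n ((2 * Real.pi) • ξ) : ℂ) • Sᶜ.indicator f ξ := by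
    intro n
    have m1 : MemLp (fun ξ : Space => (c n ((2 * Real.pi) • ξ) : ℂ)) 2
        (volume : Measure Space) := by
      have e : (fun ξ : Space => (c n ((2 * Real.pi) • ξ) : ℂ)) =
          ((fun ξ : Space => (2 * Real.pi) • ξ) ⁻¹' Metric.ball 0 n).indicator
            fun _ => (1 : ℂ) := by
        ext ξ
        by_cases h : (2 * Real.pi) • ξ ∈ Metric.ball (0 : Space) n <;> simp [c, h]
      rw [e]
      refine memLp_indicator_const 2 (measurableSet_ball.preimage (measurable_const_smul _)) _
        (Or.inr ?_)
      rw [Measure.addHaar_preimage_smul _ (by positivity)]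
      exact ENNReal.mul_ne_top ENNReal.ofReal_ne_top measure_ball_lt_top.ne
    exact memLp_one_iff_integrable.1 (hf2.smul m1)
  have mem2 : ∀ n, MemLp (fun ξ => (c n ((2 * Real.pi) • ξ) : ℂ) • Sᶜ.indicator f ξ) 2
      (volume : Measure Space) := fun n => (memLp_congr_ae (etrunc n)).1 (Lp.memLp _)
  have lim1 : Tendsto (fun n => ∫ x, ℓ (𝓕⁻ (fun ξ => S.indicator f ξ +
      (c n ((2 * Real.pi) • ξ) : ℂ) • Sᶜ.indicator f ξ) x) • (φ x • G x)) atTop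
      (𝓝 (∫ x, ℓ (𝓕⁻ (S.indicator f) x + (𝓕⁻ hf2.toLp : L2) x) • (φ x • G x))) := by
    have t1 : Tendsto (fun n => mulOp (scalarSymbol (c n)) hf2.toLp) atTop (𝓝 hf2.toLp) := by
      have := tendsto_mulOp_of_tendsto_symbol (l := atTop) (m := fun n => scalarSymbol (c n))
        (.of_forall hc) hone (.of_forall fun ξ => ?_) hf2.toLp
      · convert this using 2
        ext1
        filter_upwards [coeFn_mulOp_scalar hone hf2.toLp] with ξ h1
        simp [h1]
      · refine tendsto_const_nhds.congr' ?_
        filter_upwards [hc1 ((2 * Real.pi) • ξ)] with n hn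
        simp [scalarSymbol, hn]
    have t2 := ((B.lpPairing volume 2 2).flip mK.toLp).continuous.tendsto (𝓕⁻ hf2.toLp)
    have t3 := t2.comp (((Lp.fourierTransformₗᵢ Space Vec).symm.continuous.tendsto _).comp t1)
    have t4 := t3.const_add (∫ x, ℓ (𝓕⁻ (S.indicator f) x) • (φ x • G x))
    have e1 : ∫ x, ℓ (𝓕⁻ (S.indicator f) x + (𝓕⁻ hf2.toLp : L2) x) • (φ x • G x) =
        (∫ x, ℓ (𝓕⁻ (S.indicator f) x) • (φ x • G x)) +
          B.lpPairing volume 2 2 (𝓕⁻ hf2.toLp) mK.toLp := by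
      simp only [map_add, add_smul]
      rw [integral_add i1 (i2 _).1, (i2 _).2]
    rw [e1]
    refine t4.congr fun n => ?_
    have e2 : (fun x => ℓ (𝓕⁻ (fun ξ => S.indicator f ξ +
        (c n ((2 * Real.pi) • ξ) : ℂ) • Sᶜ.indicator f ξ) x) • (φ x • G x)) =ᵐ[volume]
        fun x => ℓ (𝓕⁻ (S.indicator f) x) • (φ x • G x) +
          ℓ ((𝓕⁻ (mem2 n).toLp : L2) x) • (φ x • G x) := by
      filter_upwards [fourierInv_ae_eq (hint n) (mem2 n)] with x hx
      rw [← hx, ← add_smul, ← map_add, ← fourierInv_add_apply hf1' (hint n)]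
    have e3 : (mem2 n).toLp = mulOp (scalarSymbol (c n)) hf2.toLp := by
      ext1
      filter_upwards [(mem2 n).coeFn_toLp, etrunc n] with ξ h1 h2
      rw [h1, h2]
    rw [integral_congr_ae e2, integral_add i1 (i2 _).1, (i2 _).2, e3]
    rfl
  have lim2 : Tendsto (fun n => ∫ η, ℓ (S.indicator f η +
      (c n ((2 * Real.pi) • η) : ℂ) • Sᶜ.indicator f η) • ∫ ξ, 𝓕⁻ φ (ξ + η) • g ξ) atTop
      (𝓝 (∫ η, ∫ ξ, ℓ (f η) • (𝓕⁻ φ (ξ + η) • g ξ))) := by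
    have hI := habs.integral_prod_left
    simp only [integral_smul] at hI ⊢
    -- The truncated function equals `f` or `0` at every point.
    have hcases : ∀ n η, S.indicator f η + (c n ((2 * Real.pi) • η) : ℂ) • Sᶜ.indicator f η = f η ∨
        S.indicator f η + (c n ((2 * Real.pi) • η) : ℂ) • Sᶜ.indicator f η = 0 := by
      intro n η
      by_cases h1 : η ∈ S
      · simp [h1]
      · by_cases h : (2 * Real.pi) • η ∈ Metric.ball (0 : Space) n
        · left; simp [c, h, h1]
        · right; simp [c, h, h1]
    refine tendsto_integral_of_dominated_convergence
      (fun η => ‖ℓ (f η) • ∫ ξ, 𝓕⁻ φ (ξ + η) • g ξ‖) (fun n => ?_) hI.norm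
      (fun n => .of_forall fun η => ?_) (.of_forall fun η => ?_)
    · refine (ℓ.continuous.comp_aestronglyMeasurable (hf1'.1.add (hint n).1)).smul ?_
      have m : AEStronglyMeasurable (fun x : Space × Space => 𝓕⁻ φ (x.2 + x.1) • g x.2)
          (volume.prod volume) :=
        (by fun_prop : Continuous fun x : Space × Space => 𝓕⁻ φ
            (x.2 + x.1)).aestronglyMeasurable.smul
          hg.aestronglyMeasurable.comp_snd
      exact m.integral_prod_right'
    · rcases hcases n η with h | h <;> rw [h]
      simp
    · refine tendsto_const_nhds.congr' ?_
      filter_upwards [hc1 ((2 * Real.pi) • η)] with n hn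
      rw [hn, Complex.ofReal_one, one_smul]
      exact (congrArg (fun v => ℓ v • ∫ ξ, 𝓕⁻ φ (ξ + η) • g ξ)
        (congr_fun (Set.indicator_self_add_compl S f) η)).symm
  refine tendsto_nhds_unique lim1 (lim2.congr fun n => ?_)
  exact (integral_mul_fourierInv_of_integrable ℓ (hf1'.add (hint n)) hg φ).symm

end

end NSE
namespace NSE

noncomputable section

/-! ### Fields described by weighted square integrable Fourier transforms -/

/-- Symbols with at most an `L²` singularity at the origin, and bounded away from it: multiplication
by such a symbol maps `L²` into `L¹ + L²`. -/
def IsTame (m : Space → ℝ) : Prop :=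
  Measurable m ∧ ∃ C α : ℝ, 0 ≤ C ∧ 0 ≤ α ∧ α < 3 / 2 ∧ ∀ p, p ≠ 0 → |m p| ≤ C * (1 + ‖p‖ ^ (-α))

lemma IsTame.memLp_indicator {m : Space → ℝ} (hm : IsTame m) :
    MemLp ((Metric.ball (0 : Space) 1).indicator fun ξ => (m ((2 * Real.pi) • ξ) : ℂ)) 2
      (volume : Measure Space) := by
  obtain ⟨mm, C, α, hC, hα, hα', hb⟩ := hm
  have mm' : Measurable fun ξ : Space => (m ((2 * Real.pi) • ξ) : ℂ) :=
    Complex.measurable_ofReal.comp (mm.comp (measurable_const_smul _))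
  refine ⟨(mm'.indicator measurableSet_ball).aestronglyMeasurable, ?_⟩
  rw [eLpNorm_lt_top_iff_lintegral_rpow_enorm_lt_top two_ne_zero ENNReal.ofNat_ne_top]
  have key : ∀ᵐ ξ : Space, ‖(Metric.ball (0 : Space) 1).indicator
      (fun ξ => (m ((2 * Real.pi) • ξ) : ℂ)) ξ‖ₑ ^ (2 : ℝ≥0∞).toReal ≤
      (Metric.ball (0 : Space) 1).indicator
        (fun ξ => ENNReal.ofReal ((2 * C) ^ 2) * negPow (2 * α) ξ) ξ := by
    filter_upwards [ae_ne_zero] with ξ h0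
    by_cases hξ : ξ ∈ Metric.ball (0 : Space) 1
    · rw [indicator_of_mem hξ, indicator_of_mem hξ, negPow, ← ENNReal.ofReal_mul (by positivity),
        ← ofReal_norm, Complex.norm_real, ENNReal.toReal_ofNat,
        ENNReal.ofReal_rpow_of_nonneg (norm_nonneg _) (by norm_num)]
      refine ENNReal.ofReal_le_ofReal ?_
      have hp : 0 < ‖ξ‖ := norm_pos_iff.2 h0
      have e : ‖ξ‖ ^ (-(2 * α)) = (‖ξ‖ ^ (-α)) ^ 2 := by
        rw [← Real.rpow_natCast, ← Real.rpow_mul hp.le]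
        congr 1
        push_cast
        ring
      rw [e, ← mul_pow, Real.rpow_two]
      refine pow_le_pow_left₀ (norm_nonneg _) ((hb _ (two_pi_smul_ne_zero h0)).trans ?_) 2
      have h1 : ‖(2 * Real.pi) • ξ‖ ^ (-α) ≤ ‖ξ‖ ^ (-α) := by
        refine Real.rpow_le_rpow_of_nonpos hp ?_ (neg_nonpos.2 hα)
        rw [norm_smul, Real.norm_of_nonneg (by positivity)]
        nlinarith [Real.pi_gt_three]
      have h2 : 1 ≤ ‖ξ‖ ^ (-α) :=
        Real.one_le_rpow_of_pos_of_le_one_of_nonpos hp (mem_ball_zero_iff.1 hξ).le (neg_nonpos.2 hα)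
      nlinarith
    · simp [hξ]
  refine (lintegral_mono_ae key).trans_lt ?_
  rw [lintegral_indicator measurableSet_ball, lintegral_const_mul _ (measurable_negPow _)]
  exact ENNReal.mul_lt_top ENNReal.ofReal_lt_top
    (lintegral_negPow_unitBall_ne_top (by linarith)).lt_top

lemma IsTame.exists_bound {m : Space → ℝ} (hm : IsTame m) :
    ∃ C : ℝ, ∀ ξ : Space, 1 ≤ ‖ξ‖ → |m ((2 * Real.pi) • ξ)| ≤ C := by
  obtain ⟨mm, C, α, hC, hα, hα', hb⟩ := hm
  refine ⟨C * 2, fun ξ hξ => ?_⟩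
  have h0 : ξ ≠ 0 := by
    rintro rfl
    simp at hξ
    linarith
  refine (hb _ (two_pi_smul_ne_zero h0)).trans ?_
  have h1 : 1 ≤ ‖(2 * Real.pi) • ξ‖ := by
    rw [norm_smul, Real.norm_of_nonneg (by positivity)]
    nlinarith [Real.pi_gt_three]
  have := Real.rpow_le_one_of_one_le_of_nonpos h1 (neg_nonpos.2 hα)
  nlinarith

lemma IsTame.exists_isInverseFourier {m : Space → ℝ} (hm : IsTame m) (h : L2) :
    ∃ G, IsInverseFourier (fun ξ => (m ((2 * Real.pi) • ξ) : ℂ) • h ξ) G := by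
  have mm : Measurable fun ξ : Space => (m ((2 * Real.pi) • ξ) : ℂ) :=
    Complex.measurable_ofReal.comp (hm.1.comp (measurable_const_smul _))
  refine ⟨_, Metric.ball 0 1, measurableSet_ball, ?_, ?_, rfl⟩
  · rw [← integrable_indicator_iff measurableSet_ball]
    have h1 := memLp_one_iff_integrable.1 ((Lp.memLp h).smul hm.memLp_indicator)
    refine h1.congr (.of_forall fun ξ => ?_)
    by_cases hξ : ξ ∈ Metric.ball (0 : Space) 1 <;> simp [hξ]
  · obtain ⟨C, hC⟩ := hm.exists_bound
    have h1 : MemLp ((Metric.ball (0 : Space) 1)ᶜ.indicator fun ξ => (m ((2 * Real.pi) • ξ) : ℂ)) ∞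
        (volume : Measure Space) := by
      refine memLp_top_of_bound (mm.indicator measurableSet_ball.compl).aestronglyMeasurable C
        (.of_forall fun ξ => ?_)
      by_cases hξ : ξ ∈ Metric.ball (0 : Space) 1
      · rw [indicator_of_notMem (by simpa using hξ), norm_zero]
        exact (abs_nonneg _).trans (hC (EuclideanSpace.single 0 1) (by simp))
      · rw [indicator_of_mem (by simpa using hξ), Complex.norm_real]
        exact hC ξ (by simpa using hξ)
    refine (memLp_congr_ae (.of_forall fun ξ => ?_)).1 ((Lp.memLp h).smul h1)
    by_cases hξ : ξ ∈ Metric.ball (0 : Space) 1 <;> simp [hξ]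

/-- The function `h / a` in the frequency variable. -/
def fieldFun (a : Space → ℝ) (h : Space → Vec) : Space → Vec :=
  fun ξ => ((a ((2 * Real.pi) • ξ))⁻¹ : ℂ) • h ξ

/-- The Fourier transform of `a(-i∇) u` is the square integrable function `h`. -/
def HasProfile (a : Space → ℝ) (u : VDist) (h : L2) : Prop :=
  IsGivenBy (𝓕 u) (fieldFun a h)

lemma ae_symbol_ne_zero {a : Space → ℝ} (ha : ∀ p, p ≠ 0 → a p ≠ 0) :
    ∀ᵐ ξ : Space, (a ((2 * Real.pi) • ξ) : ℂ) ≠ 0 := by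
  filter_upwards [ae_ne_zero] with ξ hξ
  exact_mod_cast ha _ (two_pi_smul_ne_zero hξ)

lemma HasProfile.unique {a : Space → ℝ} (ha : ∀ p, p ≠ 0 → a p ≠ 0) {u : VDist} {h k : L2}
    (hh : HasProfile a u h) (hk : HasProfile a u k) : h = k := by
  ext1
  filter_upwards [ae_symbol_ne_zero ha, IsGivenBy.ae_eq hh hk] with ξ h1 h2
  exact smul_right_injective Vec (inv_ne_zero h1) h2

lemma HasProfile.dist_eq {a : Space → ℝ} {u v : VDist} {h : L2}
    (hu : HasProfile a u h) (hv : HasProfile a v h) : u = v := by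
  have := congr_arg (fun w : VDist => 𝓕⁻ w) (IsGivenBy.dist_eq hu hv)
  simpa using this

lemma isGivenBy_fourier_Lp (F : L2) : IsGivenBy (𝓕 (F : VDist)) (𝓕 F : L2) := by
  rw [Lp.fourier_toTemperedDistribution_eq]
  exact isGivenBy_Lp _

lemma isMultiplier_iff_hasProfile {a : Space → ℝ} (ha : ∀ p, p ≠ 0 → a p ≠ 0) {u : VDist} {F : L2} :
    IsMultiplier (scalarSymbol a) u F ↔ HasProfile a u (𝓕 F) := by
  constructor
  · rintro ⟨g, hg, hF⟩
    refine hg.congr ?_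
    filter_upwards [ae_symbol_ne_zero ha, hF.ae_eq (isGivenBy_fourier_Lp F)] with ξ h1 h2
    rw [fieldFun, ← h2]
    exact (inv_smul_smul₀ h1 (g ξ)).symm
  · intro h
    refine ⟨_, h, (isGivenBy_fourier_Lp F).congr ?_⟩
    filter_upwards [ae_symbol_ne_zero ha] with ξ h1
    exact (smul_inv_smul₀ h1 _).symm

lemma HasProfile.isMultiplier {a : Space → ℝ} (ha : ∀ p, p ≠ 0 → a p ≠ 0) {u : VDist} {h : L2}
    (hu : HasProfile a u h) : IsMultiplier (scalarSymbol a) u ((𝓕⁻ h : L2) : VDist) := by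
  rw [isMultiplier_iff_hasProfile ha, FourierTransform.fourier_fourierInv_eq]
  exact hu

lemma HasProfile.multNorm_eq {a : Space → ℝ} (ha : ∀ p, p ≠ 0 → a p ≠ 0) {u : VDist} {h : L2}
    (hu : HasProfile a u h) : multNorm a u = ‖h‖ₑ := by
  have e : ∀ F : L2, IsMultiplier (scalarSymbol a) u F → ‖F‖ₑ = ‖h‖ₑ := by
    intro F hF
    rw [hu.unique ha ((isMultiplier_iff_hasProfile ha).1 hF), ← ofReal_norm, ← ofReal_norm,
      Lp.norm_fourier_eq]
  refine le_antisymm ?_ ?_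
  · exact (iInf₂_le (𝓕⁻ h : L2) (hu.isMultiplier ha)).trans_eq (e _ (hu.isMultiplier ha))
  · exact le_iInf₂ fun F hF => (e F hF).ge

/-- Change of the weight in which a field is measured. -/
lemma HasProfile.mulOp {a b m : Space → ℝ} {C : ℝ} (hm : IsBddSymbol (scalarSymbol m) C)
    (hb : ∀ p, p ≠ 0 → b p ≠ 0) (hab : ∀ p, p ≠ 0 → b p = m p * a p) {u : VDist} {h : L2}
    (hu : HasProfile a u h) : HasProfile b u (mulOp (scalarSymbol m) h) := by
  refine IsGivenBy.congr hu ?_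
  filter_upwards [ae_ne_zero, coeFn_mulOp_scalar hm h] with ξ h0 h1
  have h2 := hb _ (two_pi_smul_ne_zero h0)
  have h3 := hab _ (two_pi_smul_ne_zero h0)
  rw [h3, mul_ne_zero_iff] at h2
  have h4 : (m ((2 * Real.pi) • ξ) : ℂ) ≠ 0 := by exact_mod_cast h2.1
  rw [fieldFun, fieldFun, h1, h3, smul_smul]
  congr 1
  push_cast
  rw [mul_inv, mul_right_comm, inv_mul_cancel₀ h4, one_mul]

lemma HasProfile.add {a : Space → ℝ} {u v : VDist} {h k : L2} (hu : HasProfile a u h)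
    (hv : HasProfile a v k) : HasProfile a (u + v) (h + k) := by
  unfold HasProfile
  rw [FourierTransform.fourier_add]
  refine (IsGivenBy.add hu hv).congr ?_
  filter_upwards [Lp.coeFn_add h k] with ξ h1
  simp only [fieldFun]
  rw [h1, Pi.add_apply, smul_add]

lemma IsTame.exists_isInverseFourier_fieldFun {a : Space → ℝ} (ha : IsTame fun p => (a p)⁻¹)
    (h : L2) : ∃ G, IsInverseFourier (fieldFun a h) G := by
  obtain ⟨G, hG⟩ := ha.exists_isInverseFourier h
  refine ⟨G, ?_⟩
  convert hG using 1
  ext1 ξ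
  simp [fieldFun]

lemma IsTame.exists_hasProfile {a : Space → ℝ} (ha : IsTame fun p => (a p)⁻¹) (h : L2) :
    ∃ u : VDist, HasProfile a u h := by
  obtain ⟨G, hG⟩ := ha.exists_isInverseFourier_fieldFun h
  obtain ⟨u, -, hu⟩ := hG.exists_dist
  exact ⟨u, hu⟩

lemma IsTame.memLp_schwartz_mul {m : Space → ℝ} (hm : IsTame m) (ψ : 𝓢(Space, ℂ)) :
    MemLp (fun ξ => ψ ξ * (m ((2 * Real.pi) • ξ) : ℂ)) 2 (volume : Measure Space) := by
  have mm : Measurable fun ξ : Space => (m ((2 * Real.pi) • ξ) : ℂ) :=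
    Complex.measurable_ofReal.comp (hm.1.comp (measurable_const_smul _))
  obtain ⟨C, hC⟩ := hm.exists_bound
  have h1 : MemLp ((Metric.ball (0 : Space) 1)ᶜ.indicator fun ξ => (m ((2 * Real.pi) • ξ) : ℂ)) ∞
      (volume : Measure Space) := by
    refine memLp_top_of_bound (mm.indicator measurableSet_ball.compl).aestronglyMeasurable C
      (.of_forall fun ξ => ?_)
    by_cases hξ : ξ ∈ Metric.ball (0 : Space) 1
    · rw [indicator_of_notMem (by simpa using hξ), norm_zero]
      exact (abs_nonneg _).trans (hC (EuclideanSpace.single 0 1) (by simp))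
    · rw [indicator_of_mem (by simpa using hξ), Complex.norm_real]
      exact hC ξ (by simpa using hξ)
  have h2 : MemLp _ 2 _ :=
    (hm.memLp_indicator.smul (ψ.memLp ∞ volume)).add (h1.smul (ψ.memLp 2 volume))
  refine (memLp_congr_ae (.of_forall fun ξ => ?_)).1 h2
  by_cases hξ : ξ ∈ Metric.ball (0 : Space) 1 <;> simp [hξ]

open Classical in
/-- The pairing of `a(-i∇)⁻¹ 𝓕⁻¹ h` with a test function, as a functional of `h`. -/
def pairing (a : Space → ℝ) (φ : 𝓢(Space, ℂ)) : L2 →L[ℂ] Vec :=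
  if h : MemLp (fun ξ => 𝓕⁻ φ ξ * ((a ((2 * Real.pi) • ξ))⁻¹ : ℝ)) 2 (volume : Measure Space) then
    (ContinuousLinearMap.lsmul ℂ ℂ).lpPairing volume 2 2 h.toLp else 0

lemma HasProfile.apply_eq {a : Space → ℝ} (ha : IsTame fun p => (a p)⁻¹) {u : VDist} {h : L2}
    (hu : HasProfile a u h) (φ : 𝓢(Space, ℂ)) : u φ = pairing a φ h := by
  have h0 := ha.memLp_schwartz_mul (𝓕⁻ φ)
  have h1 : u φ = 𝓕 u (𝓕⁻ φ) := by
    rw [TemperedDistribution.fourier_apply, FourierTransform.fourier_fourierInv_eq]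
  rw [h1, (hu _).2, pairing, dif_pos h0, ContinuousLinearMap.lpPairing_eq_integral]
  refine integral_congr_ae ?_
  filter_upwards [h0.coeFn_toLp] with ξ hξ
  rw [hξ]
  simp [fieldFun, smul_smul]

end

end NSE
namespace NSE

noncomputable section

/-! ### The advection term on the Fourier side -/

/-- The product formula in terms of the convolution. -/
lemma integral_mul_fourierInv_conv {f F g G : Space → Vec} (ℓ : Vec →L[ℂ] ℂ)
    (hf : IsInverseFourier f F) (hg : IsInverseFourier g G) (φ : 𝓢(Space, ℂ))
    (habs : Integrable (fun x : Space × Space => ℓ (f x.2) • (𝓕⁻ φ x.1 • g (x.1 - x.2)))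
      (volume.prod volume)) :
    Integrable (fun x => ℓ (F x) • (φ x • G x)) ∧
    ∫ x, ℓ (F x) • (φ x • G x) = ∫ ξ, ∫ η, ℓ (f η) • (𝓕⁻ φ ξ • g (ξ - η)) := by
  have hT : MeasurePreserving (fun x : Space × Space => (x.2 + x.1, x.1))
      (volume.prod volume) (volume.prod volume) := by
    have h1 := measurePreserving_prod_add (volume : Measure Space) (volume : Measure Space)
    have h2 := (Measure.measurePreserving_swap (μ := (volume : Measure Space))
      (ν := (volume : Measure Space))).comp h1
    convert h2 using 1
    ext1 x
    simp [add_comm]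
  have h3 := hT.integrable_comp_of_integrable habs
  have e : ((fun x : Space × Space => ℓ (f x.2) • (𝓕⁻ φ x.1 • g (x.1 - x.2))) ∘
      fun x : Space × Space => (x.2 + x.1, x.1)) =
      fun x => ℓ (f x.1) • (𝓕⁻ φ (x.2 + x.1) • g x.2) := by
    ext1 x
    simp
  rw [e] at h3
  obtain ⟨i1, i2⟩ := integral_mul_fourierInv ℓ hf hg φ h3
  refine ⟨i1, ?_⟩
  rw [i2, ← integral_prod _ habs, ← integral_prod _ h3, ← e]
  nth_rewrite 2 [← hT.map_eq]
  rw [integral_map hT.measurable.aemeasurable (by rw [hT.map_eq]; exact habs.1)]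
  rfl

/-- The linear functional `u ↦ (M u)ⱼ`. -/
def matRow (M : Matrix (Fin 3) (Fin 3) ℝ) (j : Fin 3) : Vec →L[ℂ] ℂ :=
  ∑ k, (M j k : ℂ) • (EuclideanSpace.proj k : Vec →L[ℂ] ℂ)

lemma matRow_apply (M : Matrix (Fin 3) (Fin 3) ℝ) (j : Fin 3) (u : Vec) :
    matRow M j u = ∑ k, (M j k : ℂ) * u k := by
  simp [matRow, sum_apply]

lemma norm_matRow_apply_le (M : Matrix (Fin 3) (Fin 3) ℝ) (j : Fin 3) (u : Vec) :
    ‖matRow M j u‖ ≤ matConst M * ‖u‖ := by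
  rw [matRow_apply, matConst]
  calc _ ≤ ∑ k, |M j k| * ‖u‖ := by
        refine norm_sum_le_of_le _ fun k _ => ?_
        rw [norm_mul, Complex.norm_real, Real.norm_eq_abs]
        gcongr
        exact PiLp.norm_apply_le u k
    _ ≤ _ := by
        rw [← Finset.sum_mul]
        refine mul_le_mul_of_nonneg_right ?_ (norm_nonneg _)
        exact Finset.single_le_sum (f := fun j => ∑ k, |M j k|)
          (fun _ _ => Finset.sum_nonneg fun _ _ => abs_nonneg _) (Finset.mem_univ j)

/-- The Fourier transform of `∂ⱼ v`, if that of `a(-i∇) v` is `k`. -/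
def derivFun (a : Space → ℝ) (k : Space → Vec) (j : Fin 3) : Space → Vec :=
  fun ξ => (Complex.I * (((2 * Real.pi) • ξ) j : ℂ)) • fieldFun a k ξ

lemma HasProfile.fourier_lineDeriv {a : Space → ℝ} {v : VDist} {k : L2} (hv : HasProfile a v k)
    (j : Fin 3) : IsGivenBy (𝓕 (∂_{(EuclideanSpace.single j 1 : Space)} v)) (derivFun a k j) := by
  intro φ
  have hT : Function.HasTemperateGrowth
      fun x : Space => ((inner ℝ x (EuclideanSpace.single j 1 : Space) : ℝ) : ℂ) := by fun_prop
  obtain ⟨i1, i2⟩ := hv (SchwartzMap.smulLeftCLM ℂ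
    (fun x : Space => ((inner ℝ x (EuclideanSpace.single j 1 : Space) : ℝ) : ℂ)) φ)
  have e : (fun ξ => φ ξ • derivFun a k j ξ) = fun ξ => (2 * Real.pi * Complex.I : ℂ) •
      (SchwartzMap.smulLeftCLM ℂ
        (fun x : Space => ((inner ℝ x (EuclideanSpace.single j 1 : Space) : ℝ) : ℂ)) φ ξ •
          fieldFun a k ξ) := by
    ext1 ξ
    rw [SchwartzMap.smulLeftCLM_apply_apply hT, derivFun, smul_smul, smul_smul, smul_eq_mul]
    congr 1
    have : inner ℝ ξ (EuclideanSpace.single j 1 : Space) = ξ j := by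
      simp [EuclideanSpace.inner_single_right]
    rw [this, PiLp.smul_apply, smul_eq_mul]
    push_cast
    ring
  rw [e]
  refine ⟨i1.smul (2 * Real.pi * Complex.I : ℂ), ?_⟩
  rw [integral_smul, ← i2, TemperedDistribution.fourier_lineDerivOp_eq]
  rfl

lemma measurable_fieldFun {a : Space → ℝ} (ha : Measurable a) {h : Space → Vec}
    (hh : Measurable h) : Measurable (fieldFun a h) := by
  have : Measurable fun ξ : Space => (a ((2 * Real.pi) • ξ) : ℂ) :=
    Complex.measurable_ofReal.comp (ha.comp (measurable_const_smul _))
  exact this.inv.smul hh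

lemma measurable_derivFun {a : Space → ℝ} (ha : Measurable a) {h : Space → Vec}
    (hh : Measurable h) (j : Fin 3) : Measurable (derivFun a h j) := by
  have h1 : Measurable fun ξ : Space => Complex.I * (((2 * Real.pi) • ξ) j : ℂ) := by fun_prop
  exact h1.smul (measurable_fieldFun ha hh)

lemma IsTame.exists_isInverseFourier_derivFun {a : Space → ℝ} {j : Fin 3}
    (ha : IsTame fun p => p j * (a p)⁻¹) (k : L2) : ∃ G, IsInverseFourier (derivFun a k j) G := by
  obtain ⟨G, S, hS, h1, h2, rfl⟩ := ha.exists_isInverseFourier k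
  have e : derivFun a k j = Complex.I • fun ξ : Space => ((((2 * Real.pi) • ξ) j *
      (a ((2 * Real.pi) • ξ))⁻¹ : ℝ) : ℂ) • k ξ := by
    ext1 ξ
    simp [derivFun, fieldFun, smul_smul, mul_assoc]
  rw [e]
  refine ⟨_, S, hS, Integrable.smul Complex.I h1, ?_, rfl⟩
  refine (memLp_congr_ae (.of_forall fun ξ => ?_)).1 (h2.const_smul Complex.I)
  by_cases hξ : ξ ∈ S <;> simp [hξ]

variable {M : Matrix (Fin 3) (Fin 3) ℝ} {a b : Space → ℝ} {C : ℝ}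

lemma interKernel_eq_sum (h k : Space → Vec) (ξ η : Space) : interKernel M a h k ξ η =
    ∑ j, matRow M j (fieldFun a h η) • derivFun a k j (ξ - η) := by
  simp only [interKernel, advLin_apply, derivFun, fieldFun, smul_smul, map_smul, matRow_apply,
    smul_eq_mul, Finset.sum_mul, ← Finset.sum_smul]
  congr 1
  refine Finset.sum_congr rfl fun j _ => ?_
  simp only [← Finset.sum_mul]
  push_cast
  ring

lemma IsWeightPair.enorm_kernel_summand_le (hw : IsWeightPair a b C) (h k : Space → Vec) (j : Fin 3)
    (ξ η : Space) (h0 : η ≠ 0) (h1 : ξ - η ≠ 0) :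
    ‖matRow M j (fieldFun a h η) • derivFun a k j (ξ - η)‖ₑ ≤
      ENNReal.ofReal (matConst M) * absKernel a (fun x => ‖h x‖ₑ) (fun x => ‖k x‖ₑ) ξ η := by
  have p1 := hw.pos_a _ (two_pi_smul_ne_zero h0)
  have p2 := hw.pos_a _ (two_pi_smul_ne_zero h1)
  simp only [absKernel, ← ofReal_norm]
  rw [← ENNReal.ofReal_mul (by positivity), ← ENNReal.ofReal_mul (by positivity),
    ← ENNReal.ofReal_mul (by positivity), ← ENNReal.ofReal_mul (matConst_nonneg M)]
  refine ENNReal.ofReal_le_ofReal ?_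
  rw [norm_smul]
  have b1 := norm_matRow_apply_le M j (fieldFun a h η)
  have b2 : ‖derivFun a k j (ξ - η)‖ ≤ ‖(2 * Real.pi) • (ξ - η)‖ *
      (a ((2 * Real.pi) • (ξ - η)))⁻¹ * ‖k (ξ - η)‖ := by
    rw [derivFun, fieldFun, norm_smul, norm_smul, norm_mul, Complex.norm_I, one_mul,
      Complex.norm_real, norm_inv, Complex.norm_real, Real.norm_of_nonneg p2.le, mul_assoc]
    gcongr
    exact PiLp.norm_apply_le _ j
  have b3 : ‖fieldFun a h η‖ = (a ((2 * Real.pi) • η))⁻¹ * ‖h η‖ := by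
    rw [fieldFun, norm_smul, norm_inv, Complex.norm_real, Real.norm_of_nonneg p1.le]
  rw [b3] at b1
  have := matConst_nonneg M
  calc _ ≤ _ := mul_le_mul b1 b2 (norm_nonneg _) (by positivity)
    _ = _ := by ring

lemma IsWeightPair.lintegral_mul_absKernel_lt_top (hw : IsWeightPair a b C)
    (hb : IsTame fun p => (b p)⁻¹) (h k : L2) (ψ : 𝓢(Space, ℂ)) :
    ∫⁻ ξ, ‖ψ ξ‖ₑ * ∫⁻ η, absKernel a (fun x => ‖h x‖ₑ) (fun x => ‖k x‖ₑ) ξ η < ∞ := by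
  have mh : Measurable fun x => ‖h x‖ₑ := (Lp.stronglyMeasurable h).enorm
  have mk : Measurable fun x => ‖k x‖ₑ := (Lp.stronglyMeasurable k).enorm
  have e1 : Measurable fun ξ => ∫⁻ η, absKernel a (fun x => ‖h x‖ₑ) (fun x => ‖k x‖ₑ) ξ η :=
    (measurable_absKernel hw.meas_a mh mk).lintegral_prod_right'
  have e2 : Measurable fun ξ : Space => ENNReal.ofReal (b ((2 * Real.pi) • ξ)) :=
    (hw.meas_b.comp (measurable_const_smul _)).ennreal_ofReal
  have e3 := hb.memLp_schwartz_mul ψ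
  calc _ = ∫⁻ ξ, ‖ψ ξ * (((b ((2 * Real.pi) • ξ))⁻¹ : ℝ) : ℂ)‖ₑ *
        (ENNReal.ofReal (b ((2 * Real.pi) • ξ)) *
          ∫⁻ η, absKernel a (fun x => ‖h x‖ₑ) (fun x => ‖k x‖ₑ) ξ η) := by
        refine lintegral_congr_ae ?_
        filter_upwards [ae_ne_zero] with ξ h0
        have p1 := hw.pos_b _ (two_pi_smul_ne_zero h0)
        rw [enorm_mul, mul_assoc, ← mul_assoc ‖(((b ((2 * Real.pi) • ξ))⁻¹ : ℝ) : ℂ)‖ₑ,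
          ← ofReal_norm (((b ((2 * Real.pi) • ξ))⁻¹ : ℝ) : ℂ), Complex.norm_real, norm_inv,
              Real.norm_of_nonneg p1.le,
          ← ENNReal.ofReal_mul (by positivity), inv_mul_cancel₀ p1.ne', ENNReal.ofReal_one, one_mul]
    _ ≤ _ := ENNReal.lintegral_mul_le_Lp_mul_Lq _ Real.HolderConjugate.two_two
        e3.1.enorm (e2.mul e1).aemeasurable
    _ < ∞ := by
        refine ENNReal.mul_lt_top (ENNReal.rpow_lt_top_of_nonneg (by norm_num) ?_)
          (ENNReal.rpow_lt_top_of_nonneg (by norm_num) ?_)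
        · have := (eLpNorm_lt_top_iff_lintegral_rpow_enorm_lt_top two_ne_zero
            ENNReal.ofNat_ne_top).1 e3.2
          simpa using this.ne
        · refine ((hw.bilin _ _ mh mk).trans_lt ?_).ne
          rw [lintegral_enorm_sq_coeFn, lintegral_enorm_sq_coeFn]
          exact ENNReal.mul_lt_top (by finiteness) (by finiteness)

/-- The weights `a` and `b` are such that division by them gives an element of `L¹ + L²`, also
after multiplication by a component of the frequency in the case of `a`. -/
structure IsTamePair (a b : Space → ℝ) : Prop where
  left : IsTame fun p => (a p)⁻¹
  deriv : ∀ j, IsTame fun p => p j * (a p)⁻¹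
  right : IsTame fun p => (b p)⁻¹

/-- The advection term of fields with profiles `h` and `k` has the profile `interOp M hw h k`. -/
lemma IsWeightPair.isAdvection (hw : IsWeightPair a b C) (ht : IsTamePair a b) {u v N : VDist}
    {h k : L2} (hu : HasProfile a u h) (hv : HasProfile a v k)
    (hN : HasProfile b N (interOp M hw h k)) : IsAdvection M u v N := by
  obtain ⟨F, hF⟩ := ht.left.exists_isInverseFourier_fieldFun h
  choose G hG using fun j => (ht.deriv j).exists_isInverseFourier_derivFun k
  refine ⟨F, G, hF.isGivenBy hu, fun j => (hG j).isGivenBy (hv.fourier_lineDeriv j), fun φ => ?_⟩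
  have hint : ∀ j, Integrable (fun x : Space × Space => matRow M j (fieldFun a h x.2) •
      (𝓕⁻ φ x.1 • derivFun a k j (x.1 - x.2))) (volume.prod volume) := by
    intro j
    have mf := measurable_fieldFun hw.meas_a (Lp.stronglyMeasurable h).measurable
    have mg := measurable_derivFun hw.meas_a (Lp.stronglyMeasurable k).measurable j
    have mψ : Measurable (𝓕⁻ φ : 𝓢(Space, ℂ)) := (𝓕⁻ φ : 𝓢(Space, ℂ)).continuous.measurable
    have mm : Measurable fun x : Space × Space => matRow M j (fieldFun a h x.2) •
        (𝓕⁻ φ x.1 • derivFun a k j (x.1 - x.2)) := by fun_prop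
    refine ⟨mm.aestronglyMeasurable, ?_⟩
    rw [hasFiniteIntegral_iff_enorm, lintegral_prod _ mm.enorm.aemeasurable]
    have e1 : ∀ ξ, ∫⁻ η, ‖matRow M j (fieldFun a h η) • (𝓕⁻ φ ξ • derivFun a k j (ξ - η))‖ₑ ≤
        ENNReal.ofReal (matConst M) *
          (‖𝓕⁻ φ ξ‖ₑ * ∫⁻ η, absKernel a (fun x => ‖h x‖ₑ) (fun x => ‖k x‖ₑ) ξ η) := by
      intro ξ
      rw [← lintegral_const_mul' _ _ enorm_ne_top, ← lintegral_const_mul' _ _ ENNReal.ofReal_ne_top]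
      refine lintegral_mono_ae ?_
      filter_upwards [ae_ne_zero, ae_sub_ne_zero ξ] with η h0 h1
      rw [smul_comm, enorm_smul, mul_left_comm]
      exact mul_le_mul_right (hw.enorm_kernel_summand_le h k j ξ η h0 h1) _
    refine (lintegral_mono e1).trans_lt ?_
    rw [lintegral_const_mul' _ _ ENNReal.ofReal_ne_top]
    exact ENNReal.mul_lt_top ENNReal.ofReal_lt_top
      (hw.lintegral_mul_absKernel_lt_top ht.right h k _)
  have hprod := fun j => integral_mul_fourierInv_conv (matRow M j) hF (hG j) φ (hint j)
  have e : (fun x => φ x • ∑ j, (∑ k, (M j k : ℂ) * F x k) • G j x) =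
      fun x => ∑ j, matRow M j (F x) • (φ x • G j x) := by
    ext1 x
    simp only [Finset.smul_sum, matRow_apply, smul_comm (φ x)]
  rw [e]
  refine ⟨integrable_finsetSum _ fun j _ => (hprod j).1, ?_⟩
  rw [integral_finsetSum _ fun j _ => (hprod j).1]
  have e1 : N φ = ∫ ξ, 𝓕⁻ φ ξ • fieldFun b (interOp M hw h k) ξ := by
    rw [← (hN _).2, TemperedDistribution.fourier_apply, FourierTransform.fourier_fourierInv_eq]
  rw [e1]
  simp only [(hprod _).2]
  rw [← integral_finsetSum _ fun j _ => (hint j).integral_prod_left]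
  refine integral_congr_ae ?_
  have hae : ∀ᵐ ξ, ∀ j, Integrable fun η => matRow M j (fieldFun a h η) •
      (𝓕⁻ φ ξ • derivFun a k j (ξ - η)) := ae_all_iff.2 fun j => (hint j).prod_right_ae
  filter_upwards [coeFn_interOp (M := M) hw h k, hae, ae_ne_zero] with ξ h1 h2 h0
  have p1 := hw.pos_b _ (two_pi_smul_ne_zero h0)
  have p2 : (b ((2 * Real.pi) • ξ) : ℂ) ≠ 0 := by exact_mod_cast p1.ne'
  rw [← integral_finsetSum _ fun j _ => h2 j, fieldFun, h1, interFun, inv_smul_smul₀ p2,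
    ← integral_smul]
  refine integral_congr_ae (.of_forall fun η => ?_)
  simp only [interKernel_eq_sum, Finset.smul_sum, smul_comm (𝓕⁻ φ ξ)]

lemma IsAdvection.unique {u v N N' : VDist} (h : IsAdvection M u v N) (h' : IsAdvection M u v N') :
    N = N' := by
  obtain ⟨f, g, hf, hg, hN⟩ := h
  obtain ⟨f', g', hf', hg', hN'⟩ := h'
  refine hN.dist_eq (hN'.congr ?_)
  filter_upwards [hf.ae_eq hf', ae_all_iff.2 fun j => (hg j).ae_eq (hg' j)] with x h1 h2
  simp only [h1, h2]

end

end NSE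
namespace NSE

noncomputable section

/-! ### The bilinear operator on the Fourier side -/

lemma IsMultiplier.unique {m : Space → Vec →L[ℂ] Vec} {u w w' : VDist} (h : IsMultiplier m u w)
    (h' : IsMultiplier m u w') : w = w' := by
  obtain ⟨g, hg, hw⟩ := h
  obtain ⟨g', hg', hw'⟩ := h'
  have e : IsGivenBy (𝓕 w') fun ξ => m ((2 * Real.pi) • ξ) (g ξ) := by
    refine hw'.congr ?_
    filter_upwards [hg.ae_eq hg'] with ξ h
    rw [h]
  have := congr_arg (fun w : VDist => 𝓕⁻ w) (hw.dist_eq e)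
  simpa using this

lemma expSymbol_pos (c : ℝ) (p : Space) : 0 < expSymbol c p := Real.exp_pos _

lemma measurable_expSymbol (c : ℝ) : Measurable (expSymbol c) := by
  unfold expSymbol
  fun_prop

lemma expSymbol_neg_mul (c : ℝ) (p : Space) : expSymbol (-c) p * expSymbol c p = 1 := by
  rw [expSymbol, expSymbol, ← Real.exp_add]
  simp

lemma IsTame.expSymbol_mul {d : Space → ℝ} (hd : IsTame fun p => (d p)⁻¹) {c : ℝ} (hc : 0 ≤ c) :
    IsTame fun p => (expSymbol c p * d p)⁻¹ := by
  obtain ⟨h1, K, α, hK, h2, h3, h4⟩ := hd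
  refine ⟨?_, K, α, hK, h2, h3, fun p hp => ?_⟩
  · simp only [mul_inv]
    exact (measurable_expSymbol c).inv.mul h1
  · simp only [mul_inv, abs_mul]
    have : |(expSymbol c p)⁻¹| ≤ 1 := by
      rw [abs_inv, abs_of_pos (expSymbol_pos c p)]
      exact inv_le_one_of_one_le₀ (Real.one_le_exp (by positivity))
    calc _ ≤ 1 * |(d p)⁻¹| := by gcongr
      _ ≤ _ := by rw [one_mul]; exact h4 p hp

variable {M : Matrix (Fin 3) (Fin 3) ℝ} {P : Space → Vec →L[ℂ] Vec} {a b d : Space → ℝ}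
  {C γ μ : ℝ}

lemma HasProfile.remove_exp (ha : ∀ p, p ≠ 0 → 0 < a p) {c : ℝ} (hc : 0 ≤ c) {u : VDist} {h : L2}
    (hu : HasProfile (fun p => expSymbol c p * a p) u h) :
    HasProfile a u (NSE.mulOp (scalarSymbol (expSymbol (-c))) h) := by
  refine hu.mulOp (isBddSymbol_exp_neg hc) (fun p hp => (ha p hp).ne') fun p _ => ?_
  rw [← mul_assoc, expSymbol_neg_mul, one_mul]

/-- The integrand of the Duhamel term: it is determined by the profiles of the two fields. -/
lemma exists_duhamel_integrand (hw : IsWeightPair a b C) (ht : IsTamePair a b)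
    (hd : IsTarget d b γ) (hP : IsBddSymbol P 1) (hμ : 0 ≤ μ) {t s : ℝ} (hs : 0 ≤ s) (hst : s < t)
    {u v : VDist} {h k : L2} (hu : HasProfile (fun p => expSymbol (μ * s) p * a p) u h)
    (hv : HasProfile (fun p => expSymbol (μ * s) p * a p) v k) :
    ∃ N G : VDist, IsAdvection M u v N ∧
      IsMultiplier (fun p => (heatSymbol (t - s) p : ℂ) • P p) N G ∧
      HasProfile (fun p => expSymbol (μ * t) p * d p) G (kerOp M P hw d μ t s h k) := by
  have hμs : 0 ≤ μ * s := by positivity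
  have hu' := hu.remove_exp hw.pos_a hμs
  have hv' := hv.remove_exp hw.pos_a hμs
  unfold kerOp
  generalize NSE.mulOp (scalarSymbol (expSymbol (-(μ * s)))) h = h' at hu' ⊢
  generalize NSE.mulOp (scalarSymbol (expSymbol (-(μ * s)))) k = k' at hv' ⊢
  obtain ⟨N, hN⟩ := ht.right.exists_hasProfile (interOp M hw h' k')
  have hadv := hw.isAdvection ht hu' hv' hN
  generalize interOp M hw h' k' = g at hN
  obtain ⟨K, hK⟩ := isBddSymbol_kerSymbol hw hd hμ (le_max_right t 0) (sub_pos.2 hst)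
  have hK' := hK t s (le_max_left _ _) le_rfl
  have hd0 : ∀ p, p ≠ 0 → 0 < expSymbol (μ * t) p * d p := fun p hp =>
    mul_pos (expSymbol_pos _ p) (hd.pos p hp)
  have hheat : IsBddSymbol (scalarSymbol (heatSymbol (t - s))) 1 := by
    refine isBddSymbol_scalar (by unfold heatSymbol; fun_prop) fun p _ => ?_
    rw [heatSymbol, Real.abs_exp, Real.exp_le_one_iff]
    nlinarith [sq_nonneg ‖p‖]
  obtain ⟨G, hG⟩ := ht.right.exists_hasProfile
    (NSE.mulOp (scalarSymbol (heatSymbol (t - s))) (NSE.mulOp P g))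
  refine ⟨N, G, hadv, ⟨_, hN, IsGivenBy.congr hG ?_⟩, IsGivenBy.congr hG ?_⟩
  · filter_upwards [coeFn_mulOp_scalar hheat (NSE.mulOp P g), coeFn_mulOp hP g] with ξ h1 h2
    rw [fieldFun, fieldFun, h1, h2]
    simp only [smul_apply, map_smul]
  · filter_upwards [coeFn_mulOp_scalar hheat (NSE.mulOp P g),
      coeFn_mulOp_scalar hK' (NSE.mulOp P g), ae_ne_zero] with ξ h1 h2 h0
    rw [fieldFun, fieldFun, h1, h2, smul_smul, smul_smul]
    have p1 := hw.pos_b _ (two_pi_smul_ne_zero h0)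
    have p2 := hd.pos _ (two_pi_smul_ne_zero h0)
    congr 1
    rw [kerSymbol, expSymbol, heatSymbol, sub_eq_add_neg (μ * t * _), Real.exp_add, neg_mul]
    have p3 := Real.exp_ne_zero (μ * t * ‖(2 * Real.pi) • ξ‖)
    norm_cast
    field_simp

/-- On fields with profiles in the weight `a`, the bilinear operator is the Duhamel integral of the
profiles. -/
lemma isBilinear_iff (hw : IsWeightPair a b C) (ht : IsTamePair a b)
    (hd : IsTarget d b γ) (htd : IsTame fun p => (d p)⁻¹) (hP : IsBddSymbol P 1) (hμ : 0 ≤ μ)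
    {t : ℝ} (h0 : 0 < t) {u v : ℝ → VDist} {h k : ℝ → L2}
    (hu : ∀ s ∈ Ioo 0 t, HasProfile (fun p => expSymbol (μ * s) p * a p) (u s) (h s))
    (hv : ∀ s ∈ Ioo 0 t, HasProfile (fun p => expSymbol (μ * s) p * a p) (v s) (k s))
    (hint : IntervalIntegrable (fun s => kerOp M P hw d μ t s (h s) (k s)) volume 0 t)
    {B : VDist} : IsBilinear M P u v t B ↔
      HasProfile (fun p => expSymbol (μ * t) p * d p) B (-duhamel M P hw d μ h k t) := by
  have htd' := htd.expSymbol_mul (c := μ * t) (by positivity)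
  have key : ∀ G : ℝ → VDist, (∀ s ∈ Ioo 0 t,
      HasProfile (fun p => expSymbol (μ * t) p * d p) (G s) (kerOp M P hw d μ t s (h s) (k s))) →
      ∀ φ : 𝓢(Space, ℂ), IntegrableOn (fun s => G s φ) (Ioo 0 t) ∧
        -∫ s in Ioo 0 t, G s φ =
          pairing (fun p => expSymbol (μ * t) p * d p) φ (-duhamel M P hw d μ h k t) := by
    intro G hG φ
    have e : EqOn (fun s => G s φ) (fun s => pairing (fun p => expSymbol (μ * t) p * d p) φ
        (kerOp M P hw d μ t s (h s) (k s))) (Ioo 0 t) := fun s hs => (hG s hs).apply_eq htd' φ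
    have hint' := (intervalIntegrable_iff_integrableOn_Ioo_of_le h0.le).1 hint
    have hp := (pairing (fun p => expSymbol (μ * t) p * d p) φ).integrable_comp hint'
    refine ⟨IntegrableOn.congr_fun hp e.symm measurableSet_Ioo, ?_⟩
    rw [setIntegral_congr_fun measurableSet_Ioo e, ContinuousLinearMap.integral_comp_comm _ hint',
      map_neg, duhamel, intervalIntegral.integral_of_le h0.le, integral_Ioc_eq_integral_Ioo]
  have hex : ∀ s ∈ Ioo 0 t, ∃ N G : VDist, IsAdvection M (u s) (v s) N ∧
      IsMultiplier (fun p => (heatSymbol (t - s) p : ℂ) • P p) N G ∧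
      HasProfile (fun p => expSymbol (μ * t) p * d p) G (kerOp M P hw d μ t s (h s) (k s)) :=
    fun s hs => exists_duhamel_integrand hw ht hd hP hμ hs.1.le hs.2 (hu s hs) (hv s hs)
  constructor
  · rintro ⟨G, hG, hB⟩
    obtain ⟨B', hB'⟩ := htd'.exists_hasProfile (-duhamel M P hw d μ h k t)
    have hG' : ∀ s ∈ Ioo 0 t, HasProfile (fun p => expSymbol (μ * t) p * d p) (G s)
        (kerOp M P hw d μ t s (h s) (k s)) := by
      intro s hs
      obtain ⟨N, hN, hNG⟩ := hG s hs
      obtain ⟨N', G', h1, h2, h3⟩ := hex s hs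
      obtain rfl := hN.unique h1
      rwa [hNG.unique h2]
    have : B = B' := by
      ext1 φ
      rw [(hB φ).2, (key G hG' φ).2, hB'.apply_eq htd' φ]
    rwa [this]
  · intro hB
    choose! N G h1 h2 h3 using hex
    refine ⟨G, fun s hs => ⟨N s, h1 s hs, h2 s hs⟩, fun φ => ?_⟩
    obtain ⟨k1, k2⟩ := key G h3 φ
    exact ⟨k1, by rw [hB.apply_eq htd' φ, k2]⟩

end

end NSE
namespace NSE

noncomputable section

/-! ### The heat flow on the Fourier side -/

section Heat

variable {a d : Space → ℝ} {μ c T : ℝ}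

lemma measurable_kerSymbol_of_measurable (ha : Measurable a) (hd : Measurable d) (t s : ℝ) :
    Measurable (kerSymbol a d μ t s) := by
  unfold kerSymbol
  fun_prop

lemma continuousOn_mulOp_kerSymbol {S : Set ℝ} {K : ℝ}
    (hb : ∀ t ∈ S, IsBddSymbol (scalarSymbol (kerSymbol a d μ t 0)) K) (k : L2) :
    ContinuousOn (fun t => mulOp (scalarSymbol (kerSymbol a d μ t 0)) k) S := by
  intro t₀ ht₀
  refine tendsto_mulOp_of_tendsto_symbol (C := K) ?_ (hb t₀ ht₀) (.of_forall fun ξ => ?_) k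
  · filter_upwards [self_mem_nhdsWithin] with t ht using hb t ht
  · have : Continuous fun t => kerSymbol a d μ t 0 ((2 * Real.pi) • ξ) := by
      unfold kerSymbol
      fun_prop
    have h2 : Continuous fun t => scalarSymbol (kerSymbol a d μ t 0) ((2 * Real.pi) • ξ) := by
      unfold scalarSymbol
      fun_prop
    exact h2.continuousAt.continuousWithinAt

lemma isBddSymbol_heat_self (hd : Measurable d) (hpos : ∀ p, p ≠ 0 → 0 < d p) {t : ℝ}
    (ht : 0 ≤ t) (htT : t ≤ T) :
    IsBddSymbol (scalarSymbol (kerSymbol d d μ t 0)) (Real.exp (μ ^ 2 * T / 4)) := by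
  refine isBddSymbol_scalar (measurable_kerSymbol_of_measurable hd hd t 0) fun p hp => ?_
  rw [kerSymbol, div_self (hpos p hp).ne', one_mul, Real.abs_exp, sub_zero]
  refine Real.exp_le_exp.2 ?_
  nlinarith [mul_nonneg ht (sq_nonneg (‖p‖ - μ / 2)), mul_le_mul_of_nonneg_left htT (sq_nonneg μ)]

/-- The condition under which the heat semigroup gains `c` powers of the frequency. -/
structure IsInitWeight (a d : Space → ℝ) (c : ℝ) : Prop where
  meas_a : Measurable a
  meas_d : Measurable d
  pos_a : ∀ p, p ≠ 0 → 0 < a p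
  pos_d : ∀ p, p ≠ 0 → 0 < d p
  le : ∀ p, p ≠ 0 → a p ≤ d p * ‖p‖ ^ c
  nonneg : 0 ≤ c
  le_two : c ≤ 2

lemma IsInitWeight.isBddSymbol (hi : IsInitWeight a d c) (hμ : 0 ≤ μ) {t : ℝ} (ht : 0 < t) :
    IsBddSymbol (scalarSymbol (kerSymbol a d μ t 0))
      (4 * bracket (μ * Real.sqrt t) ^ c * Real.exp (μ ^ 2 * t / 4) * t ^ (-(c / 2))) := by
  refine isBddSymbol_scalar (measurable_kerSymbol_of_measurable hi.meas_a hi.meas_d t 0)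
    fun p hp => ?_
  have pd := hi.pos_d p hp
  have pa := hi.pos_a p hp
  rw [kerSymbol, abs_of_pos (by positivity), sub_zero]
  have h1 := rpow_mul_exp_le (x := ‖p‖) ht (norm_nonneg p) hμ hi.nonneg hi.le_two
  have e : μ * t * ‖p‖ - t * ‖p‖ ^ 2 = t * (μ * ‖p‖ - ‖p‖ ^ 2) := by ring
  rw [e]
  refine le_trans (mul_le_mul_of_nonneg_right ?_ (Real.exp_pos _).le) h1
  rw [div_le_iff₀ pd, mul_comm]
  exact hi.le p hp

/-- The profile `e^{-ζ(t)} t^{s₁} e^{θ(t)A} a(A) e^{-tA²} u₀` of the heat flow, in terms of the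
profile `k` of `u₀` in the weight `d`. -/
def heatProfile (a d : Space → ℝ) (μ c s₁ : ℝ) (k : L2) (t : ℝ) : L2 :=
  (omega μ c s₁ t : ℂ) • mulOp (scalarSymbol (kerSymbol a d μ t 0)) k

lemma IsInitWeight.norm_heatProfile_le (hi : IsInitWeight a d c) (hμ : 0 ≤ μ) {s₁ t : ℝ}
    (ht : 0 < t) (k : L2) : ‖heatProfile a d μ c s₁ k t‖ ≤ 4 * ‖k‖ * t ^ (s₁ - c / 2) := by
  have h1 := norm_mulOp_apply_le (hi.isBddSymbol hμ ht) k
  have h2 := bracket_pos (μ * Real.sqrt t)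
  rw [heatProfile, norm_smul, Complex.norm_real, Real.norm_of_nonneg (omega_pos ht).le]
  refine (mul_le_mul_of_nonneg_left h1 (omega_pos ht).le).trans_eq ?_
  rw [omega, Real.rpow_neg h2.le, Real.exp_neg, sub_eq_add_neg, Real.rpow_add ht]
  have h3 : bracket (μ * Real.sqrt t) ^ c ≠ 0 := (Real.rpow_pos_of_pos h2 c).ne'
  have h4 := Real.exp_ne_zero (μ ^ 2 * t / 4)
  field_simp

lemma IsInitWeight.continuousOn_heatProfile (hi : IsInitWeight a d c) (hμ : 0 ≤ μ) {s₁ : ℝ}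
    (k : L2) : ContinuousOn (heatProfile a d μ c s₁ k) (Ioc 0 T) := by
  have h1 : ContinuousOn (fun t => mulOp (scalarSymbol (kerSymbol a d μ t 0)) k) (Ioc 0 T) := by
    intro t₀ ht₀
    have hc := continuousOn_mulOp_kerSymbol (a := a) (d := d) (μ := μ) (S := Icc (t₀ / 2) T)
      (K := 4 * bracket (μ * Real.sqrt T) ^ c * Real.exp (μ ^ 2 * T / 4) * (t₀ / 2) ^ (-(c / 2)))
      (fun t ht => ?_) k
    · refine (hc t₀ ⟨by linarith [ht₀.1], ht₀.2⟩).mono_of_mem_nhdsWithin ?_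
      filter_upwards [self_mem_nhdsWithin, mem_nhdsWithin_of_mem_nhds
        (Ioi_mem_nhds (show t₀ / 2 < t₀ by linarith [ht₀.1]))] with t h1 h2
      exact ⟨le_of_lt h2, h1.2⟩
    · have ht0 : 0 < t₀ / 2 := by linarith [ht₀.1]
      have htp : 0 < t := ht0.trans_le ht.1
      obtain ⟨m1, m2⟩ := hi.isBddSymbol hμ htp
      refine ⟨m1, ?_⟩
      filter_upwards [m2] with ξ hξ
      refine hξ.trans ?_
      have b1 : bracket (μ * Real.sqrt t) ^ c ≤ bracket (μ * Real.sqrt T) ^ c :=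
        Real.rpow_le_rpow (bracket_pos _).le (bracket_mono (by positivity)
          (mul_le_mul_of_nonneg_left (Real.sqrt_le_sqrt ht.2) hμ)) hi.nonneg
      have b2 : Real.exp (μ ^ 2 * t / 4) ≤ Real.exp (μ ^ 2 * T / 4) :=
        Real.exp_le_exp.2 (by nlinarith [ht.2, sq_nonneg μ])
      have b3 : t ^ (-(c / 2)) ≤ (t₀ / 2) ^ (-(c / 2)) :=
        Real.rpow_le_rpow_of_nonpos ht0 ht.1 (by linarith [hi.nonneg])
      have p1 := Real.rpow_nonneg (bracket_pos (μ * Real.sqrt t)).le c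
      have p2 := Real.rpow_nonneg (bracket_pos (μ * Real.sqrt T)).le c
      exact mul_le_mul (mul_le_mul (mul_le_mul_of_nonneg_left b1 (by norm_num)) b2
        (Real.exp_pos _).le (by positivity)) b3 (Real.rpow_nonneg htp.le _) (by positivity)
  have h2 : ContinuousOn (fun t => (omega μ c s₁ t : ℂ)) (Ioc 0 T) :=
    Complex.continuous_ofReal.comp_continuousOn
      (continuousOn_omega.mono fun t (ht : t ∈ Ioc 0 T) => ht.1)
  exact ContinuousOn.smul (f := fun t => (omega μ c s₁ t : ℂ)) h2 h1

lemma HasProfile.heat {u₀ Y : VDist} {k : L2} (hpa : ∀ p, p ≠ 0 → 0 < a p)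
    (hpd : ∀ p, p ≠ 0 → 0 < d p) (hu : HasProfile d u₀ k) {t K : ℝ}
    (hb : IsBddSymbol (scalarSymbol (kerSymbol a d μ t 0)) K) :
    HasProfile (fun p => expSymbol (μ * t) p * a p) Y
      (NSE.mulOp (scalarSymbol (kerSymbol a d μ t 0)) k) ↔
          IsMultiplier (scalarSymbol (heatSymbol t)) u₀ Y := by
  have e : fieldFun (fun p => expSymbol (μ * t) p * a p)
      (NSE.mulOp (scalarSymbol (kerSymbol a d μ t 0)) k) =ᵐ[volume]
      fun ξ => scalarSymbol (heatSymbol t) ((2 * Real.pi) • ξ) (fieldFun d k ξ) := by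
    filter_upwards [coeFn_mulOp_scalar hb k, ae_ne_zero] with ξ h1 h0
    have p1 := hpa _ (two_pi_smul_ne_zero h0)
    have p2 := hpd _ (two_pi_smul_ne_zero h0)
    rw [fieldFun, h1, smul_smul]
    change _ = (heatSymbol t ((2 * Real.pi) • ξ) : ℂ) • fieldFun d k ξ
    rw [fieldFun, smul_smul]
    congr 1
    rw [kerSymbol, expSymbol, heatSymbol, sub_eq_add_neg, Real.exp_add, neg_mul, sub_zero]
    have p3 := Real.exp_ne_zero (μ * t * ‖(2 * Real.pi) • ξ‖)
    norm_cast
    field_simp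
  constructor
  · intro hY
    exact ⟨_, hu, IsGivenBy.congr hY e⟩
  · rintro ⟨g, hg, hY⟩
    refine hY.congr ?_
    filter_upwards [e, IsGivenBy.ae_eq hu hg] with ξ h1 h2
    rw [h1, h2]

end Heat

/-! ### The spaces `𝓑` on the Fourier side -/

lemma hasProfile_const_mul {A : Space → ℝ} {w : ℝ} {u : VDist} {h : L2} :
    HasProfile (fun p => w * A p) u h ↔ HasProfile A u (((w⁻¹ : ℝ) : ℂ) • h) := by
  have e : fieldFun (fun p => w * A p) h =ᵐ[volume] fieldFun A (((w⁻¹ : ℝ) : ℂ) • h : L2) := by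
    filter_upwards [Lp.coeFn_smul ((w⁻¹ : ℝ) : ℂ) h] with ξ h1
    rw [fieldFun, fieldFun, h1, Pi.smul_apply, smul_smul]
    congr 1
    push_cast
    rw [mul_inv, mul_comm]
  exact ⟨fun hu => IsGivenBy.congr hu e, fun hu => IsGivenBy.congr hu e.symm⟩

lemma definesBC_iff {J : Set ℝ} {A : ℝ → Space → ℝ} (hA : ∀ t ∈ J, ∀ p, p ≠ 0 → A t p ≠ 0)
    {v : ℝ → VDist} : DefinesBC J A v ↔ ∃ f : ℝ → L2, (∀ t ∈ J, HasProfile (A t) (v t) (f t)) ∧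
      ContinuousOn f J ∧ ∃ C : ℝ, ∀ t ∈ J, ‖f t‖ ≤ C := by
  constructor
  · rintro ⟨F, h1, h2, C, h3⟩
    refine ⟨fun t => 𝓕 (F t), fun t ht => (isMultiplier_iff_hasProfile (hA t ht)).1 (h1 t ht),
      (Lp.fourierTransformₗᵢ Space Vec).continuous.comp_continuousOn h2, C, fun t ht => ?_⟩
    rw [Lp.norm_fourier_eq]
    exact h3 t ht
  · rintro ⟨f, h1, h2, C, h3⟩
    refine ⟨fun t => 𝓕⁻ (f t), fun t ht => (h1 t ht).isMultiplier (hA t ht),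
      (Lp.fourierTransformₗᵢ Space Vec).symm.continuous.comp_continuousOn h2, C, fun t ht => ?_⟩
    refine Eq.trans_le ?_ (h3 t ht)
    exact (Lp.fourierTransformₗᵢ Space Vec).symm.norm_map (f t)

section Space

variable {a : Space → ℝ} {ζ θ : ℝ → ℝ} {μ c s₁ T : ℝ}

lemma memB_iff (ha : ∀ p, p ≠ 0 → 0 < a p) (hθ : ∀ t ∈ Ioc 0 T, θ t = μ * t)
    (hζ : ∀ t ∈ Ioc 0 T, Real.exp (-ζ t) * t ^ s₁ = omega μ c s₁ t) {v : ℝ → VDist} :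
    MemB ζ θ T s₁ a v ↔ ∃ f : ℝ → L2,
      (∀ t ∈ Ioc 0 T, HasProfile (fun p => expSymbol (μ * t) p * a p) (v t)
        (unweight μ c s₁ f t)) ∧ ContinuousOn f (Ioc 0 T) ∧ ∃ C : ℝ, ∀ t ∈ Ioc 0 T, ‖f t‖ ≤ C := by
  rw [MemB, definesBC_iff]
  · refine exists_congr fun f => and_congr (forall₂_congr fun t ht => ?_) Iff.rfl
    rw [hasProfile_const_mul, hζ t ht, hθ t ht, unweight]
  · intro t ht p hp
    rw [hζ t ht]
    exact (mul_pos (omega_pos ht.1) (mul_pos (expSymbol_pos _ _) (ha p hp))).ne'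

lemma normB_eq (ha : ∀ p, p ≠ 0 → 0 < a p) (hθ : ∀ t ∈ Ioc 0 T, θ t = μ * t)
    (hζ : ∀ t ∈ Ioc 0 T, Real.exp (-ζ t) * t ^ s₁ = omega μ c s₁ t) {v : ℝ → VDist} {f : ℝ → L2}
    (hf : ∀ t ∈ Ioc 0 T, HasProfile (fun p => expSymbol (μ * t) p * a p) (v t)
        (unweight μ c s₁ f t)) : normB ζ θ T s₁ a v = ⨆ t ∈ Ioc 0 T, ‖f t‖ₑ := by
  refine iSup_congr fun t => iSup_congr fun ht => ?_
  rw [hζ t ht, hθ t ht, (hf t ht).multNorm_eq fun p hp =>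
    (mul_pos (expSymbol_pos _ _) (ha p hp)).ne', ← ofReal_norm, ← ofReal_norm,
    ← ENNReal.ofReal_mul (omega_pos ht.1).le, unweight, norm_smul, Complex.norm_real,
    Real.norm_of_nonneg (inv_nonneg.2 (omega_pos ht.1).le),
        mul_inv_cancel_left₀ (omega_pos ht.1).ne']

end Space

end

end NSE
namespace NSE

noncomputable section

/-! ### The solution -/

variable {M : Matrix (Fin 3) (Fin 3) ℝ} {P : Space → Vec →L[ℂ] Vec} {a b d : Space → ℝ}
  {C γ μ c s₁ T N : ℝ} {ζ θ : ℝ → ℝ}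

/-- The standing assumptions: `a` is the weight of the space `𝓑`, `d` the weight of the initial
data, `b` that of the advection term; `s₁` is the power of `t` in the norm of `𝓑`, `c` the exponent
of `⟨λ(t)⟩` therein, and `μ = λ₀/√T`. -/
structure IsSetup (P : Space → Vec →L[ℂ] Vec) (a b d : Space → ℝ) (C γ μ c s₁ T : ℝ) : Prop where
  pair : IsWeightPair a b C
  tame : IsTamePair a b
  target : IsTarget a b γ
  init : IsInitWeight a d c
  proj : IsBddSymbol P 1
  nonneg_μ : 0 ≤ μ
  pos_T : 0 < T
  T_le : T ≤ 1
  c_lt : c < 1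
  s₁_nonneg : 0 ≤ s₁
  s₁_lt : 2 * s₁ < 1
  pos_δ : 0 < s₁ - c / 2
  scaling : 1 - γ / 2 - s₁ = s₁ - c / 2

variable (M) in
/-- `f` is the profile of the solution in the ball of `𝓑`, `y` that of the heat flow of data with
profile `k`, and `N` is a bound for `y` for which the fixed point argument applies. -/
structure IsSolProfile (hs : IsSetup P a b d C γ μ c s₁ T) (N : ℝ) (k : L2) (f : ℝ → L2) :
    Prop where
  heat_bdd : BddContOn (Ioc 0 T) (heatProfile a d μ c s₁ k) N
  small : 8 * (bilinConst M C γ c (2 * s₁) μ T * T ^ (s₁ - c / 2)) * N ≤ 1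
  le_data : N ≤ 4 * ‖k‖ * T ^ (s₁ - c / 2)
  bdd : BddContOn (Ioc 0 T) f (2 * N)
  eq : ∀ t ∈ Ioc 0 T, f t = heatProfile a d μ c s₁ k t - bilinOp M P hs.pair μ c s₁ f f t

lemma IsSetup.isBddBilin (hs : IsSetup P a b d C γ μ c s₁ T) :
    IsBddBilin (Ioc 0 T) (bilinOp M P hs.pair μ c s₁)
      (bilinConst M C γ c (2 * s₁) μ T * T ^ (s₁ - c / 2)) := by
  have h := isBddBilin_bilinOp (M := M) hs.pair hs.target hs.proj hs.nonneg_μ hs.pos_T hs.T_le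
    hs.init.nonneg hs.s₁_nonneg hs.s₁_lt (by rw [hs.scaling]; exact hs.pos_δ.le)
  rwa [hs.scaling] at h

lemma IsSetup.exp_mul_pos (hs : IsSetup P a b d C γ μ c s₁ T) (t : ℝ) {p : Space} (hp : p ≠ 0) :
    expSymbol (μ * t) p * a p ≠ 0 :=
  (mul_pos (expSymbol_pos _ _) (hs.pair.pos_a p hp)).ne'

lemma IsSetup.exists_solProfile (hs : IsSetup P a b d C γ μ c s₁ T) {k : L2}
    (hsmall : 32 * bilinConst M C γ c (2 * s₁) μ T * T ^ (2 * (s₁ - c / 2)) * ‖k‖ ≤ 1) :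
    ∃ N f, IsSolProfile M hs N k f ∧
      ENNReal.ofReal N = ⨆ t ∈ Ioc 0 T, ‖heatProfile a d μ c s₁ k t‖ₑ := by
  have hT := hs.pos_T
  have hb : ∀ t ∈ Ioc 0 T, ‖heatProfile a d μ c s₁ k t‖ ≤ 4 * ‖k‖ * T ^ (s₁ - c / 2) := by
    intro t ht
    refine (hs.init.norm_heatProfile_le hs.nonneg_μ ht.1 k).trans ?_
    exact mul_le_mul_of_nonneg_left (Real.rpow_le_rpow ht.1.le ht.2 hs.pos_δ.le) (by positivity)
  have hle : ⨆ t ∈ Ioc 0 T, ‖heatProfile a d μ c s₁ k t‖ₑ ≤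
      ENNReal.ofReal (4 * ‖k‖ * T ^ (s₁ - c / 2)) := by
    refine iSup₂_le fun t ht => ?_
    rw [← ofReal_norm]
    exact ENNReal.ofReal_le_ofReal (hb t ht)
  set S := ⨆ t ∈ Ioc 0 T, ‖heatProfile a d μ c s₁ k t‖ₑ with hS
  have hfin : S ≠ ∞ := (hle.trans_lt ENNReal.ofReal_lt_top).ne
  have hN : S.toReal ≤ 4 * ‖k‖ * T ^ (s₁ - c / 2) :=
    ENNReal.toReal_le_of_le_ofReal (by positivity) hle
  have hy : BddContOn (Ioc 0 T) (heatProfile a d μ c s₁ k) S.toReal :=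
    ⟨hs.init.continuousOn_heatProfile hs.nonneg_μ k, fun t ht => by
      have h1 : ‖heatProfile a d μ c s₁ k t‖ₑ ≤ S := le_iSup₂ (f := fun t (_ : t ∈ Ioc 0 T) =>
        ‖heatProfile a d μ c s₁ k t‖ₑ) t ht
      rw [← toReal_enorm]
      exact ENNReal.toReal_mono hfin h1, ENNReal.toReal_nonneg⟩
  have hsm : 8 * (bilinConst M C γ c (2 * s₁) μ T * T ^ (s₁ - c / 2)) * S.toReal ≤ 1 := by
    have hnn := bilinConst_nonneg (M := M) (c := c) (μ := μ) (T := T) hs.pair hs.target.lt_two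
        hs.s₁_lt
    refine le_trans ?_ hsmall
    have e : T ^ (2 * (s₁ - c / 2)) = T ^ (s₁ - c / 2) * T ^ (s₁ - c / 2) := by
      rw [← Real.rpow_add hT]
      ring_nf
    rw [e]
    calc _ ≤ 8 * (bilinConst M C γ c (2 * s₁) μ T * T ^ (s₁ - c / 2)) *
          (4 * ‖k‖ * T ^ (s₁ - c / 2)) :=
          mul_le_mul_of_nonneg_left hN (by positivity)
      _ = _ := by ring
  obtain ⟨f, hf, hfe⟩ := hs.isBddBilin.exists_fixedPoint hsm hy
  exact ⟨S.toReal, f, ⟨hy, hsm, hN, hf, hfe⟩, ENNReal.ofReal_toReal hfin⟩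

/-- The solution inherits the decay as `t → 0` of the heat flow. -/
lemma IsSolProfile.norm_le {hs : IsSetup P a b d C γ μ c s₁ T} {k : L2} {f : ℝ → L2}
    (hf : IsSolProfile M hs N k f) {t : ℝ} (ht : t ∈ Ioc 0 T) :
    ‖f t‖ ≤ 6 * ‖k‖ * t ^ (s₁ - c / 2) := by
  have h1 := hs.init.norm_heatProfile_le hs.nonneg_μ (s₁ := s₁) ht.1 k
  have h2 := norm_bilinOp_le (M := M) hs.pair hs.target hs.proj hs.nonneg_μ hs.T_le
    hs.init.nonneg hf.bdd hf.bdd hs.s₁_nonneg hs.s₁_lt ht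
  rw [hs.scaling] at h2
  have hnn := bilinConst_nonneg (M := M) (c := c) (μ := μ) (T := T) hs.pair hs.target.lt_two
      hs.s₁_lt
  have hN := hf.heat_bdd.nonneg
  have hTp := Real.rpow_pos_of_pos hs.pos_T (s₁ - c / 2)
  have h3 : bilinConst M C γ c (2 * s₁) μ T * (2 * N * (2 * N)) ≤ 2 * ‖k‖ := by
    have h4 : 8 * bilinConst M C γ c (2 * s₁) μ T * N * T ^ (s₁ - c / 2) * N ≤
        4 * ‖k‖ * T ^ (s₁ - c / 2) := by
      refine le_trans ?_ hf.le_data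
      refine mul_le_of_le_one_left hN (le_trans (le_of_eq ?_) hf.small)
      ring
    refine le_of_mul_le_mul_right ?_ hTp
    linarith
  rw [hf.eq t ht]
  refine (norm_sub_le _ _).trans ?_
  have h5 := mul_le_mul_of_nonneg_right h3 (Real.rpow_nonneg ht.1.le (s₁ - c / 2))
  linarith

lemma IsSetup.intervalIntegrable (hs : IsSetup P a b d C γ μ c s₁ T) {d' : Space → ℝ} {γ' : ℝ}
    (hd : IsTarget d' b γ') {f : ℝ → L2} {F : ℝ} (hf : BddContOn (Ioc 0 T) f F) {t : ℝ}
    (ht : t ∈ Ioc 0 T) : IntervalIntegrable (fun s => kerOp M P hs.pair d' μ t s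
      (unweight μ c s₁ f s) (unweight μ c s₁ f s)) volume 0 t := by
  have hle : ∀ t ∈ Ioc 0 T, ‖f t‖ ≤ F * t ^ (0 : ℝ) := by simpa using hf.le
  have hi := isInput_unweight hs.nonneg_μ hs.init.nonneg hf.cont hf.cont hf.nonneg hf.nonneg
    hle hle (s₁ := s₁) (by simpa using hs.s₁_nonneg) (by simpa using hs.s₁_lt)
  exact intervalIntegrable_integrand hs.pair hd hs.proj hs.nonneg_μ hs.T_le hi ht.1 ht.2

/-- The integral equation on the Fourier side. -/
lemma IsSetup.solvesIntegralEq_iff (hs : IsSetup P a b d C γ μ c s₁ T) {f y : ℝ → L2} {F : ℝ}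
    (hf : BddContOn (Ioc 0 T) f F) {X Y : ℝ → VDist}
    (hX : ∀ t ∈ Ioc 0 T, HasProfile (fun p => expSymbol (μ * t) p * a p) (X t)
      (unweight μ c s₁ f t))
    (hY : ∀ t ∈ Ioc 0 T, HasProfile (fun p => expSymbol (μ * t) p * a p) (Y t)
      (unweight μ c s₁ y t)) :
    SolvesIntegralEq M P T Y X ↔ ∀ t ∈ Ioc 0 T, f t = y t - bilinOp M P hs.pair μ c s₁ f f t := by
  refine forall₂_congr fun t ht => ?_
  have hsub : ∀ s ∈ Ioo 0 t, s ∈ Ioc 0 T := fun s h => ⟨h.1, (h.2.trans_le ht.2).le⟩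
  have hB := fun B => isBilinear_iff (M := M) (B := B) hs.pair hs.tame hs.target hs.tame.left
      hs.proj
    hs.nonneg_μ ht.1 (fun s h => hX s (hsub s h)) (fun s h => hX s (hsub s h))
    (hs.intervalIntegrable hs.target hf ht)
  have hω : (omega μ c s₁ t : ℂ) ≠ 0 := by exact_mod_cast (omega_pos ht.1).ne'
  have key : f t = y t - bilinOp M P hs.pair μ c s₁ f f t ↔ unweight μ c s₁ f t =
      unweight μ c s₁ y t +
        -duhamel M P hs.pair a μ (unweight μ c s₁ f) (unweight μ c s₁ f) t := by
    rw [bilinOp]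
    generalize duhamel M P hs.pair a μ (unweight μ c s₁ f) (unweight μ c s₁ f) t = D
    rw [unweight, unweight, Complex.ofReal_inv]
    constructor
    · intro h
      rw [h, smul_sub, inv_smul_smul₀ hω, sub_eq_add_neg]
    · intro h
      have := congr_arg (fun x => (omega μ c s₁ t : ℂ) • x) h
      simpa [smul_inv_smul₀ hω, sub_eq_add_neg] using this
  rw [key]
  constructor
  · rintro ⟨B, hB1, hB2⟩
    have h1 := (hY t ht).add ((hB B).1 hB1)
    rw [← hB2] at h1
    exact (hX t ht).unique (fun p hp => hs.exp_mul_pos t hp) h1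
  · intro h
    have hμt : 0 ≤ μ * t := mul_nonneg hs.nonneg_μ ht.1.le
    obtain ⟨B, hB1⟩ := (hs.tame.left.expSymbol_mul hμt).exists_hasProfile
      (-duhamel M P hs.pair a μ (unweight μ c s₁ f) (unweight μ c s₁ f) t)
    refine ⟨B, (hB B).2 hB1, (hX t ht).dist_eq ?_⟩
    rw [h]
    exact (hY t ht).add hB1

lemma hasProfile_heatProfile_iff (hs : IsSetup P a b d C γ μ c s₁ T) {u₀ Y : VDist} {k : L2}
    (hu : HasProfile d u₀ k) {t : ℝ} (ht : t ∈ Ioc 0 T) :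
    HasProfile (fun p => expSymbol (μ * t) p * a p) Y
      (unweight μ c s₁ (heatProfile a d μ c s₁ k) t) ↔
    IsMultiplier (scalarSymbol (heatSymbol t)) u₀ Y := by
  have hω : (omega μ c s₁ t : ℂ) ≠ 0 := by exact_mod_cast (omega_pos ht.1).ne'
  rw [← hu.heat hs.init.pos_a hs.init.pos_d (hs.init.isBddSymbol hs.nonneg_μ ht.1), unweight,
    heatProfile, Complex.ofReal_inv, inv_smul_smul₀ hω]

/-- Existence and uniqueness in the ball of `𝓑`, and the membership in `𝓑⁰`. -/
theorem IsSolProfile.exists_solution {hs : IsSetup P a b d C γ μ c s₁ T} {k : L2} {f : ℝ → L2}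
    (hf : IsSolProfile M hs N k f)
    (hN : ENNReal.ofReal N = ⨆ t ∈ Ioc 0 T, ‖heatProfile a d μ c s₁ k t‖ₑ)
    (hθ : ∀ t ∈ Ioc 0 T, θ t = μ * t)
    (hζ : ∀ t ∈ Ioc 0 T, Real.exp (-ζ t) * t ^ s₁ = omega μ c s₁ t) {u₀ : VDist}
    (hu : HasProfile d u₀ k) :
    ∃ Y X : ℝ → VDist, IsHeatFlow u₀ T Y ∧ MemB ζ θ T s₁ a Y ∧
      IsUniqueSolInBall M P ζ θ T s₁ a Y X ∧ MemB0 ζ θ T s₁ a X ∧ X 0 = u₀ ∧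
      (∀ t ∈ Ioc 0 T, HasProfile (fun p => expSymbol (μ * t) p * a p) (X t)
        (unweight μ c s₁ f t)) ∧ SolvesIntegralEq M P T Y X := by
  have hpa := hs.pair.pos_a
  have hex : ∀ (g : ℝ → L2) (t : ℝ), ∃ u : VDist, t ∈ Ioc 0 T →
      HasProfile (fun p => expSymbol (μ * t) p * a p) u (unweight μ c s₁ g t) := by
    intro g t
    by_cases ht : t ∈ Ioc 0 T
    · obtain ⟨u, hu⟩ := (hs.tame.left.expSymbol_mul
        (mul_nonneg hs.nonneg_μ ht.1.le)).exists_hasProfile (unweight μ c s₁ g t)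
      exact ⟨u, fun _ => hu⟩
    · exact ⟨0, fun h => absurd h ht⟩
  choose Y hY using hex (heatProfile a d μ c s₁ k)
  choose X₁ hX₁ using hex f
  have hX : ∀ t ∈ Ioc 0 T, HasProfile (fun p => expSymbol (μ * t) p * a p)
      (Function.update X₁ 0 u₀ t) (unweight μ c s₁ f t) := by
    intro t ht
    rw [Function.update_of_ne ht.1.ne']
    exact hX₁ t ht
  have hsol := (hs.solvesIntegralEq_iff hf.bdd hX hY).2 hf.eq
  have hBX : MemB ζ θ T s₁ a (Function.update X₁ 0 u₀) :=
    (memB_iff hpa hθ hζ).2 ⟨f, hX, hf.bdd.cont, _, hf.bdd.le⟩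
  have hNY : 2 * normB ζ θ T s₁ a Y = ENNReal.ofReal (2 * N) := by
    rw [normB_eq hpa hθ hζ hY, ← hN, ENNReal.ofReal_mul zero_le_two, ENNReal.ofReal_ofNat]
  refine ⟨Y, Function.update X₁ 0 u₀, fun t ht => (hasProfile_heatProfile_iff hs hu ht).1 (hY t ht),
    (memB_iff hpa hθ hζ).2 ⟨_, hY, hf.heat_bdd.cont, _, hf.heat_bdd.le⟩,
    ⟨⟨hBX, ?_, hsol⟩, ?_⟩, ⟨hBX, ?_⟩, Function.update_self _ _ _, hX, hsol⟩
  · rw [hNY, normB_eq hpa hθ hζ hX]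
    refine iSup₂_le fun t ht => ?_
    rw [← ofReal_norm]
    exact ENNReal.ofReal_le_ofReal (hf.bdd.le t ht)
  · intro X' hB' hn' hs' t ht
    obtain ⟨f', hX', hc', -⟩ := (memB_iff hpa hθ hζ).1 hB'
    rw [hNY, normB_eq hpa hθ hζ hX'] at hn'
    have hf' : BddContOn (Ioc 0 T) f' (2 * N) := by
      refine ⟨hc', fun t ht => ?_, hf.bdd.nonneg⟩
      have h1 : ‖f' t‖ₑ ≤ ENNReal.ofReal (2 * N) := (iSup₂_le_iff.1 hn') t ht
      rw [← ofReal_norm] at h1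
      exact (ENNReal.ofReal_le_ofReal_iff hf.bdd.nonneg).1 h1
    have he' := (hs.solvesIntegralEq_iff hf' hX' hY).1 hs'
    have e := hs.isBddBilin.fixedPoint_unique hf.small hf' hf.bdd he' hf.eq ht
    refine (hX' t ht).dist_eq ?_
    have e' : unweight μ c s₁ f' t = unweight μ c s₁ f t := by rw [unweight, unweight, e]
    rw [e']
    exact hX t ht
  · have hlim : Tendsto (fun t => ENNReal.ofReal (Real.exp (μ ^ 2 * T / 4) *
        bracket (μ * Real.sqrt T) ^ c * (6 * ‖k‖ * t ^ (s₁ - c / 2)))) (𝓝[>] 0) (𝓝 0) := by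
      have h1 : Tendsto (fun t : ℝ => t ^ (s₁ - c / 2)) (𝓝[>] 0) (𝓝 0) := by
        have := (Real.continuousAt_rpow_const 0 _ (Or.inr hs.pos_δ.le)).tendsto
        rw [Real.zero_rpow hs.pos_δ.ne'] at this
        exact this.mono_left nhdsWithin_le_nhds
      have h2 := ((h1.const_mul (6 * ‖k‖)).const_mul (Real.exp (μ ^ 2 * T / 4) *
        bracket (μ * Real.sqrt T) ^ c))
      rw [mul_zero, mul_zero] at h2
      simpa using ENNReal.tendsto_ofReal h2
    refine tendsto_of_tendsto_of_tendsto_of_le_of_le' tendsto_const_nhds hlim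
      (.of_forall fun _ => zero_le) ?_
    filter_upwards [Ioc_mem_nhdsGT hs.pos_T] with t ht
    have hpow : 0 < t ^ s₁ := Real.rpow_pos_of_pos ht.1 _
    rw [hθ t ht, (hX t ht).multNorm_eq (fun p hp => hs.exp_mul_pos t hp), ← ofReal_norm,
      ← ENNReal.ofReal_mul hpow.le, norm_unweight ht.1, Real.rpow_neg ht.1.le]
    refine ENNReal.ofReal_le_ofReal ?_
    have e : t ^ s₁ * (Real.exp (μ ^ 2 * t / 4) * bracket (μ * Real.sqrt t) ^ c * (t ^ s₁)⁻¹ *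
        ‖f t‖) = Real.exp (μ ^ 2 * t / 4) * bracket (μ * Real.sqrt t) ^ c * ‖f t‖ := by
      field_simp
    rw [e]
    have b1 : bracket (μ * Real.sqrt t) ^ c ≤ bracket (μ * Real.sqrt T) ^ c :=
      Real.rpow_le_rpow (bracket_pos _).le (bracket_mono
        (mul_nonneg hs.nonneg_μ (Real.sqrt_nonneg t))
        (mul_le_mul_of_nonneg_left (Real.sqrt_le_sqrt ht.2) hs.nonneg_μ)) hs.init.nonneg
    have b2 : Real.exp (μ ^ 2 * t / 4) ≤ Real.exp (μ ^ 2 * T / 4) :=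
      Real.exp_le_exp.2 (by nlinarith [ht.2, sq_nonneg μ])
    have p1 := Real.rpow_nonneg (bracket_pos (μ * Real.sqrt t)).le c
    have p2 := Real.rpow_nonneg (bracket_pos (μ * Real.sqrt T)).le c
    exact mul_le_mul (mul_le_mul b2 b1 p1 (Real.exp_pos _).le) (hf.norm_le ht) (norm_nonneg _)
      (by positivity)

/-! ### Regularity of the solution -/

/-- Regularity in a weight `d'` that the initial data are measured in: the field `e^{θ(t)A} d'(A) X`
is continuous up to `t = 0`, with an explicit bound. -/
theorem IsSolProfile.regularity {hs : IsSetup P a b d C γ μ c s₁ T} {k : L2} {f : ℝ → L2}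
    (hf : IsSolProfile M hs N k f) {d' : Space → ℝ} {γ' : ℝ} (hd : IsTarget d' b γ')
    (htd : IsTame fun p => (d' p)⁻¹) (hγ : 0 < 1 - γ' / 2 - c) {u₀ : VDist} {k' : L2}
    (hu' : HasProfile d' u₀ k') (hθ : ∀ t ∈ Icc 0 T, θ t = μ * t)
    {X Y : ℝ → VDist} (hX0 : X 0 = u₀) (hY : IsHeatFlow u₀ T Y)
    (hX : ∀ t ∈ Ioc 0 T, HasProfile (fun p => expSymbol (μ * t) p * a p) (X t)
      (unweight μ c s₁ f t))
    (hsol : SolvesIntegralEq M P T Y X) :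
    DefinesBC (Icc 0 T) (fun t p => expSymbol (θ t) p * d' p) X ∧
    ∀ t ∈ Ioc 0 T, multNorm (fun p => expSymbol (θ t) p * d' p) (X t) ≤
      ENNReal.ofReal (Real.exp (μ ^ 2 * T / 4) * (‖k'‖ +
        bilinConst M C γ' c c μ T * (36 * ‖k‖ ^ 2) * T ^ (1 - γ' / 2 - c))) := by
  have hμ := hs.nonneg_μ
  have hT := hs.pos_T
  set D := duhamel M P hs.pair d' μ (unweight μ c s₁ f) (unweight μ c s₁ f) with hD
  have hdm : Measurable d' := hd.meas
  have hexp : ∀ t p, p ≠ 0 → expSymbol (μ * t) p * d' p ≠ 0 := fun t p hp =>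
    (mul_pos (expSymbol_pos _ _) (hd.pos p hp)).ne'
  -- the decay of `f` makes the Duhamel term small as `t → 0`
  have hq : 2 * (s₁ - (s₁ - c / 2)) = c := by ring
  have hDle : ∀ t ∈ Ioc 0 T, ‖D t‖ ≤ bilinConst M C γ' c c μ T * (36 * ‖k‖ ^ 2) *
      Real.exp (μ ^ 2 * T / 4) * t ^ (1 - γ' / 2 - c) := by
    intro t ht
    have h := norm_duhamel_unweight_le (M := M) (α := s₁ - c / 2) (s₁ := s₁) hs.pair hd hs.proj hμ
      hs.T_le hs.init.nonneg hf.bdd.cont hf.bdd.cont (by positivity) (by positivity)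
      (fun t ht => hf.norm_le ht) (fun t ht => hf.norm_le ht) (by linarith [hs.init.nonneg])
      (by rw [hq]; exact hs.c_lt) ht
    rw [hq] at h
    have hnn := bilinConst_nonneg (M := M) (γ := γ') (c := c) (μ := μ) (T := T) hs.pair hd.lt_two
      hs.c_lt
    have b2 : Real.exp (μ ^ 2 * t / 4) ≤ Real.exp (μ ^ 2 * T / 4) :=
      Real.exp_le_exp.2 (by nlinarith [ht.2, sq_nonneg μ])
    have hp := Real.rpow_nonneg ht.1.le (1 - γ' / 2 - c)
    refine h.trans ?_
    have e : 6 * ‖k‖ * (6 * ‖k‖) = 36 * ‖k‖ ^ 2 := by ring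
    rw [e]
    exact mul_le_mul_of_nonneg_right (mul_le_mul_of_nonneg_left b2 (by positivity)) hp
  have hDc : ContinuousOn D (Ioc 0 T) := by
    have hle : ∀ t ∈ Ioc 0 T, ‖f t‖ ≤ 2 * N * t ^ (0 : ℝ) := by simpa using hf.bdd.le
    exact continuousOn_duhamel hs.pair hd hs.proj hμ hs.T_le
      (isInput_unweight hμ hs.init.nonneg hf.bdd.cont hf.bdd.cont hf.bdd.nonneg hf.bdd.nonneg
        hle hle (s₁ := s₁) (by simpa using hs.s₁_nonneg) (by simpa using hs.s₁_lt))
  have hheat : ∀ t ∈ Icc 0 T, IsBddSymbol (scalarSymbol (kerSymbol d' d' μ t 0))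
      (Real.exp (μ ^ 2 * T / 4)) := fun t ht => isBddSymbol_heat_self hdm hd.pos ht.1 ht.2
  have hD0 : D 0 = 0 := by simp [hD, duhamel]
  set x : ℝ → L2 := fun t => mulOp (scalarSymbol (kerSymbol d' d' μ t 0)) k' - D t with hx
  have hprof : ∀ t ∈ Icc 0 T, HasProfile (fun p => expSymbol (μ * t) p * d' p) (X t) (x t) := by
    intro t ht
    rcases ht.1.eq_or_lt with rfl | ht0
    · have e1 : mulOp (scalarSymbol (kerSymbol d' d' μ 0 0)) k' = k' := by
        ext1
        filter_upwards [coeFn_mulOp_scalar (hheat 0 ht) k', ae_ne_zero] with ξ h1 h0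
        have := (hd.pos _ (two_pi_smul_ne_zero h0)).ne'
        rw [h1, kerSymbol, div_self this]
        simp
      have e2 : (fun p => expSymbol (μ * 0) p * d' p) = d' := by
        ext p
        simp [expSymbol]
      simp only [hx]
      rw [e1, e2, hX0, hD0, sub_zero]
      exact hu'
    · have ht' : t ∈ Ioc 0 T := ⟨ht0, ht.2⟩
      obtain ⟨B, hB, hXB⟩ := hsol t ht'
      have hsub : ∀ s ∈ Ioo 0 t, s ∈ Ioc 0 T := fun s h => ⟨h.1, (h.2.trans_le ht.2).le⟩
      have h1 := (isBilinear_iff (M := M) hs.pair hs.tame hd htd hs.proj hμ ht0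
        (fun s h => hX s (hsub s h)) (fun s h => hX s (hsub s h))
        (hs.intervalIntegrable hd hf.bdd ht')).1 hB
      have h2 := (hu'.heat hd.pos hd.pos (hheat t ht)).2 (hY t ht')
      rw [hXB]
      simp only [hx]
      rw [sub_eq_add_neg]
      exact h2.add h1
  have hxc : ContinuousOn x (Icc 0 T) := by
    refine (continuousOn_mulOp_kerSymbol hheat k').sub ?_
    intro t ht
    rcases ht.1.eq_or_lt with rfl | ht0
    · rw [ContinuousWithinAt, hD0]
      have h1 : Tendsto (fun t : ℝ => bilinConst M C γ' c c μ T * (36 * ‖k‖ ^ 2) *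
          Real.exp (μ ^ 2 * T / 4) * t ^ (1 - γ' / 2 - c)) (𝓝[Icc 0 T] 0) (𝓝 0) := by
        have := (Real.continuousAt_rpow_const 0 _ (Or.inr hγ.le)).tendsto
        rw [Real.zero_rpow hγ.ne'] at this
        have h2 := (this.mono_left (nhdsWithin_le_nhds (s := Icc 0 T))).const_mul
          (bilinConst M C γ' c c μ T * (36 * ‖k‖ ^ 2) * Real.exp (μ ^ 2 * T / 4))
        rwa [mul_zero] at h2
      refine squeeze_zero_norm' ?_ h1
      filter_upwards [self_mem_nhdsWithin] with t ht
      rcases ht.1.eq_or_lt with rfl | ht0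
      · rw [hD0, norm_zero, Real.zero_rpow hγ.ne', mul_zero]
      · exact hDle t ⟨ht0, ht.2⟩
    · refine (hDc t ⟨ht0, ht.2⟩).mono_of_mem_nhdsWithin ?_
      filter_upwards [self_mem_nhdsWithin, mem_nhdsWithin_of_mem_nhds (Ioi_mem_nhds ht0)]
        with s h1 h2 using ⟨h2, h1.2⟩
  constructor
  · rw [definesBC_iff fun t ht p hp => by rw [hθ t ht]; exact hexp t p hp]
    refine ⟨x, fun t ht => by rw [hθ t ht]; exact hprof t ht, hxc, ?_⟩
    obtain ⟨K, hK⟩ := (isCompact_Icc.image_of_continuousOn hxc).isBounded.exists_norm_le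
    exact ⟨K, fun t ht => hK _ (mem_image_of_mem x ht)⟩
  · intro t ht
    have ht' : t ∈ Icc 0 T := ⟨ht.1.le, ht.2⟩
    rw [hθ t ht', (hprof t ht').multNorm_eq fun p hp => hexp t p hp, ← ofReal_norm]
    refine ENNReal.ofReal_le_ofReal ((norm_sub_le _ _).trans ?_)
    have hnn := bilinConst_nonneg (M := M) (γ := γ') (c := c) (μ := μ) (T := T) hs.pair hd.lt_two
      hs.c_lt
    have h1 := norm_mulOp_apply_le (hheat t ht') k'
    have h2 : t ^ (1 - γ' / 2 - c) ≤ T ^ (1 - γ' / 2 - c) :=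
      Real.rpow_le_rpow ht.1.le ht.2 hγ.le
    have h3 := (hDle t ht).trans (mul_le_mul_of_nonneg_left h2 (by positivity))
    linarith

end

end NSE
namespace NSE

noncomputable section

/-! ### Real fields -/

/-- Complex conjugation of vectors. -/
def conjVec : Vec ≃ₗᵢ[ℝ] Vec := LinearIsometryEquiv.piLpCongrRight 2 fun _ => Complex.conjLIE

lemma conjVec_apply (v : Vec) (i : Fin 3) : conjVec v i = (starRingEnd ℂ) (v i) := rfl

lemma conjVec_smul (z : ℂ) (v : Vec) : conjVec (z • v) = (starRingEnd ℂ) z • conjVec v := by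
  ext i
  simp [conjVec_apply]

/-- The operator which on the Fourier side corresponds to the complex conjugation of fields. -/
def reflConj : L2 →L[ℝ] L2 :=
  (ContinuousLinearMap.compLpL 2 volume (conjVec.toContinuousLinearEquiv : Vec →L[ℝ] Vec)).comp
    (Lp.compMeasurePreservingₗᵢ ℝ (fun ξ : Space => -ξ)
      (Measure.measurePreserving_neg volume)).toContinuousLinearMap

lemma coeFn_reflConj (f : L2) : reflConj f =ᵐ[volume] fun ξ => conjVec (f (-ξ)) := by
  have h1 := ContinuousLinearMap.coeFn_compLp
    (conjVec.toContinuousLinearEquiv : Vec →L[ℝ] Vec) (Lp.compMeasurePreserving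
      (fun ξ : Space => -ξ) (Measure.measurePreserving_neg volume) f)
  have h2 := Lp.coeFn_compMeasurePreserving f
      (Measure.measurePreserving_neg (volume : Measure Space))
  filter_upwards [h1, h2] with ξ h1 h2
  refine Eq.trans h1 ?_
  rw [h2]
  rfl

lemma norm_reflConj (f : L2) : ‖reflConj f‖ = ‖f‖ := by
  have h1 : ‖reflConj f‖ = ‖Lp.compMeasurePreserving
      (fun ξ : Space => -ξ) (Measure.measurePreserving_neg volume) f‖ := by
    rw [Lp.norm_def, Lp.norm_def]
    congr 1
    refine eLpNorm_congr_norm_ae ?_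
    filter_upwards [coeFn_reflConj f, Lp.coeFn_compMeasurePreserving f
      (Measure.measurePreserving_neg (volume : Measure Space))] with ξ h1 h2
    rw [h1, h2]
    exact conjVec.norm_map _
  rw [h1, Lp.norm_compMeasurePreserving]

lemma ae_neg {p : Space → Prop} (h : ∀ᵐ ξ, p ξ) : ∀ᵐ ξ, p (-ξ) :=
  (Measure.measurePreserving_neg (volume : Measure Space)).quasiMeasurePreserving.ae h

lemma reflConj_smul (r : ℝ) (f : L2) : reflConj ((r : ℂ) • f) = (r : ℂ) • reflConj f := by
  ext1
  filter_upwards [coeFn_reflConj ((r : ℂ) • f), coeFn_reflConj f,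
      Lp.coeFn_smul (r : ℂ) (reflConj f),
    ae_neg (Lp.coeFn_smul (r : ℂ) f)] with ξ h1 h2 h3 h4
  rw [h1, h3, h4, Pi.smul_apply, Pi.smul_apply, h2, conjVec_smul, Complex.conj_ofReal]

lemma reflConj_mulOp {m : Space → Vec →L[ℂ] Vec} {C : ℝ} (hm : IsBddSymbol m C)
    (hsymm : ∀ᵐ ξ : Space, ∀ v, conjVec (m ((2 * Real.pi) • -ξ) v) =
      m ((2 * Real.pi) • ξ) (conjVec v)) (f : L2) :
    reflConj (mulOp m f) = mulOp m (reflConj f) := by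
  ext1
  filter_upwards [coeFn_reflConj (mulOp m f), coeFn_reflConj f, coeFn_mulOp hm (reflConj f),
    ae_neg (coeFn_mulOp hm f), hsymm] with ξ h1 h2 h3 h4 h5
  rw [h1, h3, h4, h2, h5]

lemma reflConj_mulOp_scalar {m : Space → ℝ} {C : ℝ} (hm : IsBddSymbol (scalarSymbol m) C)
    (heven : ∀ p, m (-p) = m p) (f : L2) :
    reflConj (mulOp (scalarSymbol m) f) = mulOp (scalarSymbol m) (reflConj f) := by
  refine reflConj_mulOp hm (.of_forall fun ξ v => ?_) f
  change conjVec ((m ((2 * Real.pi) • -ξ) : ℂ) • v) = (m ((2 * Real.pi) • ξ) : ℂ) • conjVec v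
  rw [conjVec_smul, Complex.conj_ofReal, smul_neg, heven]

variable {M : Matrix (Fin 3) (Fin 3) ℝ} {P : Space → Vec →L[ℂ] Vec} {a b d : Space → ℝ}
  {C γ μ c s₁ T N : ℝ}

lemma advLin_conj (M : Matrix (Fin 3) (Fin 3) ℝ) (p : Space) (u : Vec) :
    (starRingEnd ℂ) (advLin M (-p) u) = advLin M p (conjVec u) := by
  simp [advLin_apply, conjVec_apply]

lemma conjVec_interKernel (ha : ∀ p, a (-p) = a p) (h k : Space → Vec) (ξ η : Space) :
    conjVec (interKernel M a h k (-ξ) (-η)) =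
      interKernel M a (fun x => conjVec (h (-x))) (fun x => conjVec (k (-x))) ξ η := by
  have e : -ξ - -η = -(ξ - η) := by abel
  simp only [interKernel, conjVec_smul, e, smul_neg, ha, map_mul, Complex.conj_ofReal, advLin_conj]

lemma reflConj_interOp (hw : IsWeightPair a b C) (ha : ∀ p, a (-p) = a p) (hb : ∀ p, b (-p) = b p)
    (h k : L2) : reflConj (interOp M hw h k) = interOp M hw (reflConj h) (reflConj k) := by
  ext1
  filter_upwards [coeFn_reflConj (interOp M hw h k),
      coeFn_interOp (M := M) hw (reflConj h) (reflConj k),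
    ae_neg (coeFn_interOp (M := M) hw h k)] with ξ h1 h2 h3
  rw [h1, h2, h3, interFun_congr (coeFn_reflConj h) (coeFn_reflConj k), interFun, interFun,
    conjVec_smul, Complex.conj_ofReal, smul_neg, hb]
  congr 1
  rw [← integral_neg_eq_self]
  refine ((conjVec.toContinuousLinearEquiv).integral_comp_comm _).symm.trans ?_
  exact integral_congr_ae (.of_forall fun η => conjVec_interKernel ha h k ξ η)

lemma IsRealSymbol.ae_conjVec (hP : IsRealSymbol P) :
    ∀ᵐ ξ : Space, ∀ v, conjVec (P ((2 * Real.pi) • -ξ) v) = P ((2 * Real.pi) • ξ) (conjVec v) := by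
  filter_upwards [quasiMeasurePreserving_dilation.ae hP] with ξ hξ v
  have e : ∀ (Q : Vec →L[ℂ] Vec) (w : Vec) (j : Fin 3),
      Q w j = ∑ i, w i * Q (EuclideanSpace.single i 1) j := by
    intro Q w j
    have hw : w = ∑ i, w i • (EuclideanSpace.single i (1 : ℂ) : Vec) := by
      ext j
      simp [Pi.single_apply]
    conv_lhs => rw [hw]
    simp
  ext j
  rw [conjVec_apply, e, e _ (conjVec v), map_sum]
  refine Finset.sum_congr rfl fun i _ => ?_
  rw [smul_neg, hξ i j, map_mul, Complex.conj_conj, conjVec_apply]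

lemma kerSymbol_even (hd : ∀ p, d (-p) = d p) (hb : ∀ p, b (-p) = b p) (t s : ℝ) (p : Space) :
    kerSymbol d b μ t s (-p) = kerSymbol d b μ t s p := by
  simp [kerSymbol, hd, hb]

lemma reflConj_kerOp (hw : IsWeightPair a b C) (hd : IsTarget d b γ) (hP1 : IsBddSymbol P 1)
    (hP : IsRealSymbol P) (hμ : 0 ≤ μ) (ha : ∀ p, a (-p) = a p) (hb : ∀ p, b (-p) = b p)
    (hde : ∀ p, d (-p) = d p) {t s : ℝ} (hs : 0 ≤ s) (hst : s < t) (h k : L2) :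
    reflConj (kerOp M P hw d μ t s h k) = kerOp M P hw d μ t s (reflConj h) (reflConj k) := by
  obtain ⟨K, hK⟩ := isBddSymbol_kerSymbol hw hd hμ (le_max_right t 0) (sub_pos.2 hst)
  have hexp : ∀ p, expSymbol (-(μ * s)) (-p) = expSymbol (-(μ * s)) p := by simp [expSymbol]
  have h0 : 0 ≤ μ * s := by positivity
  unfold kerOp
  rw [reflConj_mulOp_scalar (hK t s (le_max_left _ _) le_rfl) (kerSymbol_even hde hb t s),
    reflConj_mulOp hP1 hP.ae_conjVec, reflConj_interOp hw ha hb,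
    reflConj_mulOp_scalar (isBddSymbol_exp_neg h0) hexp,
    reflConj_mulOp_scalar (isBddSymbol_exp_neg h0) hexp]

lemma IsSetup.reflConj_bilinOp (hs : IsSetup P a b d C γ μ c s₁ T) (hP : IsRealSymbol P)
    (ha : ∀ p, a (-p) = a p) (hb : ∀ p, b (-p) = b p) {f : ℝ → L2} {F : ℝ}
    (hf : BddContOn (Ioc 0 T) f F) {t : ℝ} (ht : t ∈ Ioc 0 T) :
    reflConj (bilinOp M P hs.pair μ c s₁ f f t) =
      bilinOp M P hs.pair μ c s₁ (fun s => reflConj (f s)) (fun s => reflConj (f s)) t := by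
  rw [bilinOp, bilinOp, reflConj_smul, duhamel, duhamel,
    ← ContinuousLinearMap.intervalIntegral_comp_comm reflConj
      (hs.intervalIntegrable hs.target hf ht)]
  congr 1
  refine intervalIntegral.integral_congr_ae ?_
  have hne : ∀ᵐ s : ℝ, s ≠ t := by simp [ae_iff, measure_singleton]
  filter_upwards [hne] with s hst hs'
  rw [uIoc_of_le ht.1.le] at hs'
  rw [reflConj_kerOp hs.pair hs.target hs.proj hP hs.nonneg_μ ha hb ha hs'.1.le
    (lt_of_le_of_ne hs'.2 hst)]
  simp only [unweight, reflConj_smul]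

/-- The solution has a real profile if the initial data do: the conjugate solves the same
fixed point problem. -/
lemma IsSolProfile.reflConj_eq {hs : IsSetup P a b d C γ μ c s₁ T} {k : L2} {f : ℝ → L2}
    (hf : IsSolProfile M hs N k f) (hP : IsRealSymbol P) (ha : ∀ p, a (-p) = a p)
    (hb : ∀ p, b (-p) = b p) (hd : ∀ p, d (-p) = d p) (hk : reflConj k = k) {t : ℝ}
    (ht : t ∈ Ioc 0 T) : reflConj (f t) = f t := by
  have hf' : BddContOn (Ioc 0 T) (fun s => reflConj (f s)) (2 * N) :=
    ⟨reflConj.continuous.comp_continuousOn hf.bdd.cont, fun s hs => by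
      rw [norm_reflConj]; exact hf.bdd.le s hs, hf.bdd.nonneg⟩
  refine hs.isBddBilin.fixedPoint_unique hf.small hf' hf.bdd (fun t ht => ?_) hf.eq ht
  rw [← hs.reflConj_bilinOp hP ha hb hf.bdd ht, hf.eq t ht, map_sub]
  congr 1
  rw [heatProfile, reflConj_smul, reflConj_mulOp_scalar (hs.init.isBddSymbol hs.nonneg_μ ht.1)
    (kerSymbol_even ha hd t 0), hk]

/-- Complex conjugation of test functions. -/
def conjSchwartz (φ : 𝓢(Space, ℂ)) : 𝓢(Space, ℂ) :=
  SchwartzMap.postcompCLM (𝕜 := ℝ) (Complex.conjCLE : ℂ →L[ℝ] ℂ) φ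

lemma conjSchwartz_apply (φ : 𝓢(Space, ℂ)) (x : Space) :
    conjSchwartz φ x = (starRingEnd ℂ) (φ x) := rfl

/-- Reflection of test functions. -/
def reflSchwartz (φ : 𝓢(Space, ℂ)) : 𝓢(Space, ℂ) :=
  SchwartzMap.compCLMOfContinuousLinearEquiv ℂ (ContinuousLinearEquiv.neg ℝ) φ

lemma reflSchwartz_apply (φ : 𝓢(Space, ℂ)) (x : Space) : reflSchwartz φ x = φ (-x) := rfl

lemma fourier_conjSchwartz_reflSchwartz (φ : 𝓢(Space, ℂ)) :
    𝓕 (conjSchwartz (reflSchwartz φ)) = conjSchwartz (𝓕 φ) := by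
  ext ξ
  rw [conjSchwartz_apply, SchwartzMap.fourier_coe, SchwartzMap.fourier_coe, Real.fourier_eq,
    Real.fourier_eq, ← integral_conj, ← integral_neg_eq_self]
  refine integral_congr_ae (.of_forall fun x => ?_)
  simp [conjSchwartz_apply, reflSchwartz_apply, Circle.smul_def, ← Circle.coe_inv_eq_conj,
    AddChar.map_neg_eq_inv]

lemma IsReal.conj_apply {u : VDist} (hu : IsReal u) (φ : 𝓢(Space, ℂ)) :
    conjVec (u (conjSchwartz φ)) = u φ := by
  set χ₁ : 𝓢(Space, ℂ) := (1 / 2 : ℂ) • (φ + conjSchwartz φ) with h1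
  set χ₂ : 𝓢(Space, ℂ) := (-Complex.I / 2 : ℂ) • (φ - conjSchwartz φ) with h2
  have e1 : φ = χ₁ + Complex.I • χ₂ := by
    ext x
    simp [h1, h2, conjSchwartz_apply]
    linear_combination ((1 / 2) * (φ x - (starRingEnd ℂ) (φ x))) * Complex.I_sq
  have e2 : conjSchwartz φ = χ₁ - Complex.I • χ₂ := by
    ext x
    simp [h1, h2, conjSchwartz_apply]
    linear_combination (-(1 / 2) * (φ x - (starRingEnd ℂ) (φ x))) * Complex.I_sq
  have r1 : ∀ i, (starRingEnd ℂ) (u χ₁ i) = u χ₁ i := fun i =>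
    Complex.conj_eq_iff_im.2 (hu χ₁ (fun x => by simp [h1, conjSchwartz_apply]) i)
  have r2 : ∀ i, (starRingEnd ℂ) (u χ₂ i) = u χ₂ i := fun i =>
    Complex.conj_eq_iff_im.2 (hu χ₂ (fun x => by simp [h2, conjSchwartz_apply]) i)
  rw [e2]
  conv_rhs => rw [e1]
  ext i
  simp [conjVec_apply, r1, r2]

/-- Conjugation of a field amounts to `reflConj` of its profile. -/
lemma HasProfile.reflConj_integral {u : VDist} {h : L2} (hd : ∀ p, d (-p) = d p)
    (hu : HasProfile d u h) (ψ : 𝓢(Space, ℂ)) :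
    Integrable (fun ξ => ψ ξ • fieldFun d (reflConj h) ξ) ∧
      ∫ ξ, ψ ξ • fieldFun d (reflConj h) ξ = conjVec (u (conjSchwartz (𝓕 ψ))) := by
  obtain ⟨i1, i2⟩ := hu (conjSchwartz (reflSchwartz ψ))
  have e : (fun ξ => ψ ξ • fieldFun d (reflConj h) ξ) =ᵐ[volume]
      fun ξ => conjVec (conjSchwartz (reflSchwartz ψ) (-ξ) • fieldFun d h (-ξ)) := by
    filter_upwards [coeFn_reflConj h] with ξ h1
    rw [conjVec_smul, fieldFun, fieldFun, conjVec_smul, h1, conjSchwartz_apply, reflSchwartz_apply,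
      neg_neg, Complex.conj_conj, smul_neg, hd, map_inv₀, Complex.conj_ofReal]
  constructor
  · refine Integrable.congr ?_ e.symm
    exact (conjVec.toContinuousLinearEquiv : Vec →L[ℝ] Vec).integrable_comp i1.comp_neg
  · rw [integral_congr_ae e, integral_neg_eq_self
      (fun ξ => conjVec (conjSchwartz (reflSchwartz ψ) ξ • fieldFun d h ξ)),
      ← fourier_conjSchwartz_reflSchwartz, ← TemperedDistribution.fourier_apply, i2]
    exact conjVec.toContinuousLinearEquiv.integral_comp_comm _

lemma HasProfile.reflConj_eq_of_isReal {u : VDist} {h : L2} (hd : ∀ p, d (-p) = d p)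
    (hpos : ∀ p, p ≠ 0 → 0 < d p) (hu : HasProfile d u h) (hr : IsReal u) : reflConj h = h := by
  refine HasProfile.unique (fun p hp => (hpos p hp).ne') (fun ψ => ?_) hu
  obtain ⟨i1, i2⟩ := hu.reflConj_integral hd ψ
  refine ⟨i1, ?_⟩
  rw [i2, hr.conj_apply, TemperedDistribution.fourier_apply]

lemma HasProfile.isReal {u : VDist} {h : L2} (hd : ∀ p, d (-p) = d p) (hu : HasProfile d u h)
    (hh : reflConj h = h) : IsReal u := by
  intro φ hφ i
  have e : conjSchwartz φ = φ := by
    ext x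
    rw [conjSchwartz_apply]
    exact Complex.conj_eq_iff_im.2 (hφ x)
  obtain ⟨-, i2⟩ := hu.reflConj_integral hd (𝓕⁻ φ)
  rw [hh, ← (hu _).2, TemperedDistribution.fourier_apply, FourierTransform.fourier_fourierInv_eq,
    e] at i2
  have := congrArg (fun v : Vec => v i) i2
  exact Complex.conj_eq_iff_im.1 this.symm

end

end NSE
namespace NSE

noncomputable section

/-! ### The Sobolev weights -/

lemma isBddSymbol_of_isStarProjection {P : Space → Vec →L[ℂ] Vec}
    (hm : AEStronglyMeasurable P volume) (hP : ∀ᵐ p, IsStarProjection (P p)) : IsBddSymbol P 1 :=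
  ⟨hm.comp_quasiMeasurePreserving quasiMeasurePreserving_dilation, by
    filter_upwards [quasiMeasurePreserving_dilation.ae hP] with ξ hξ using hξ.norm_le⟩

lemma isTame_of_le {m : Space → ℝ} (hm : Measurable m) {α : ℝ} (h0 : 0 ≤ α) (h1 : α < 3 / 2)
    (hle : ∀ p, p ≠ 0 → |m p| ≤ 1 + ‖p‖ ^ (-α)) : IsTame m :=
  ⟨hm, 1, α, zero_le_one, h0, h1, fun p hp => by rw [one_mul]; exact hle p hp⟩

lemma isTame_inv_homSymbol {s : ℝ} (h0 : 0 ≤ s) (h1 : s < 3 / 2) :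
    IsTame fun p => (homSymbol s p)⁻¹ := by
  refine isTame_of_le (measurable_homSymbol s).inv h0 h1 fun p hp => ?_
  rw [homSymbol, ← Real.rpow_neg (norm_nonneg p),
      abs_of_nonneg (Real.rpow_nonneg (norm_nonneg p) _)]
  linarith

lemma isTame_coord_mul_inv_homSymbol {s : ℝ} (h0 : 1 ≤ s) (h1 : s < 3 / 2) (j : Fin 3) :
    IsTame fun p => p j * (homSymbol s p)⁻¹ := by
  have hm : Measurable fun p : Space => p j := by fun_prop
  refine isTame_of_le (hm.mul (measurable_homSymbol s).inv) (show 0 ≤ s - 1 by linarith)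
    (by linarith) fun p hp => ?_
  have hp' := norm_pos_iff.2 hp
  have h2 : |p j| ≤ ‖p‖ := PiLp.norm_apply_le p j
  rw [homSymbol, ← Real.rpow_neg (norm_nonneg p), abs_mul,
    abs_of_nonneg (Real.rpow_nonneg (norm_nonneg p) _)]
  have e : ‖p‖ ^ (-(s - 1)) = ‖p‖ * ‖p‖ ^ (-s) := by
    rw [neg_sub, sub_eq_add_neg, Real.rpow_add hp', Real.rpow_one]
  rw [e]
  nlinarith [Real.rpow_nonneg hp'.le (-s)]

lemma isTame_inv_inhomSymbol {s : ℝ} (h0 : 0 ≤ s) : IsTame fun p => (inhomSymbol s p)⁻¹ := by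
  refine isTame_of_le (measurable_inhomSymbol s).inv le_rfl (by norm_num) fun p hp => ?_
  rw [abs_of_pos (inv_pos.2 (inhomSymbol_pos s p)), neg_zero, Real.rpow_zero]
  have : (inhomSymbol s p)⁻¹ ≤ 1 :=
    inv_le_one_of_one_le₀ (Real.one_le_rpow (one_le_bracket _) h0)
  linarith

lemma isTame_coord_mul_inv_inhomSymbol {s : ℝ} (h0 : 1 ≤ s) (j : Fin 3) :
    IsTame fun p => p j * (inhomSymbol s p)⁻¹ := by
  have hm : Measurable fun p : Space => p j := by fun_prop
  refine isTame_of_le (hm.mul (measurable_inhomSymbol s).inv) le_rfl (by norm_num) fun p hp => ?_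
  rw [abs_mul, abs_of_pos (inv_pos.2 (inhomSymbol_pos s p)), neg_zero, Real.rpow_zero,
    ← div_eq_mul_inv]
  have h1 : |p j| ≤ inhomSymbol s p :=
    calc |p j| ≤ ‖p‖ := PiLp.norm_apply_le p j
      _ ≤ bracket ‖p‖ := (le_abs_self _).trans (abs_le_bracket _)
      _ ≤ bracket ‖p‖ ^ s := by
        conv_lhs => rw [← Real.rpow_one (bracket ‖p‖)]
        exact Real.rpow_le_rpow_of_exponent_le (one_le_bracket _) h0
  have : |p j| / inhomSymbol s p ≤ 1 := (div_le_one (inhomSymbol_pos s p)).2 h1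
  linarith

lemma isTamePair_hom {σ : ℝ} (h0 : 5 / 4 ≤ σ) (h1 : σ < 3 / 2) :
    IsTamePair (homSymbol σ) (homSymbol (2 * σ - 5 / 2)) :=
  ⟨isTame_inv_homSymbol (by linarith) h1, isTame_coord_mul_inv_homSymbol (by linarith) h1,
    isTame_inv_homSymbol (by linarith) (by linarith)⟩

lemma isTamePair_inhom {r σ : ℝ} (h0 : 5 / 4 ≤ σ) (hr : σ ≤ r) :
    IsTamePair (inhomSymbol r) (inhomSymbol (r + σ - 5 / 2)) :=
  ⟨isTame_inv_inhomSymbol (by linarith), isTame_coord_mul_inv_inhomSymbol (by linarith),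
    isTame_inv_inhomSymbol (by linarith)⟩

lemma isTarget_hom {s s' γ : ℝ} (hγ : γ = s - s') (h0 : 0 ≤ γ) (h2 : γ < 2) :
    IsTarget (homSymbol s) (homSymbol s') γ := by
  refine ⟨measurable_homSymbol s, fun p hp => homSymbol_pos s hp, fun p hp => ?_, h0, h2⟩
  have hp' := norm_pos_iff.2 hp
  have e : s = s' + γ := by linarith
  rw [homSymbol, homSymbol, e, Real.rpow_add hp']
  exact mul_le_mul_of_nonneg_left (Real.rpow_le_rpow hp'.le
    ((le_abs_self _).trans (abs_le_bracket _)) h0) (Real.rpow_nonneg hp'.le _)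

lemma isTarget_inhom {s s' γ : ℝ} (hγ : γ = s - s') (h0 : 0 ≤ γ) (h2 : γ < 2) :
    IsTarget (inhomSymbol s) (inhomSymbol s') γ := by
  refine ⟨measurable_inhomSymbol s, fun p _ => inhomSymbol_pos s p, fun p _ => ?_, h0, h2⟩
  have e : s = s' + γ := by linarith
  rw [inhomSymbol, inhomSymbol, e, Real.rpow_add (bracket_pos _)]

lemma isInitWeight_hom {σ r : ℝ} (h0 : 0 ≤ σ - r) (h2 : σ - r ≤ 2) :
    IsInitWeight (homSymbol σ) (homSymbol r) (σ - r) := by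
  refine ⟨measurable_homSymbol σ, measurable_homSymbol r, fun p hp => homSymbol_pos σ hp,
    fun p hp => homSymbol_pos r hp, fun p hp => ?_, h0, h2⟩
  rw [homSymbol, homSymbol, ← Real.rpow_add (norm_pos_iff.2 hp), add_sub_cancel]

lemma isInitWeight_inhom (r : ℝ) : IsInitWeight (inhomSymbol r) (inhomSymbol r) 0 :=
  ⟨measurable_inhomSymbol r, measurable_inhomSymbol r, fun p _ => inhomSymbol_pos r p,
    fun p _ => inhomSymbol_pos r p, fun p _ => by simp, le_rfl, zero_le_two⟩

/-- A field in `L²` and in `Ḣ^r` is in `H^r`. -/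
lemma HasProfile.exists_inhom {r : ℝ} (hr : 0 ≤ r) {u : VDist} {h k : L2}
    (h1 : HasProfile (homSymbol r) u h) (h2 : HasProfile (fun _ => 1) u k) :
    ∃ l : L2, HasProfile (inhomSymbol r) u l := by
  have hsum : HasProfile (fun p => 1 + homSymbol r p) u (k + h) := by
    refine IsGivenBy.congr h1 ?_
    filter_upwards [IsGivenBy.ae_eq h1 h2, Lp.coeFn_add k h, ae_ne_zero] with ξ e1 e2 h0
    have hp := homSymbol_pos r (two_pi_smul_ne_zero h0)
    have hp1 : (homSymbol r ((2 * Real.pi) • ξ) : ℂ) ≠ 0 := by exact_mod_cast hp.ne'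
    have hp2 : (1 + homSymbol r ((2 * Real.pi) • ξ) : ℂ) ≠ 0 := by
      exact_mod_cast (show 1 + homSymbol r ((2 * Real.pi) • ξ) ≠ 0 by positivity)
    simp only [fieldFun, Complex.ofReal_one, inv_one, one_smul] at e1 ⊢
    rw [e2, Pi.add_apply, ← e1]
    have e3 : h ξ = (homSymbol r ((2 * Real.pi) • ξ) : ℂ) •
        (homSymbol r ((2 * Real.pi) • ξ) : ℂ)⁻¹ • h ξ := (smul_inv_smul₀ hp1 (h ξ)).symm
    generalize (homSymbol r ((2 * Real.pi) • ξ) : ℂ)⁻¹ • h ξ = g at e3 ⊢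
    rw [e3, Complex.ofReal_add, Complex.ofReal_one]
    nth_rewrite 2 [← one_smul ℂ g]
    rw [← add_smul, inv_smul_smul₀ hp2]
  refine ⟨_, hsum.mulOp (m := fun p => inhomSymbol r p * (1 + homSymbol r p)⁻¹) (C := 2 ^ r)
    (isBddSymbol_scalar ?_ fun p hp => ?_) (fun p _ => (inhomSymbol_pos r p).ne') fun p hp => ?_⟩
  · exact (measurable_inhomSymbol r).mul ((measurable_homSymbol r).const_add 1).inv
  · have hp1 := homSymbol_pos r hp
    have hp2 := inhomSymbol_pos r p
    rw [abs_of_pos (by positivity), ← div_eq_mul_inv, div_le_iff₀ (by positivity)]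
    have hle : bracket ‖p‖ ≤ 2 * max 1 ‖p‖ :=
      (bracket_le_one_add (norm_nonneg p)).trans
          (by linarith [le_max_left 1 ‖p‖, le_max_right 1 ‖p‖])
    refine (Real.rpow_le_rpow (bracket_pos _).le hle hr).trans ?_
    rw [Real.mul_rpow zero_le_two (by positivity)]
    refine mul_le_mul_of_nonneg_left ?_ (by positivity)
    rcases max_cases 1 ‖p‖ with ⟨e, -⟩ | ⟨e, -⟩ <;> rw [e]
    · rw [Real.one_rpow]; linarith
    · exact le_add_of_nonneg_left zero_le_one
  · have := homSymbol_pos r hp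
    rw [inv_mul_cancel_right₀ (by positivity)]

lemma MemL2.exists_hasProfile {u : VDist} (hu : MemL2 u) :
    ∃ k : L2, HasProfile (fun _ => 1) u k ∧ ‖k‖ = (normL2 u).toReal := by
  have h1 : ∀ f : L2, HasProfile (fun _ => 1) (f : VDist) (𝓕 f) := by
    intro f
    refine (isGivenBy_fourier_Lp f).congr (.of_forall fun ξ => ?_)
    simp [fieldFun]
  obtain ⟨f, rfl⟩ := hu
  refine ⟨𝓕 f, h1 f, ?_⟩
  have h2 : normL2 (f : VDist) = ‖f‖ₑ := by
    refine le_antisymm (iInf₂_le (f := fun (f' : L2) (_ : (f : VDist) = f') => ‖f'‖ₑ) f rfl)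
      (le_iInf₂ fun g hg => ?_)
    have h3 := h1 f
    rw [hg] at h3
    have h4 := h3.unique (fun _ _ => one_ne_zero) (h1 g)
    rw [← ofReal_norm, ← ofReal_norm, ← Lp.norm_fourier_eq f, h4, Lp.norm_fourier_eq]
  rw [h2, Lp.norm_fourier_eq, toReal_enorm]

/-! ### The time weights and the size of the constants -/

section Constants

variable {ρ σ ε T : ℝ}

lemma lam_eq {lam₀ t : ℝ} (ht : 0 ≤ t) : lam lam₀ T t = lam₀ / Real.sqrt T * Real.sqrt t := by
  rw [lam, Real.sqrt_div ht]
  ring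

lemma exp_neg_zetaFun_mul {c s₁ lam₀ t : ℝ} (ht : t ∈ Ioc 0 T) :
    Real.exp (-zetaFun c lam₀ T t) * t ^ s₁ = omega (lam₀ / Real.sqrt T) c s₁ t := by
  rw [zetaFun, omega, lam_eq ht.1.le]
  congr 1
  rw [neg_add, Real.exp_add, mul_pow, Real.sq_sqrt ht.1.le, Real.rpow_def_of_pos (bracket_pos _)]
  congr 2
  ring

lemma thetaFun_eq {lam₀ t : ℝ} (ht : t ∈ Icc 0 T) : thetaFun lam₀ T t = lam₀ / Real.sqrt T * t := by
  rw [thetaFun, lam_eq ht.1, mul_assoc, Real.mul_self_sqrt ht.1]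

lemma sq_lamZero_le (ρ ε T : ℝ) : lamZero ρ ε T ^ 2 ≤ |2 * ρ - 1 - ε| * |Real.log T| := by
  rw [lamZero, mul_pow, Real.sq_sqrt (abs_nonneg _)]
  refine mul_le_mul_of_nonneg_right ?_ (abs_nonneg _)
  rcases le_total 0 (2 * ρ - 1 - ε) with h | h
  · rw [Real.sq_sqrt h]
    exact le_abs_self _
  · rw [Real.sqrt_eq_zero_of_nonpos h]
    simp

/-- Powers of `⟨λ₀⟩` grow at most logarithmically as `T → 0`. -/
lemma exists_bracket_lamZero_le (ρ : ℝ) {ε n : ℝ} (hε : 0 < ε) (hn : 0 ≤ n) :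
    ∃ D : ℝ, 0 ≤ D ∧ ∀ T : ℝ, 0 < T → T ≤ 1 →
      bracket (lamZero ρ ε T) ^ n * T ^ (ε / 4) ≤ D * T ^ (ε / 8) := by
  set η := ε / (4 * (n + 1)) with hη
  have hη0 : 0 < η := by positivity
  set E := 1 + |2 * ρ - 1 - ε| / η with hE
  have hE0 : 0 ≤ E := by positivity
  refine ⟨E ^ (n / 2), by positivity, fun T hT hT1 => ?_⟩
  have h1 : bracket (lamZero ρ ε T) ^ 2 * T ^ η ≤ E := by
    have h2 := (Real.abs_log_mul_self_rpow_lt T η hT hT1 hη0).le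
    rw [abs_mul, abs_of_pos (Real.rpow_pos_of_pos hT η)] at h2
    have h3 : T ^ η ≤ 1 := Real.rpow_le_one hT.le hT1 hη0.le
    have h4 := mul_le_mul_of_nonneg_right (sq_lamZero_le ρ ε T) (Real.rpow_nonneg hT.le η)
    have h5 := mul_le_mul_of_nonneg_left h2 (abs_nonneg (2 * ρ - 1 - ε))
    rw [sq_bracket, hE, add_mul, one_mul, div_eq_mul_one_div]
    linarith
  have hb := bracket_pos (lamZero ρ ε T)
  have h2 := Real.rpow_le_rpow (by positivity) h1 (show 0 ≤ n / 2 by positivity)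
  rw [Real.mul_rpow (by positivity) (by positivity), ← Real.rpow_natCast, ← Real.rpow_mul hb.le,
    ← Real.rpow_mul hT.le] at h2
  have e1 : ((2 : ℕ) : ℝ) * (n / 2) = n := by push_cast; ring
  rw [e1] at h2
  have e2 : T ^ (ε / 4) = T ^ (ε / 8) * T ^ (ε / 8) := by
    rw [← Real.rpow_add hT]
    ring_nf
  have h3 : T ^ (ε / 8) ≤ T ^ (η * (n / 2)) := by
    refine Real.rpow_le_rpow_of_exponent_ge hT hT1 ?_
    rw [hη, div_mul_div_comm, div_le_div_iff₀ (by positivity) (by norm_num)]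
    nlinarith
  rw [e2, ← mul_assoc]
  refine mul_le_mul_of_nonneg_right (le_trans ?_ h2) (Real.rpow_nonneg hT.le _)
  exact mul_le_mul_of_nonneg_left h3 (Real.rpow_nonneg hb.le _)

/-- The factor `e^{λ₀²/4}` is the power of `1/T` in the asserted bounds. -/
lemma exp_lamZero_sq (hρ : ε ≤ 2 * ρ - 1) (hT : 0 < T) (hT1 : T ≤ 1) :
    Real.exp (lamZero ρ ε T ^ 2 / 4) = T ^ (-(ρ / 2 - 1 / 4 - ε / 4)) := by
  rw [lamZero, mul_pow, Real.sq_sqrt (abs_nonneg _), Real.sq_sqrt (by linarith),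
    abs_of_nonpos (Real.log_nonpos hT.le hT1), Real.rpow_def_of_pos hT]
  congr 1
  ring

/-- The constant of the bilinear estimate times the power of `T` available to compensate it. -/
lemma exists_bilinConst_le (M : Matrix (Fin 3) (Fin 3) ℝ) {C γ c q : ℝ} (hρ : ε ≤ 2 * ρ - 1)
    (hε : 0 < ε) (hC : 0 ≤ C) (hγ : 0 ≤ γ) (hγ2 : γ < 2) (hc : 0 ≤ c) (hq : q < 1) :
    ∃ D : ℝ, 0 ≤ D ∧ ∀ T : ℝ, 0 < T → T ≤ 1 →
      bilinConst M C γ c q (lamZero ρ ε T / Real.sqrt T) T * T ^ (ρ / 2 - 1 / 4) ≤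
        D * T ^ (ε / 8) := by
  obtain ⟨D, hD, hle⟩ := exists_bracket_lamZero_le ρ hε (show 0 ≤ γ + 2 * c by positivity)
  have hs := singConst_nonneg (κ := γ / 2) (by linarith) hq
  have hm := matConst_nonneg M
  refine ⟨4 * (matConst M * C) * singConst (γ / 2) q * D, by positivity, fun T hT hT1 => ?_⟩
  have hsT := Real.sqrt_pos.2 hT
  have e1 : lamZero ρ ε T / Real.sqrt T * Real.sqrt T = lamZero ρ ε T :=
    div_mul_cancel₀ _ hsT.ne'
  have e2 : (lamZero ρ ε T / Real.sqrt T) ^ 2 * T = lamZero ρ ε T ^ 2 := by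
    conv_rhs => rw [← e1, mul_pow, Real.sq_sqrt hT.le]
  have e3 : T ^ (-(ρ / 2 - 1 / 4 - ε / 4)) * T ^ (ρ / 2 - 1 / 4) = T ^ (ε / 4) := by
    rw [← Real.rpow_add hT]
    ring_nf
  rw [bilinConst, duhamelConst, e1, e2, exp_lamZero_sq hρ hT hT1]
  calc _ = 4 * (matConst M * C) * singConst (γ / 2) q * ((bracket (lamZero ρ ε T) ^ γ *
        bracket (lamZero ρ ε T) ^ (2 * c)) *
          (T ^ (-(ρ / 2 - 1 / 4 - ε / 4)) * T ^ (ρ / 2 - 1 / 4))) := by ring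
    _ ≤ 4 * (matConst M * C) * singConst (γ / 2) q * (D * T ^ (ε / 8)) := by
        rw [e3, ← Real.rpow_add (bracket_pos _)]
        exact mul_le_mul_of_nonneg_left (hle T hT hT1) (by positivity)
    _ = _ := by ring

end Constants

end

end NSE
namespace NSE

noncomputable section

/-! ### The solution for given weights -/

variable {M : Matrix (Fin 3) (Fin 3) ℝ} {P : Space → Vec →L[ℂ] Vec} {a b d : Space → ℝ}
  {C ρ σ ε : ℝ}

/-- Radial weights `a` for the solution, `b` for the advection term and `d` for the data, which
scale like the weights of order `σ`, `2σ - 5/2` and `ρ`. -/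
structure IsWeightSystem (a b d : Space → ℝ) (C ρ σ : ℝ) : Prop where
  pair : IsWeightPair a b C
  tame : IsTamePair a b
  target : IsTarget a b (5 / 2 - σ)
  init : IsInitWeight a d (σ - ρ)
  even_a : ∀ p, a (-p) = a p
  even_b : ∀ p, b (-p) = b p
  even_d : ∀ p, d (-p) = d p

/-- On a time interval of a length that depends on the size of the data only, the smallness
required by the fixed point argument holds. -/
lemma IsWeightSystem.exists_small (M : Matrix (Fin 3) (Fin 3) ℝ)
    (hw : IsWeightSystem a b d C ρ σ) (hρ : 1 / 2 < ρ) (hσ : σ < 3 / 2) (hε : 0 < ε)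
    (hερ : ε ≤ 2 * ρ - 1) :
    ∃ T₀ : ℝ → ℝ, (∀ K, 0 < T₀ K ∧ T₀ K ≤ 1) ∧ ∀ K T : ℝ, 0 < T → T ≤ T₀ K →
      32 * bilinConst M C (5 / 2 - σ) (σ - ρ) (2 * (σ / 2 - ρ / 4 - 1 / 8))
        (lamZero ρ ε T / Real.sqrt T) T * T ^ (ρ / 2 - 1 / 4) * K ≤ 1 := by
  obtain ⟨D, hD, hle⟩ := exists_bilinConst_le (C := C) (γ := 5 / 2 - σ) (c := σ - ρ)
    (q := 2 * (σ / 2 - ρ / 4 - 1 / 8)) M hερ hε hw.pair.nonneg hw.target.nonneg hw.target.lt_two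
    hw.init.nonneg (by linarith)
  have hE : ∀ K : ℝ, 0 < 32 * D * |K| + 1 := fun K => by positivity
  refine ⟨fun K => min 1 ((32 * D * |K| + 1)⁻¹ ^ (8 / ε)), fun K => ⟨lt_min one_pos
    (Real.rpow_pos_of_pos (inv_pos.2 (hE K)) _), min_le_left _ _⟩, fun K T hT hTK => ?_⟩
  have h1 := hle T hT (hTK.trans (min_le_left _ _))
  have h2 : T ^ (ε / 8) ≤ (32 * D * |K| + 1)⁻¹ := by
    refine (Real.rpow_le_rpow hT.le (hTK.trans (min_le_right _ _)) (by positivity)).trans_eq ?_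
    rw [← Real.rpow_mul (inv_pos.2 (hE K)).le, div_mul_div_comm, mul_comm 8 ε,
      div_self (by positivity), Real.rpow_one]
  have hb := bilinConst_nonneg (M := M) (γ := 5 / 2 - σ) (c := σ - ρ)
    (q := 2 * (σ / 2 - ρ / 4 - 1 / 8)) (μ := lamZero ρ ε T / Real.sqrt T) (T := T) hw.pair
    hw.target.lt_two (by linarith)
  have hTp := Real.rpow_nonneg hT.le (ρ / 2 - 1 / 4)
  calc _ ≤ 32 * bilinConst M C (5 / 2 - σ) (σ - ρ) (2 * (σ / 2 - ρ / 4 - 1 / 8))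
        (lamZero ρ ε T / Real.sqrt T) T * T ^ (ρ / 2 - 1 / 4) * |K| :=
        mul_le_mul_of_nonneg_left (le_abs_self K) (by positivity)
    _ ≤ 32 * |K| * (D * (32 * D * |K| + 1)⁻¹) := by
        have := mul_le_mul_of_nonneg_left (h1.trans (mul_le_mul_of_nonneg_left h2 hD))
          (show 0 ≤ 32 * |K| by positivity)
        linarith
    _ ≤ 1 := by
        rw [← mul_assoc, ← div_eq_mul_inv, div_le_one (hE K)]
        linarith

/-- Existence, uniqueness and regularity with respect to every admissible weight `d'`. -/
theorem IsWeightSystem.exists_solution (M : Matrix (Fin 3) (Fin 3) ℝ)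
    (hw : IsWeightSystem a b d C ρ σ) (hP : IsBddSymbol P 1) (hρ : 1 / 2 < ρ) (hσ' : 5 / 4 ≤ σ)
    (hσ : σ < 3 / 2) (hε : 0 < ε) (hερ : ε ≤ 2 * ρ - 1) :
    ∃ T₀ D : ℝ → ℝ, (∀ K, 0 < T₀ K) ∧ ∀ (u₀ : VDist) (k : L2), HasProfile d u₀ k →
      ∀ T : ℝ, 0 < T → T ≤ T₀ ‖k‖ →
      ∀ s₁ c : ℝ, s₁ = σ / 2 - ρ / 4 - 1 / 8 → c = σ - ρ →
      ∀ θ ζ : ℝ → ℝ, θ = thetaFun (lamZero ρ ε T) T → ζ = zetaFun c (lamZero ρ ε T) T →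
      ∃ Y X : ℝ → VDist, IsHeatFlow u₀ T Y ∧ MemB ζ θ T s₁ a Y ∧
        IsUniqueSolInBall M P ζ θ T s₁ a Y X ∧ MemB0 ζ θ T s₁ a X ∧ X 0 = u₀ ∧
        (∀ (d' : Space → ℝ) (γ' : ℝ) (k' : L2), IsTarget d' b γ' → (IsTame fun p => (d' p)⁻¹) →
          γ' ≤ ρ - 2 * σ + 5 / 2 → HasProfile d' u₀ k' →
          DefinesBC (Icc 0 T) (fun t p => expSymbol (θ t) p * d' p) X ∧
          ∀ t ∈ Ioc 0 T, multNorm (fun p => expSymbol (θ t) p * d' p) (X t) ≤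
            ENNReal.ofReal ((‖k'‖ + D γ' * ‖k‖ ^ 2) * T ^ (-(ρ / 2 - 1 / 4 - ε / 4)))) ∧
        (IsRealSymbol P → IsReal u₀ → ∀ t ∈ Icc 0 T, IsReal (X t)) := by
  have hex : ∀ γ' : ℝ, ∃ D : ℝ, 0 ≤ γ' → γ' < 2 → 0 ≤ D ∧ ∀ T : ℝ, 0 < T → T ≤ 1 →
      bilinConst M C γ' (σ - ρ) (σ - ρ) (lamZero ρ ε T / Real.sqrt T) T * T ^ (ρ / 2 - 1 / 4) ≤
        D * T ^ (ε / 8) := by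
    intro γ'
    by_cases h : 0 ≤ γ' ∧ γ' < 2
    · obtain ⟨D, hD⟩ := exists_bilinConst_le (c := σ - ρ) (q := σ - ρ) M hερ hε hw.pair.nonneg
        h.1 h.2 hw.init.nonneg (by linarith)
      exact ⟨D, fun _ _ => hD⟩
    · exact ⟨0, fun h1 h2 => absurd ⟨h1, h2⟩ h⟩
  choose D hD using hex
  obtain ⟨T₀, hT₀, hsmall⟩ := hw.exists_small M hρ hσ hε hερ
  refine ⟨T₀, fun γ' => 36 * D γ', fun K => (hT₀ K).1, ?_⟩
  rintro u₀ k hu T hT hTk s₁ c hs₁ rfl θ ζ rfl rfl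
  have hT1 := hTk.trans (hT₀ _).2
  set μ := lamZero ρ ε T / Real.sqrt T with hμ
  have hμ2 : μ ^ 2 * T = lamZero ρ ε T ^ 2 := by
    rw [hμ, div_pow, Real.sq_sqrt hT.le, div_mul_cancel₀ _ hT.ne']
  have hs : IsSetup P a b d C (5 / 2 - σ) μ (σ - ρ) s₁ T :=
    { pair := hw.pair
      tame := hw.tame
      target := hw.target
      init := hw.init
      proj := hP
      nonneg_μ := div_nonneg (mul_nonneg (Real.sqrt_nonneg _) (Real.sqrt_nonneg _))
        (Real.sqrt_nonneg _)
      pos_T := hT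
      T_le := hT1
      c_lt := by linarith
      s₁_nonneg := by linarith [hw.init.nonneg]
      s₁_lt := by linarith
      pos_δ := by linarith
      scaling := by rw [hs₁]; ring }
  obtain ⟨N, f, hf, hN⟩ := hs.exists_solProfile (M := M) (k := k) (by
    have e : 2 * (s₁ - (σ - ρ) / 2) = ρ / 2 - 1 / 4 := by rw [hs₁]; ring
    rw [e, hs₁]
    exact hsmall ‖k‖ T hT hTk)
  obtain ⟨Y, X, hY, hYB, hX, hX0, hXu, hXf, hsol⟩ := hf.exists_solution hN
    (θ := thetaFun (lamZero ρ ε T) T) (ζ := zetaFun (σ - ρ) (lamZero ρ ε T) T)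
    (fun t ht => thetaFun_eq (Ioc_subset_Icc_self ht)) (fun t ht => exp_neg_zetaFun_mul ht) hu
  refine ⟨Y, X, hY, hYB, hX, hX0, hXu, ?_, ?_⟩
  · intro d' γ' k' hd htd hγ hu'
    obtain ⟨h1, h2⟩ := hf.regularity hd htd (by linarith) hu'
      (θ := thetaFun (lamZero ρ ε T) T) (fun t ht => thetaFun_eq ht) hXu hY hXf hsol
    refine ⟨h1, fun t ht => (h2 t ht).trans (ENNReal.ofReal_le_ofReal ?_)⟩
    obtain ⟨hD0, hD1⟩ := hD γ' hd.nonneg hd.lt_two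
    rw [hμ2, exp_lamZero_sq hερ hT hT1, mul_comm]
    refine mul_le_mul_of_nonneg_right ?_ (Real.rpow_nonneg hT.le _)
    have hb := bilinConst_nonneg (M := M) (γ := γ') (c := σ - ρ) (q := σ - ρ) (μ := μ) (T := T)
      hw.pair hd.lt_two (by linarith)
    have h3 : bilinConst M C γ' (σ - ρ) (σ - ρ) μ T * T ^ (1 - γ' / 2 - (σ - ρ)) ≤ D γ' := by
      calc _ ≤ bilinConst M C γ' (σ - ρ) (σ - ρ) μ T * T ^ (ρ / 2 - 1 / 4) :=
            mul_le_mul_of_nonneg_left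
              (Real.rpow_le_rpow_of_exponent_ge hT hT1 (by linarith)) hb
        _ ≤ D γ' * T ^ (ε / 8) := hD1 T hT hT1
        _ ≤ D γ' := mul_le_of_le_one_right hD0 (Real.rpow_le_one hT.le hT1 (by positivity))
    have h4 := mul_le_mul_of_nonneg_right h3 (show 0 ≤ 36 * ‖k‖ ^ 2 by positivity)
    linarith
  · intro hPr hur t ht
    rcases ht.1.eq_or_lt with rfl | ht0
    · rw [hXu]
      exact hur
    have ht' : t ∈ Ioc 0 T := ⟨ht0, ht.2⟩
    have hk : reflConj k = k := hu.reflConj_eq_of_isReal hw.even_d hw.init.pos_d hur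
    have hft := hf.reflConj_eq hPr hw.even_a hw.even_b hw.even_d hk ht'
    refine (hXf t ht').isReal (fun p => ?_) ?_
    · rw [expSymbol, expSymbol, norm_neg, hw.even_a]
    · rw [unweight, reflConj_smul, hft]

lemma isWeightSystem_hom {r σ : ℝ} (h0 : 5 / 4 ≤ σ) (h1 : σ < 3 / 2) (hr : r ≤ σ)
    (hr' : 1 / 2 < r) :
    ∃ C, IsWeightSystem (homSymbol σ) (homSymbol (2 * σ - 5 / 2)) (homSymbol r) C r σ := by
  obtain ⟨C, hC⟩ := exists_isWeightPair_hom h0 h1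
  exact ⟨C, hC, isTamePair_hom h0 h1, isTarget_hom (by ring) (by linarith) (by linarith),
    isInitWeight_hom (by linarith) (by linarith), fun p => by simp [homSymbol],
    fun p => by simp [homSymbol], fun p => by simp [homSymbol]⟩

lemma isWeightSystem_inhom {r σ : ℝ} (h0 : 5 / 4 ≤ σ) (h1 : σ < 3 / 2) (hr : σ ≤ r) :
    ∃ C, IsWeightSystem (inhomSymbol r) (inhomSymbol (r + σ - 5 / 2)) (inhomSymbol r) C σ σ := by
  obtain ⟨C, hC⟩ := exists_isWeightPair_inhom h0 h1 hr
  exact ⟨C, hC, isTamePair_inhom h0 hr, isTarget_inhom (by ring) (by linarith) (by linarith),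
    by rw [sub_self]; exact isInitWeight_inhom r, fun p => by simp [inhomSymbol],
    fun p => by simp [inhomSymbol], fun p => by simp [inhomSymbol]⟩

/-- The profile of a field in a Sobolev space; its norm is that of the field. -/
lemma exists_hasProfile_of_isMultiplier {d : Space → ℝ} (hd : ∀ p, p ≠ 0 → d p ≠ 0) {u : VDist}
    (hu : ∃ f : L2, IsMultiplier (scalarSymbol d) u f) :
    ∃ k : L2, HasProfile d u k ∧ ‖k‖ = (multNorm d u).toReal := by
  obtain ⟨f, hf⟩ := hu
  have h := (isMultiplier_iff_hasProfile hd).1 hf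
  exact ⟨_, h, by rw [h.multNorm_eq hd, toReal_enorm]⟩

end

end NSE

theorem mainTheorem4
    (M : Matrix (Fin 3) (Fin 3) ℝ)
    (P : NSE.Space → NSE.Vec →L[ℂ] NSE.Vec)
    (hPmeas : AEStronglyMeasurable P volume)
    (hPproj : ∀ᵐ p, IsStarProjection (P p)) :
    -- Part (i)
    (∀ r ε : ℝ, 1 / 2 < r → r < 3 / 2 → 0 < ε → ε ≤ 2 * r - 1 →
      ∃ (T₀ C : ℝ → ℝ) (C' : ℝ → ℝ → ℝ), (∀ K, 0 < T₀ K) ∧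
      ∀ u₀ : NSE.VDist, NSE.MemHdot r u₀ →
      ∀ T : ℝ, 0 < T → T ≤ T₀ (NSE.multNorm (NSE.homSymbol r) u₀).toReal →
      let rt : ℝ := max r (5 / 4)
      let s₁ : ℝ := rt / 2 - r / 4 - 1 / 8
      let s₂ : ℝ := rt
      let lam₀ : ℝ := NSE.lamZero r ε T
      let θ : ℝ → ℝ := NSE.thetaFun lam₀ T
      let ζ : ℝ → ℝ := NSE.zetaFun (rt - r) lam₀ T
      ∃ Y X : ℝ → NSE.VDist,
        NSE.IsHeatFlow u₀ T Y ∧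
        NSE.MemB ζ θ T s₁ (NSE.homSymbol s₂) Y ∧
        NSE.IsUniqueSolInBall M P ζ θ T s₁ (NSE.homSymbol s₂) Y X ∧
        NSE.MemB0 ζ θ T s₁ (NSE.homSymbol s₂) X ∧
        NSE.DefinesBC (Icc 0 T)
          (fun t p => NSE.expSymbol (θ t) p * NSE.homSymbol r p) X ∧
        X 0 = u₀ ∧
        (∀ t ∈ Ioc 0 T,
          NSE.multNorm (fun p => NSE.expSymbol (θ t) p * NSE.homSymbol r p) (X t) ≤
            ENNReal.ofReal (C (NSE.multNorm (NSE.homSymbol r) u₀).toReal *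
              T ^ (-(r / 2 - 1 / 4 - ε / 4)))) ∧
        (NSE.MemL2 u₀ → r ≤ 5 / 4 →
          NSE.DefinesBC (Icc 0 T)
            (fun t p => NSE.expSymbol (θ t) p * NSE.inhomSymbol r p) X ∧
          ∀ t ∈ Ioc 0 T,
            NSE.multNorm (NSE.expSymbol (θ t)) (X t) ≤
              ENNReal.ofReal (C' (NSE.multNorm (NSE.homSymbol r) u₀).toReal
                  (NSE.normL2 u₀).toReal *
                T ^ (-(r / 2 - 1 / 4 - ε / 4)))) ∧
        (NSE.IsRealSymbol P → NSE.IsReal u₀ → ∀ t ∈ Icc 0 T, NSE.IsReal (X t))) ∧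
    -- Part (ii)
    (∀ r rt ε : ℝ, 5 / 4 ≤ r → 5 / 4 ≤ rt → rt < 3 / 2 → rt ≤ r → 0 < ε → ε ≤ 2 * rt - 1 →
      ∃ T₀ C : ℝ → ℝ, (∀ K, 0 < T₀ K) ∧
      ∀ u₀ : NSE.VDist, NSE.MemH r u₀ →
      ∀ T : ℝ, 0 < T → T ≤ T₀ (NSE.multNorm (NSE.inhomSymbol r) u₀).toReal →
      let s₁ : ℝ := rt / 4 - 1 / 8
      let s₂ : ℝ := r
      let lam₀ : ℝ := NSE.lamZero rt ε T
      let θ : ℝ → ℝ := NSE.thetaFun lam₀ T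
      let ζ : ℝ → ℝ := NSE.zetaFun 0 lam₀ T
      ∃ Y X : ℝ → NSE.VDist,
        NSE.IsHeatFlow u₀ T Y ∧
        NSE.MemB ζ θ T s₁ (NSE.inhomSymbol s₂) Y ∧
        NSE.IsUniqueSolInBall M P ζ θ T s₁ (NSE.inhomSymbol s₂) Y X ∧
        NSE.MemB0 ζ θ T s₁ (NSE.inhomSymbol s₂) X ∧
        NSE.DefinesBC (Icc 0 T)
          (fun t p => NSE.expSymbol (θ t) p * NSE.inhomSymbol r p) X ∧
        X 0 = u₀ ∧
        (∀ t ∈ Ioc 0 T,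
          NSE.multNorm (fun p => NSE.expSymbol (θ t) p * NSE.inhomSymbol r p) (X t) ≤
            ENNReal.ofReal (C (NSE.multNorm (NSE.inhomSymbol r) u₀).toReal *
              T ^ (-(rt / 2 - 1 / 4 - ε / 4)))) ∧
        (NSE.IsRealSymbol P → NSE.IsReal u₀ → ∀ t ∈ Icc 0 T, NSE.IsReal (X t))) := by
  have hP := NSE.isBddSymbol_of_isStarProjection hPmeas hPproj
  refine ⟨fun r ε hr hr2 hε hεr => ?_, fun r rt ε hr hrt hrt2 hrtr hε hεr => ?_⟩
  · have hσ : max r (5 / 4) < 3 / 2 := max_lt hr2 (by norm_num)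
    obtain ⟨C, hw⟩ := NSE.isWeightSystem_hom (le_max_right r (5 / 4)) hσ (le_max_left _ _) hr
    obtain ⟨T₀, D, hT₀, H⟩ := hw.exists_solution M hP hr (le_max_right _ _) hσ hε hεr
    refine ⟨T₀, fun K => K + D (r - (2 * max r (5 / 4) - 5 / 2)) * K ^ 2,
      fun K K₂ => K₂ + D 0 * K ^ 2, hT₀, fun u₀ hu₀ T hT hTK => ?_⟩
    obtain ⟨k, hk, hkn⟩ := NSE.exists_hasProfile_of_isMultiplier
      (fun p hp => (NSE.homSymbol_pos r hp).ne') hu₀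
    rw [← hkn] at hTK ⊢
    intro rt s₁ s₂ lam₀ θ ζ
    obtain ⟨Y, X, hY, hYB, hX, hX0, hXu, hreg, hreal⟩ :=
      H u₀ k hk T hT hTK s₁ (rt - r) rfl rfl θ ζ rfl rfl
    have hmax : 2 * max r (5 / 4) - 5 / 2 ≤ r := by
      rcases max_cases r (5 / 4) with ⟨e, -⟩ | ⟨e, -⟩ <;> rw [e] <;> linarith
    have hmax' := le_max_right r (5 / 4)
    obtain ⟨h1, h2⟩ := hreg (NSE.homSymbol r) (r - (2 * max r (5 / 4) - 5 / 2)) k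
      (NSE.isTarget_hom rfl (by linarith) (by linarith))
      (NSE.isTame_inv_homSymbol (by linarith) hr2) (by linarith) hk
    refine ⟨Y, X, hY, hYB, hX, hX0, h1, hXu, h2, fun hL2 hr54 => ?_, hreal⟩
    obtain ⟨k₂, hk₂, hk₂n⟩ := hL2.exists_hasProfile
    obtain ⟨l, hl⟩ := hk.exists_inhom (by linarith) hk₂
    -- for `r ≤ 5/4` the advection term is measured with the trivial weight
    have hone : NSE.homSymbol (2 * max r (5 / 4) - 5 / 2) = NSE.inhomSymbol 0 := by
      funext p
      rw [NSE.homSymbol, NSE.inhomSymbol, max_eq_right hr54, Real.rpow_zero]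
      norm_num
    have hone' : NSE.inhomSymbol 0 = fun _ => 1 := by
      funext p
      rw [NSE.inhomSymbol, Real.rpow_zero]
    rw [hone] at hreg
    have hm := max_eq_right hr54
    rw [← hone'] at hk₂
    refine ⟨(hreg _ r l (NSE.isTarget_inhom (sub_zero r).symm (by linarith) (by linarith))
      (NSE.isTame_inv_inhomSymbol (by linarith)) (by linarith) hl).1, fun t ht => ?_⟩
    have h3 := (hreg _ 0 k₂ (NSE.isTarget_inhom (sub_zero 0).symm le_rfl two_pos)
      (NSE.isTame_inv_inhomSymbol le_rfl) (by linarith) hk₂).2 t ht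
    rw [hk₂n] at h3
    simpa only [hone', mul_one] using h3
  · obtain ⟨C, hw⟩ := NSE.isWeightSystem_inhom hrt hrt2 hrtr
    obtain ⟨T₀, D, hT₀, H⟩ := hw.exists_solution M hP (by linarith) hrt hrt2 hε hεr
    refine ⟨T₀, fun K => K + D (5 / 2 - rt) * K ^ 2, hT₀, fun u₀ hu₀ T hT hTK => ?_⟩
    obtain ⟨k, hk, hkn⟩ := NSE.exists_hasProfile_of_isMultiplier
      (fun p _ => (NSE.inhomSymbol_pos r p).ne') hu₀
    rw [← hkn] at hTK ⊢
    intro s₁ s₂ lam₀ θ ζ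
    obtain ⟨Y, X, hY, hYB, hX, hX0, hXu, hreg, hreal⟩ :=
      H u₀ k hk T hT hTK s₁ 0 (show rt / 4 - 1 / 8 = _ by ring) (sub_self rt).symm θ ζ rfl rfl
    obtain ⟨h1, h2⟩ := hreg (NSE.inhomSymbol r) (5 / 2 - rt) k
      (NSE.isTarget_inhom (by ring) (by linarith) (by linarith))
      (NSE.isTame_inv_inhomSymbol (by linarith)) (by linarith) hk
    exact ⟨Y, X, hY, hYB, hX, hX0, h1, hXu, h2, hreal⟩
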